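/- Let $\Omega\subseteq\mathbb R^N$ be open and let $g_1^{ij}(x)$, $g_2^{ij}(x)$ be two smooth contravariant Riemannian or pseudo-Riemannian metrics on $\Omega$ (smooth symmetric matrix functions with nowhere vanishing determinant). For a contravariant metric $g^{ij}$ with inverse $g_{ij}$ put $$\Gamma^i_{jk}=\tfrac12 g^{is}\Big(\frac{\partial g_{sk}}{\partial x^j}+\frac{\partial g_{js}}{\partial x^k}-\frac{\partial g_{jk}}{\partial x^s}\Big),\qquad \Gamma^{ij}_k=g^{is}\Gamma^j_{sk},$$ $$R^i_{jkl}=\frac{\partial\Gamma^i_{jl}}{\partial x^k}-\frac{\partial\Gamma^i_{jk}}{\partial x^l}+\Gamma^i_{pk}\Gamma^p_{jl}-\Gamma^i_{pl}\Gamma^p_{jk},\qquad R^{ij}_{kl}=g^{is}R^j_{skl}.$$ The metrics are called *compatible* if for all real constants $\lambda_1,\lambda_2$ the metric $g^{ij}=\lambda_1g_1^{ij}+\lambda_2g_2^{ij}$ satisfies, at every point where it is nondegenerate, $$\Gamma^{ij}_k=\lambda_1\Gamma^{ij}_{1,k}+\lambda_2\Gamma^{ij}_{2,k},\qquad R^{ij}_{kl}=\lambda_1R^{ij}_{1,kl}+\lambda_2R^{ij}_{2,kl}.$$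 The pair is called *nonsingular* if at every point the equation $\det(g_1^{ij}-\mu g_2^{ij})=0$ has $N$ distinct complex roots $\mu$. Local coordinates $u=(u^1,\dots,u^N)$ are allowed to be complex in the following sense: the $u^i$ are smooth complex-valued functions on an open set $U$ with $\det(\partial u^i/\partial x^k)\neq0$ on $U$, the map $u$ is injective on $U$, and for some involution $\sigma$ of $\{1,\dots,N\}$ one has $u^{\sigma(i)}=\overline{u^i}$; so each $u^i$ is either real ($\sigma(i)=i$) or paired with its complex conjugate. The pair *has diagonal form* in such coordinates on $U$ if $$g_2^{ij}(u)=g^i(u)\,\delta^{ij},\qquad g_1^{ij}(u)=f^i(u^i)\,g^i(u)\,\delta^{ij},$$ where $g_a^{ij}(u)=\frac{\partial u^i}{\partial x^k}g_a^{kl}\frac{\partial u^j}{\partial x^l}$ and each $f^i$ is a function of the single variable $u^i$: a smooth function of the real variable $u^i$ if $u^i$ is real, a holomorphic function of $u^i$ if $\sigma(i)\ne i$. Then: 1. A nonsingular pair $g_1,g_2$ is compatible on $\Omega$ if and only if every point of $\Omega$ has a neighbourhood $U\subseteq\Omega$ with local coordinates in which the pair has diagonal form. 2. If every point of $\Omega$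 has a neighbourhood $U\subseteq\Omega$ with local coordinates in which the pair has diagonal form, then $g_1,g_2$ are compatible, even if the pair is singular. 3. Whenever the pair has diagonal form on $U\subseteq\Omega$, the functions $f^i(u^i)$ vanish nowhere on $U$; if the pair is nonsingular, then $f^i(u^i)\neq f^j(u^j)$ everywhere on $U$ for $i\neq j$. -/

import Mathlib

open scoped ContDiff

noncomputable section

namespace MetricPencil

/-- The coordinate space with coordinates `x^1, …, x^N`. -/
abbrev Coord (N : ℕ) : Type := Fin N → ℝ

/-- The partial derivative `∂F/∂x^k` at `x`. -/
def pd {N : ℕ} {F : Type*} [NormedAddCommGroup F] [NormedSpace ℝ F]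
    (k : Fin N) (h : Coord N → F) (x : Coord N) : F :=
  fderiv ℝ h x (Pi.single k 1)

/-- A smooth (Riemannian or pseudo-Riemannian) contravariant metric `g^{ij}` on `Ω`. -/
structure IsMetric {N : ℕ} (Ω : Set (Coord N)) (G : Coord N → Matrix (Fin N) (Fin N) ℝ) :
    Prop where
  smooth : ∀ i j, ContDiffOn ℝ ∞ (fun x => G x i j) Ω
  symm : ∀ x ∈ Ω, (G x).IsSymm
  nondegenerate : ∀ x ∈ Ω, (G x).det ≠ 0

/-- `Γ^i_{jk}` of the Levi-Civita connection of the contravariant metric `G = (g^{ij})`;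
the covariant components `g_{ij}` are the entries of the inverse matrix. -/
def christoffel {N : ℕ} (G : Coord N → Matrix (Fin N) (Fin N) ℝ) (i j k : Fin N)
    (x : Coord N) : ℝ :=
  (1 / 2) * ∑ s, G x i s *
    (pd j (fun y => (G y)⁻¹ s k) x + pd k (fun y => (G y)⁻¹ j s) x
      - pd s (fun y => (G y)⁻¹ j k) x)

/-- `Γ^{ij}_k = g^{is} Γ^j_{sk}`. -/
def christoffelUp {N : ℕ} (G : Coord N → Matrix (Fin N) (Fin N) ℝ) (i j k : Fin N)
    (x : Coord N) : ℝ :=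
  ∑ s, G x i s * christoffel G j s k x

/-- `R^i_{jkl}`, the Riemann curvature tensor of the Levi-Civita connection of `G`. -/
def riemann {N : ℕ} (G : Coord N → Matrix (Fin N) (Fin N) ℝ) (i j k l : Fin N)
    (x : Coord N) : ℝ :=
  pd k (christoffel G i j l) x - pd l (christoffel G i j k) x
    + ∑ p, (christoffel G i p k x * christoffel G p j l x
      - christoffel G i p l x * christoffel G p j k x)

/-- `R^{ij}_{kl} = g^{is} R^j_{skl}`. -/
def riemannUp {N : ℕ} (G : Coord N → Matrix (Fin N) (Fin N) ℝ) (i j k l : Fin N)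
    (x : Coord N) : ℝ :=
  ∑ s, G x i s * riemann G j s k l x

/-- The linear combination `l₁ g₁^{ij} + l₂ g₂^{ij}` with constant coefficients. -/
def pencil {N : ℕ} (l₁ l₂ : ℝ) (G₁ G₂ : Coord N → Matrix (Fin N) (Fin N) ℝ) :
    Coord N → Matrix (Fin N) (Fin N) ℝ :=
  fun x => l₁ • G₁ x + l₂ • G₂ x

/-- Compatible metrics: for every linear combination, the connection coefficients `Γ^{ij}_k` and
the curvature components `R^{ij}_{kl}` are given by the same linear combination, wherever the
combined metric is nondegenerate (that is, wherever its connection and curvature are defined; a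
combination whose determinant vanishes identically gives no condition). -/
def Compatible {N : ℕ} (Ω : Set (Coord N)) (G₁ G₂ : Coord N → Matrix (Fin N) (Fin N) ℝ) : Prop :=
  ∀ l₁ l₂ : ℝ, ∀ x ∈ Ω, (pencil l₁ l₂ G₁ G₂ x).det ≠ 0 →
    (∀ i j k, christoffelUp (pencil l₁ l₂ G₁ G₂) i j k x =
      l₁ * christoffelUp G₁ i j k x + l₂ * christoffelUp G₂ i j k x) ∧
    (∀ i j k l, riemannUp (pencil l₁ l₂ G₁ G₂) i j k l x =
      l₁ * riemannUp G₁ i j k l x + l₂ * riemannUp G₂ i j k l x)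

/-- A real matrix regarded as a complex one. -/
def complexify {N : ℕ} (A : Matrix (Fin N) (Fin N) ℝ) : Matrix (Fin N) (Fin N) ℂ :=
  A.map (fun a : ℝ => (a : ℂ))

/-- Nonsingular pair: at every point the equation `det (g₁ - μ g₂) = 0`, of degree `N` in `μ`,
has `N` distinct (complex) roots. -/
def IsNonsingularPair {N : ℕ} (Ω : Set (Coord N))
    (G₁ G₂ : Coord N → Matrix (Fin N) (Fin N) ℝ) : Prop :=
  ∀ x ∈ Ω, {μ : ℂ | (complexify (G₁ x) - μ • complexify (G₂ x)).det = 0}.ncard = N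

/-- The Jacobian matrix `∂u^i/∂x^k` of complex-valued functions `u^1, …, u^N`. -/
def jacobian {N : ℕ} (u : Coord N → Fin N → ℂ) (x : Coord N) : Matrix (Fin N) (Fin N) ℂ :=
  Matrix.of fun i k => pd k (fun y => u y i) x

/-- `u = (u^1, …, u^N)` is a system of smooth coordinates on the open set `U`, each `u^i` being
real or paired with its complex conjugate `u^{σ i}`. For `σ = 1` this is an ordinary real
coordinate system; in general the real coordinates together with the real and imaginary parts of
one member of each conjugate pair form one. -/
structure IsCoordinateSystem {N : ℕ} (U : Set (Coord N)) (σ : Equiv.Perm (Fin N))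
    (u : Coord N → Fin N → ℂ) : Prop where
  isOpen : IsOpen U
  involutive : ∀ i, σ (σ i) = i
  conj : ∀ x ∈ U, ∀ i, u x (σ i) = (starRingEnd ℂ) (u x i)
  smooth : ∀ i, ContDiffOn ℝ ∞ (fun x => u x i) U
  injective : Set.InjOn u U
  regular : ∀ x ∈ U, (jacobian u x).det ≠ 0

/-- The components `(∂u^i/∂x^k) g^{kl} (∂u^j/∂x^l)` of a contravariant metric in the
coordinates `u`. -/
def inCoordinates {N : ℕ} (G : Coord N → Matrix (Fin N) (Fin N) ℝ) (u : Coord N → Fin N → ℂ)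
    (x : Coord N) : Matrix (Fin N) (Fin N) ℂ :=
  jacobian u x * complexify (G x) * (jacobian u x).transpose

/-- In the coordinates `u` on `U` the metrics have the form `g₂^{ij} = g^i(u) δ^{ij}` and
`g₁^{ij} = f^i(u^i) g^i(u) δ^{ij}`. Each `f^i` is a function of the single variable `u^i`: a smooth
function of the real variable `u^i` if `u^i` is real, and a holomorphic function of `u^i` if `u^i`
is a member of a conjugate pair. -/
structure IsDiagonalForm {N : ℕ} (U : Set (Coord N))
    (G₁ G₂ : Coord N → Matrix (Fin N) (Fin N) ℝ) (σ : Equiv.Perm (Fin N))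
    (u : Coord N → Fin N → ℂ) (f : Fin N → ℂ → ℂ) (g : Fin N → Coord N → ℂ) : Prop where
  coordinates : IsCoordinateSystem U σ u
  smooth_real : ∀ i, σ i = i →
    ContDiffOn ℝ ∞ (fun t : ℝ => f i (t : ℂ)) {t : ℝ | ∃ x ∈ U, u x i = (t : ℂ)}
  holomorphic : ∀ i, σ i ≠ i → DifferentiableOn ℂ (f i) ((fun x => u x i) '' U)
  form₂ : ∀ x ∈ U, inCoordinates G₂ u x = Matrix.diagonal fun i => g i x
  form₁ : ∀ x ∈ U, inCoordinates G₁ u x = Matrix.diagonal fun i => f i (u x i) * g i x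

/-- Around every point of `Ω` there are local coordinates in which the pair has the diagonal
form. -/
def LocallyDiagonal {N : ℕ} (Ω : Set (Coord N))
    (G₁ G₂ : Coord N → Matrix (Fin N) (Fin N) ℝ) : Prop :=
  ∀ p ∈ Ω, ∃ (U : Set (Coord N)) (σ : Equiv.Perm (Fin N)) (u : Coord N → Fin N → ℂ)
    (f : Fin N → ℂ → ℂ) (g : Fin N → Coord N → ℂ),
    p ∈ U ∧ U ⊆ Ω ∧ IsDiagonalForm U G₁ G₂ σ u f g

end MetricPencil

end

/-! Let Γ_m be the matrix with entries Γ^i_{jm}, and let T_m = Γ_{1,m} − Γ_{2,m}. For P = λ₁g₁ +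
λ₂g₂, linearity of Γ^{ij}_k forces Γ_m = Γ_{2,m} + λ₁ T_m g₁ P⁻¹. This connection always preserves
P, so it is the Levi-Civita connection of P exactly when it is symmetric. The question becomes one
about the components of T in a coframe Θ of common eigencovectors of the pair.

Diagonal form gives compatibility (`hasDiagonalDifference_of_closed`,
`linear_of_hasDiagonalDifference`). In the closed coframe du^i the connection components with three
distinct indices vanish for both metrics. Since f^i depends on u^i alone, T^i_{in} = 0 for n ≠ i.
Hence T^i_{jm} = Σ_c τ^i_c Θ^c_j Θ^c_m. The factor g₁P⁻¹ is diagonal in the same frame and only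
rescales the summands, so symmetry survives. The extra quadratic terms in the curvature are
symmetric in k, l and cancel.

Conversely (`integrable_of_connection`), a nonsingular pair has a smooth eigencoframe
(`exists_eigen_coframe`), a priori not closed. For one combination g₁ + εg₂, both T^i_{jn} and
T^i_{jn}q_j are symmetric in j, n, where the q_j are the distinct eigenvalues of g₁P⁻¹; so T^i_{jn}
= 0 for j ≠ n. Comparing the derivatives of the two diagonal metrics then kills the connection
components with distinct indices. Therefore dΘ^i lies in the ideal generated by Θ^i, and df^i is
proportional to Θ^i.

It remains to integrate the rows. For a real row the Frobenius theorem (`exists_first_integral`)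
gives u^i. For a complex row it only gives a complex function v with dv = aΘ^i + bΘ̄^i, and a change
of variable solving a Beltrami equation removes Θ̄^i (`exists_complex_coordinate`). The Frobenius
theorem comes from a radial differential equation solved by the implicit function theorem in
C([0,1]). The Beltrami equation is made periodic with a small coefficient and solved by a Neumann
series on absolutely convergent Fourier series.

The last claim reads off determinants: g^i and f^i g^i are diagonal entries of nondegenerate forms,
and the values f^i are the roots μ. -/

open scoped ContDiff Topology

noncomputable section

namespace MetricPencil

universe u

/-! ### Smoothness of superposition operators on spaces of continuous maps. -/

section Superposition

variable {K : Type*} [TopologicalSpace K] [CompactSpace K]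
variable {E G : Type u} [NormedAddCommGroup E] [NormedSpace ℝ E]
  [NormedAddCommGroup G] [NormedSpace ℝ G]

/-- Pointwise application of a continuous family of operators, as a bounded operator. -/
def applyOp (K : Type*) [TopologicalSpace K] [CompactSpace K] (E G : Type u)
    [NormedAddCommGroup E] [NormedSpace ℝ E] [NormedAddCommGroup G] [NormedSpace ℝ G] :
    C(K, E →L[ℝ] G) →L[ℝ] C(K, E) →L[ℝ] C(K, G) :=
  LinearMap.mkContinuous₂
    (LinearMap.mk₂ ℝ (fun (A : C(K, E →L[ℝ] G)) (h : C(K, E)) =>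
        (⟨fun s => A s (h s), by fun_prop⟩ : C(K, G)))
      (by intros; ext; simp) (by intros; ext; simp) (by intros; ext; simp)
      (by intros; ext; simp)) 1 (by
    intro A h
    rw [one_mul, ContinuousMap.norm_le _ (by positivity)]
    intro s
    exact ((A s).le_opNorm _).trans (mul_le_mul (A.norm_coe_le_norm s) (h.norm_coe_le_norm s)
      (norm_nonneg _) (norm_nonneg A)))

/-- At each point of `K` this is the mean value inequality. The estimate is uniform because the
derivative of `F` is uniformly continuous around the compact range of `y`. -/
lemma hasFDerivAt_postcomp {F : E → G} (hF : ContDiff ℝ 1 F) (y : C(K, E)) :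
    HasFDerivAt (fun y : C(K, E) => (⟨F, hF.continuous⟩ : C(E, G)).comp y)
      (applyOp K E G
        ((⟨fderiv ℝ F, hF.continuous_fderiv one_ne_zero⟩ : C(E, E →L[ℝ] G)).comp y)) y := by
  rw [hasFDerivAt_iff_isLittleO_nhds_zero, Asymptotics.isLittleO_iff]
  intro c hc
  have hK : IsCompact (Set.range y) := isCompact_range y.continuous
  have hu := hK.uniformContinuousAt_of_continuousAt (fderiv ℝ F)
    (fun a _ => (hF.continuous_fderiv one_ne_zero).continuousAt)
    (Metric.dist_mem_uniformity hc)
  obtain ⟨δ, hδ, H⟩ := Metric.mem_uniformity_dist.1 hu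
  filter_upwards [Metric.ball_mem_nhds (0 : C(K, E)) hδ] with h hh
  rw [ContinuousMap.norm_le _ (by positivity)]
  intro s
  have hs : ‖h s‖ ≤ ‖h‖ := h.norm_coe_le_norm s
  have hh' : ‖h‖ < δ := by simpa using hh
  have key : ‖F (y s + h s) - F (y s) - fderiv ℝ F (y s) (y s + h s - y s)‖
      ≤ c * ‖y s + h s - y s‖ := by
    refine Convex.norm_image_sub_le_of_norm_fderiv_le' (𝕜 := ℝ) (s := Metric.ball (y s) δ)
      (fun x _ => hF.differentiable one_ne_zero x) ?_ (convex_ball _ _)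
      (Metric.mem_ball_self hδ) ?_
    · intro x hx
      have := H (a := y s) (b := x) (by rw [dist_comm]; exact hx) (Set.mem_range_self s)
      rw [← dist_eq_norm, dist_comm]
      exact le_of_lt this
    · simpa using hs.trans_lt hh'
  simp only [add_sub_cancel_left] at key
  exact key.trans (mul_le_mul_of_nonneg_left hs hc.le)

/-- The superposition operator `y ↦ F ∘ y` of a smooth function is smooth. -/
theorem contDiff_postcomp {F : E → G} (hF : ContDiff ℝ ∞ F) :
    ContDiff ℝ ∞ (fun y : C(K, E) => (⟨F, hF.continuous⟩ : C(E, G)).comp y) := by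
  rw [contDiff_infty]
  intro n
  -- The derivative of superposition by `F` is superposition by `fderiv ℝ F`, followed by the
  -- bounded operator `applyOp`. The target changes to `E →L[ℝ] G` at each step, which is why `G` is
  -- generalized and shares a universe with `E`.
  induction n generalizing G with
  | zero =>
    exact contDiff_zero.2 (ContinuousMap.continuous_postcomp _)
  | succ n ih =>
    have h1 : ContDiff ℝ 1 F := hF.of_le (by exact_mod_cast le_top)
    rw [Nat.cast_succ, contDiff_succ_iff_hasFDerivAt]
    have ha : ContDiff ℝ n (applyOp K E G) := by fun_prop
    have hd := ih (hF.fderiv_right (m := ∞) (by simp))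
    exact ⟨fun y => applyOp K E G
        ((⟨fderiv ℝ F, h1.continuous_fderiv one_ne_zero⟩ : C(E, E →L[ℝ] G)).comp y),
      ha.comp hd, fun y => hasFDerivAt_postcomp h1 y⟩

end Superposition

end MetricPencil

end

open scoped ContDiff Topology

noncomputable section

namespace MetricPencil

universe u

/-! ### Implicit and inverse functions that are smooth near the base point. -/

section Implicit

variable {E₁ E₂ F : Type*} [NormedAddCommGroup E₁] [NormedSpace ℝ E₁] [CompleteSpace E₁]
  [NormedAddCommGroup E₂] [NormedSpace ℝ E₂] [CompleteSpace E₂]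
  [NormedAddCommGroup F] [NormedSpace ℝ F] [CompleteSpace F]

/-- The implicit function theorem, with smoothness in a neighbourhood of the base point. -/
theorem exists_smooth_implicit {f : E₁ × E₂ → F} {u : E₁ × E₂}
    (hf : ∀ᶠ v in 𝓝 u, ContDiffAt ℝ ∞ f v) (h0 : f u = 0)
    (hi : (fderiv ℝ f u ∘L .inr ℝ E₁ E₂).IsInvertible) :
    ∃ ψ : E₁ → E₂, ψ u.1 = u.2 ∧ (∀ᶠ x in 𝓝 u.1, ContDiffAt ℝ ∞ ψ x) ∧
      ∀ᶠ v in 𝓝 u, f v = 0 ↔ ψ v.1 = v.2 := by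
  have pn : (∞ : WithTop ℕ∞) ≠ 0 := by simp
  have cdf := hf.self_of_nhds
  set ψ := cdf.implicitFunction pn hi with hψ
  have hψu : ψ u.1 = u.2 := cdf.implicitFunction_apply_self pn hi
  have hψs : ContDiffAt ℝ ∞ ψ u.1 := cdf.contDiffAt_implicitFunction pn hi
  have hiff : ∀ᶠ v in 𝓝 u, f v = 0 ↔ ψ v.1 = v.2 := by
    have := cdf.eventually_apply_eq_iff_implicitFunction pn hi
    rwa [h0] at this
  refine ⟨ψ, hψu, ?_, hiff⟩
  -- Smoothness of infinite order at one point does not spread to a neighbourhood, since the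
  -- neighbourhood may shrink with the order. The implicit function theorem is therefore applied
  -- again at every nearby point `(x, ψ x)`, and local uniqueness identifies the new function with
  -- `ψ`.
  have hinv : ∀ᶠ v in 𝓝 u, (fderiv ℝ f v ∘L .inr ℝ E₁ E₂).IsInvertible := by
    have hc : ContinuousAt (fun v => fderiv ℝ f v ∘L .inr ℝ E₁ E₂) u := by
      have : ContinuousAt (fderiv ℝ f) u := (cdf.fderiv_right (m := 0) (by simp)).continuousAt
      exact this.clm_comp continuousAt_const
    obtain ⟨e, he⟩ := hi
    have hn := ContinuousLinearEquiv.nhds e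
    rw [he] at hn
    filter_upwards [hc hn] with v hv
    obtain ⟨e', he'⟩ := hv
    exact ⟨e', he'⟩
  have htend : Filter.Tendsto (fun x => (x, ψ x)) (𝓝 u.1) (𝓝 u) := by
    have : Filter.Tendsto (fun x => (x, ψ x)) (𝓝 u.1) (𝓝 (u.1, ψ u.1)) :=
      (continuousAt_id.prodMk hψs.continuousAt)
    rwa [hψu] at this
  have h1 : ∀ᶠ x in 𝓝 u.1, ContinuousAt ψ x := by
    have : ContDiffAt ℝ 1 ψ u.1 := hψs.of_le (by exact_mod_cast le_top)
    filter_upwards [this.eventually (by simp)] with x hx using hx.continuousAt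
  filter_upwards [htend.eventually hf, htend.eventually hinv, htend.eventually hiff.eventually_nhds,
    h1] with x hxf hxi hxe hxc
  have hx0 : f (x, ψ x) = 0 := hxe.self_of_nhds.2 rfl
  have hiff' := hxf.eventually_apply_eq_iff_implicitFunction pn hxi
  have ht : Filter.Tendsto (fun z => (z, ψ z)) (𝓝 x) (𝓝 (x, ψ x)) :=
    (continuousAt_id.prodMk hxc)
  refine (hxf.contDiffAt_implicitFunction pn hxi).congr_of_eventuallyEq ?_
  filter_upwards [ht.eventually hxe, ht.eventually hiff'] with z hz hz'
  rw [hx0] at hz'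
  exact (hz'.1 (hz.2 rfl)).symm

/-- The inverse function theorem, with smoothness in a neighbourhood of the base point. -/
theorem exists_smooth_localInverse {g : E₂ → E₁} {y : E₂}
    (hg : ∀ᶠ z in 𝓝 y, ContDiffAt ℝ ∞ g z) (hi : (fderiv ℝ g y).IsInvertible) :
    ∃ ψ : E₁ → E₂, ψ (g y) = y ∧ (∀ᶠ x in 𝓝 (g y), ContDiffAt ℝ ∞ ψ x) ∧
      (∀ᶠ x in 𝓝 (g y), g (ψ x) = x) ∧ ∀ᶠ z in 𝓝 y, ψ (g z) = z := by
  have hs : ∀ᶠ v in 𝓝 ((g y, y) : E₁ × E₂), ContDiffAt ℝ ∞ (fun v : E₁ × E₂ => g v.2 - v.1) v := by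
    have : Filter.Tendsto (Prod.snd : E₁ × E₂ → E₂) (𝓝 (g y, y)) (𝓝 y) :=
      continuous_snd.continuousAt
    filter_upwards [this.eventually hg] with v hv
    exact (hv.comp v contDiffAt_snd).sub contDiffAt_fst
  have hd : HasFDerivAt (fun v : E₁ × E₂ => g v.2 - v.1)
      ((fderiv ℝ g y).comp (.snd ℝ E₁ E₂) - .fst ℝ E₁ E₂) (g y, y) :=
    HasFDerivAt.sub (HasFDerivAt.comp (g y, y) (f := Prod.snd)
      ((hg.self_of_nhds.differentiableAt (by simp)).hasFDerivAt) hasFDerivAt_snd) hasFDerivAt_fst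
  obtain ⟨ψ, h1, h2, h3⟩ := exists_smooth_implicit (u := (g y, y)) hs (by simp) (by
    rw [hd.fderiv]
    convert hi using 1
    ext v
    simp)
  have hψc : ContinuousAt ψ (g y) := h2.self_of_nhds.continuousAt
  have hgc : ContinuousAt g y := hg.self_of_nhds.continuousAt
  refine ⟨ψ, h1, h2, ?_, ?_⟩
  · have : Filter.Tendsto (fun x => (x, ψ x)) (𝓝 (g y)) (𝓝 (g y, y)) := by
      have : Filter.Tendsto (fun x => (x, ψ x)) (𝓝 (g y)) (𝓝 (g y, ψ (g y))) :=
        (continuousAt_id.prodMk hψc)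
      rwa [show ψ (g y) = y from h1] at this
    filter_upwards [this.eventually h3] with x hx
    exact sub_eq_zero.1 (hx.2 rfl)
  · have : Filter.Tendsto (fun z => (g z, z)) (𝓝 y) (𝓝 (g y, y)) :=
      hgc.prodMk continuousAt_id
    filter_upwards [this.eventually h3] with z hz
    exact hz.1 (by simp)

end Implicit

end MetricPencil

end

open scoped ContDiff Topology

noncomputable section

namespace MetricPencil

universe u

/-! ### Radial differential equations with smooth dependence on the end point. -/

section RadialFlow

open unitInterval

variable {K W : Type u} [NormedAddCommGroup K] [NormedSpace ℝ K]
  [NormedAddCommGroup W] [NormedSpace ℝ W]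

/-- The continuous path `s ↦ ((s x, Y s), x)`, depending linearly on `(x, Y)`. -/
def radialPath (K W : Type u) [NormedAddCommGroup K] [NormedSpace ℝ K]
    [NormedAddCommGroup W] [NormedSpace ℝ W] : K × C(I, W) →L[ℝ] C(I, (K × W) × K) :=
  LinearMap.mkContinuous
    { toFun := fun p => ⟨fun s => (((s : ℝ) • p.1, p.2 s), p.1), by fun_prop⟩
      map_add' := by intro p q; ext s <;> simp
      map_smul' := by intro c p; ext s <;> simp [smul_comm c] } 1 (by
    intro p
    rw [one_mul, ContinuousMap.norm_le _ (norm_nonneg _)]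
    intro s
    have h1 : ‖p.1‖ ≤ ‖p‖ := norm_fst_le p
    have h2 : ‖p.2 s‖ ≤ ‖p‖ := (p.2.norm_coe_le_norm s).trans (norm_snd_le p)
    have h3 : ‖(s : ℝ) • p.1‖ ≤ ‖p‖ := by
      rw [norm_smul, Real.norm_of_nonneg s.2.1]
      exact (mul_le_of_le_one_left (norm_nonneg _) s.2.2).trans h1
    exact max_le (max_le h3 h2) h1)

/-- The primitive `s ↦ ∫_1^s Z`. -/
def primitiveFromOne (W : Type u) [NormedAddCommGroup W] [NormedSpace ℝ W] :
    C(I, W) →L[ℝ] C(I, W) :=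
  LinearMap.mkContinuous
    { toFun := fun Z => ⟨fun s => ∫ t in (1 : ℝ)..s, Set.IccExtend zero_le_one Z t, by
        have hZ : Continuous (Set.IccExtend zero_le_one Z) := Z.continuous.Icc_extend'
        exact (intervalIntegral.continuous_primitive
          (fun a b => hZ.intervalIntegrable a b) 1).comp continuous_subtype_val⟩
      map_add' := by
        intro Z Z'
        ext s
        have hZ : Continuous (Set.IccExtend zero_le_one Z) := Z.continuous.Icc_extend'
        have hZ' : Continuous (Set.IccExtend zero_le_one Z') := Z'.continuous.Icc_extend'
        exact intervalIntegral.integral_add (hZ.intervalIntegrable 1 s)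
          (hZ'.intervalIntegrable 1 s)
      map_smul' := by
        intro c Z
        ext s
        exact intervalIntegral.integral_smul c _ } 1 (by
    intro Z
    rw [one_mul, ContinuousMap.norm_le _ (norm_nonneg _)]
    intro s
    have := intervalIntegral.norm_integral_le_of_norm_le_const (a := 1) (b := s) (C := ‖Z‖)
      (f := Set.IccExtend zero_le_one Z) (fun t _ => Z.norm_coe_le_norm _)
    refine this.trans (mul_le_of_le_one_right (norm_nonneg _) ?_)
    rw [abs_le]
    constructor <;> linarith [s.2.1, s.2.2])

lemma primitiveFromOne_apply (Z : C(I, W)) (s : I) :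
    primitiveFromOne W Z s = ∫ t in (1 : ℝ)..s, Set.IccExtend zero_le_one Z t := rfl

variable [CompleteSpace K] [CompleteSpace W]

/-- The solutions `Y` of `Y' (s) = A (s x, Y s) x`, `Y 1 = y`, near the zero solution, as curves
depending on `z = (x, y)`; their value at `s = 0` depends smoothly on `z`. -/
theorem exists_radial_flow {A : K × W → K →L[ℝ] W} (hA : ContDiff ℝ ∞ A) :
    ∃ c : K × W → ℝ → W,
      (∀ᶠ z in 𝓝 (0 : K × W), c z 1 = z.2 ∧ ∀ s ∈ Set.Icc (0 : ℝ) 1,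
        HasDerivAt (c z) (A (s • z.1, c z s) z.1) s) ∧
      (∀ P : K × W → Prop, (∀ᶠ z in 𝓝 (0 : K × W), P z) →
        ∀ᶠ z in 𝓝 (0 : K × W), ∀ s ∈ Set.Icc (0 : ℝ) 1, P (s • z.1, c z s)) ∧
      (∀ᶠ z in 𝓝 (0 : K × W), ContDiffAt ℝ ∞ (fun z => c z 0) z) ∧
      (∀ᶠ z in 𝓝 (0 : K × W), ∀ s ∈ Set.Icc (0 : ℝ) 1, c (s • z.1, c z s) 0 = c z 0) ∧
      ∀ᶠ y in 𝓝 (0 : W), c (0, y) 0 = y := by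
  have hF : ContDiff ℝ ∞ (fun p : (K × W) × K => A p.1 p.2) :=
    (hA.comp contDiff_fst).clm_apply contDiff_snd
  set NF : C(I, (K × W) × K) → C(I, W) :=
    fun y => (⟨fun p : (K × W) × K => A p.1 p.2, hF.continuous⟩ : C((K × W) × K, W)).comp y
    with hNF
  have hNFs : ContDiff ℝ ∞ NF := contDiff_postcomp hF
  -- Zeros of `Φ` solve the integral form of the equation. The integral starts at 1, so that the
  -- point `z` is prescribed at the end of the curve and its trace over `x = 0` is the output.
  set Φ : (K × W) × C(I, W) → C(I, W) := fun p =>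
    p.2 - ContinuousMap.const I p.1.2 - primitiveFromOne W (NF (radialPath K W (p.1.1, p.2)))
    with hΦ
  have hconst : ContDiff ℝ ∞ (fun w : W => ContinuousMap.const I w) := by
    have : ContDiff ℝ ∞ (ContinuousLinearMap.const ℝ (M := W) I) := by fun_prop
    exact this
  have hΦs : ContDiff ℝ ∞ Φ := by
    have h1 : ContDiff ℝ ∞ (radialPath K W) := by fun_prop
    have h2 : ContDiff ℝ ∞ (primitiveFromOne W) := by fun_prop
    refine (contDiff_snd.sub (hconst.comp (contDiff_snd.comp contDiff_fst))).sub ?_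
    refine h2.comp (hNFs.comp (h1.comp ?_))
    exact (contDiff_fst.comp contDiff_fst).prodMk contDiff_snd
  have hNF0 : ∀ (x : K) (Y : C(I, W)) (t : ℝ), Set.IccExtend zero_le_one
      (NF (radialPath K W (x, Y))) t = A ((Set.projIcc (0 : ℝ) 1 zero_le_one t : ℝ) • x,
        Y (Set.projIcc 0 1 zero_le_one t)) x := fun x Y t => rfl
  have hΦ0 : ∀ y Y, Φ ((0, y), Y) = Y - ContinuousMap.const I y := by
    intro y Y
    ext s
    simp only [hΦ, ContinuousMap.sub_apply, primitiveFromOne_apply, hNF0, map_zero]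
    simp
  -- For `x = 0` the integrand vanishes and `Φ` is `Y` minus a constant path, so the partial
  -- derivative in `Y` is the identity.
  have hd : fderiv ℝ Φ 0 ∘L .inr ℝ (K × W) C(I, W) = ContinuousLinearMap.id ℝ C(I, W) := by
    have h1 : HasFDerivAt (Φ ∘ (ContinuousLinearMap.inr ℝ (K × W) C(I, W)))
        (fderiv ℝ Φ 0 ∘L .inr ℝ (K × W) C(I, W)) 0 := by
      refine HasFDerivAt.comp (0 : C(I, W)) ?_ (ContinuousLinearMap.hasFDerivAt _)
      rw [map_zero]
      exact ((hΦs.differentiable (by simp)) 0).hasFDerivAt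
    have h2 : Φ ∘ (ContinuousLinearMap.inr ℝ (K × W) C(I, W)) = id := by
      funext Y
      have := hΦ0 0 Y
      simp only [Function.comp, ContinuousLinearMap.inr_apply, id]
      rw [show ((0 : K × W), Y) = (((0 : K), (0 : W)), Y) from rfl, this]
      ext s; simp
    rw [h2] at h1
    exact h1.unique (hasFDerivAt_id _)
  obtain ⟨ψ, hψ0, hψs, hψ⟩ := exists_smooth_implicit (f := Φ) (u := 0)
    (Filter.Eventually.of_forall fun v => hΦs.contDiffAt)
    (by have := hΦ0 0 0
        rw [show (0 : (K × W) × C(I, W)) = (((0 : K), (0 : W)), (0 : C(I, W))) from rfl, this]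
        ext s; simp)
    (by rw [hd]; exact ⟨.refl ℝ _, rfl⟩)
  simp only [Prod.fst_zero, Prod.snd_zero] at hψ0 hψs
  have hψc : Filter.Tendsto ψ (𝓝 0) (𝓝 0) := by
    have := hψs.self_of_nhds.continuousAt.tendsto
    rwa [hψ0] at this
  have hsol : ∀ᶠ z in 𝓝 (0 : K × W), Φ (z, ψ z) = 0 := by
    have : Filter.Tendsto (fun z => (z, ψ z)) (𝓝 (0 : K × W)) (𝓝 0) :=
      Filter.Tendsto.prodMk_nhds Filter.tendsto_id hψc
    filter_upwards [this.eventually hψ] with z hz using hz.2 rfl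
  set Z : K × W → ℝ → W := fun z => Set.IccExtend zero_le_one (NF (radialPath K W (z.1, ψ z)))
    with hZ
  have hZc : ∀ z, Continuous (Z z) := fun z => (NF (radialPath K W (z.1, ψ z))).continuous.Icc_extend'
  -- Extending the solution to all of ℝ as an integral makes it differentiable on both sides at 0
  -- and 1.
  set c : K × W → ℝ → W := fun z s => z.2 + ∫ t in (1 : ℝ)..s, Z z t with hc
  have hcψ : ∀ᶠ z in 𝓝 (0 : K × W), ∀ s : I, c z s = ψ z s := by
    filter_upwards [hsol] with z hz s
    have := DFunLike.congr_fun hz s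
    simp only [hΦ, ContinuousMap.sub_apply, primitiveFromOne_apply, ContinuousMap.const_apply,
      ContinuousMap.zero_apply] at this
    rw [sub_sub, sub_eq_zero] at this
    exact this.symm
  have hnear : ∀ P : K × W → Prop, (∀ᶠ z in 𝓝 (0 : K × W), P z) →
        ∀ᶠ z in 𝓝 (0 : K × W), ∀ s ∈ Set.Icc (0 : ℝ) 1, P (s • z.1, c z s) := by
    intro P hP
    obtain ⟨δ, hδ, H⟩ := Metric.eventually_nhds_iff.1 hP
    have h1 : ∀ᶠ z in 𝓝 (0 : K × W), ‖ψ z‖ < δ := by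
      have := hψc.norm
      rw [norm_zero] at this
      exact this.eventually (gt_mem_nhds hδ)
    have h2 : ∀ᶠ z in 𝓝 (0 : K × W), ‖z‖ < δ := by
      filter_upwards [Metric.ball_mem_nhds (0 : K × W) hδ] with z hz
      simpa using hz
    filter_upwards [h1, h2, hcψ] with z hz1 hz2 hz3 s hs
    apply H
    rw [dist_zero_right, Prod.norm_def]
    refine max_lt ?_ ?_
    · rw [norm_smul, Real.norm_of_nonneg hs.1]
      exact ((mul_le_of_le_one_left (norm_nonneg _) hs.2).trans (norm_fst_le z)).trans_lt hz2
    · have := hz3 ⟨s, hs⟩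
      simp only at this
      rw [this]
      exact ((ψ z).norm_coe_le_norm _).trans_lt hz1
  refine ⟨c, ?_, hnear, ?_, ?_, ?_⟩
  · filter_upwards [hcψ] with z hz
    refine ⟨by simp [hc], fun s hs => ?_⟩
    have h1 : HasDerivAt (c z) (Z z s) s :=
      (intervalIntegral.integral_hasDerivAt_right ((hZc z).intervalIntegrable 1 s)
        ((hZc z).stronglyMeasurableAtFilter _ _) (hZc z).continuousAt).const_add _
    convert h1 using 1
    rw [hZ]
    simp only [hNF0, Set.projIcc_of_mem zero_le_one hs]
    rw [← hz ⟨s, hs⟩]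
  · have hev : ContDiff ℝ ∞ (fun Y : C(I, W) => Y 0) := by
      have : ContDiff ℝ ∞ (ContinuousMap.evalCLM ℝ (M := W) (0 : I)) := by fun_prop
      exact this
    filter_upwards [hψs, hcψ.eventually_nhds] with z hz hz'
    refine (hev.contDiffAt.comp z hz).congr_of_eventuallyEq ?_
    filter_upwards [hz'] with w hw
    exact hw 0
  · obtain ⟨δ, hδ, H⟩ := Metric.eventually_nhds_iff.1 hψ
    have h1 : ∀ᶠ z in 𝓝 (0 : K × W), ‖ψ z‖ < δ := by
      have := hψc.norm
      rw [norm_zero] at this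
      exact this.eventually (gt_mem_nhds hδ)
    have h2 : ∀ᶠ z in 𝓝 (0 : K × W), ‖z‖ < δ := by
      filter_upwards [Metric.ball_mem_nhds (0 : K × W) hδ] with z hz
      simpa using hz
    filter_upwards [h1, hcψ, hnear _ h2, hnear _ hcψ] with z hz1 hz2 hz3 hz4 s hs
    -- The rescaled path solves the equation with end point `(s • z.1, c z s)`. By uniqueness it is
    -- the solution attached to that point, and rescaling does not change the value at 0.
    set Y' : C(I, W) := ⟨fun r => ψ z (r * ⟨s, hs⟩), by fun_prop⟩ with hY'
    have hY'n : ‖Y'‖ < δ := by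
      refine lt_of_le_of_lt ?_ hz1
      rw [ContinuousMap.norm_le _ (norm_nonneg _)]
      intro r
      exact (ψ z).norm_coe_le_norm _
    have hiff := H (y := ((s • z.1, c z s), Y')) (by
      rw [dist_zero_right, Prod.norm_def]
      exact max_lt (hz3 s hs) hY'n)
    have hΦ' : Φ ((s • z.1, c z s), Y') = 0 := by
      ext r
      simp only [hΦ, ContinuousMap.sub_apply, primitiveFromOne_apply, ContinuousMap.const_apply,
        ContinuousMap.zero_apply, hNF0]
      have hintg : (∫ t in (1 : ℝ)..r, A ((Set.projIcc (0 : ℝ) 1 zero_le_one t : ℝ) • (s • z.1),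
          Y' (Set.projIcc 0 1 zero_le_one t)) (s • z.1)) = ∫ t in (1 : ℝ)..r, s • Z z (t * s) := by
        refine intervalIntegral.integral_congr fun t ht => ?_
        rw [Set.uIcc_of_ge r.2.2] at ht
        have ht' : t ∈ Set.Icc (0 : ℝ) 1 := ⟨r.2.1.trans ht.1, ht.2⟩
        have hts : t * s ∈ Set.Icc (0 : ℝ) 1 := ⟨mul_nonneg ht'.1 hs.1, mul_le_one₀ ht'.2 hs.1 hs.2⟩
        simp only [hZ, hNF0, Set.projIcc_of_mem zero_le_one ht', Set.projIcc_of_mem zero_le_one hts,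
          map_smul, smul_smul]
        rfl
      rw [hintg, intervalIntegral.integral_smul, intervalIntegral.smul_integral_comp_mul_right,
        one_mul]
      have e1 : Y' r = c z (r * s) := (hz2 (r * ⟨s, hs⟩)).symm
      rw [e1]
      simp only [hc]
      have := intervalIntegral.integral_add_adjacent_intervals
        ((hZc z).intervalIntegrable (μ := MeasureTheory.volume) 1 s)
        ((hZc z).intervalIntegrable (μ := MeasureTheory.volume) s (r * s))
      rw [← this]
      abel
    have e := hiff.1 hΦ'
    have e0 := hz4 s hs 0
    have e1 := hz2 0
    simp only [Set.Icc.coe_zero] at e0 e1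
    rw [e0, e1, e]
    simp [hY']
  · have hy : Filter.Tendsto (fun y : W => ((0 : K), y)) (𝓝 0) (𝓝 0) := by
      have : Continuous (fun y : W => ((0 : K), y)) := by fun_prop
      exact this.tendsto' _ _ rfl
    filter_upwards [hy.eventually hcψ, hy.eventually hsol] with y h1 h2
    have := h1 0
    rw [hΦ0] at h2
    have h3 := DFunLike.congr_fun (sub_eq_zero.1 h2) (0 : I)
    simp only [Set.Icc.coe_zero] at this
    rw [this, h3]
    rfl

end RadialFlow

end MetricPencil

end

open scoped ContDiff Topology

noncomputable section

namespace MetricPencil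

universe u

/-! ### First integrals of integrable distributions (Frobenius theorem). -/

section FirstIntegrals

variable {K W : Type u} [NormedAddCommGroup K] [NormedSpace ℝ K]
  [NormedAddCommGroup W] [NormedSpace ℝ W] [CompleteSpace K] [CompleteSpace W]

/-- First integrals of an integrable distribution given as the graphs of the linear maps `A z`. -/
theorem exists_first_integral_graph {A : K × W → K →L[ℝ] W} (hA : ContDiff ℝ ∞ A)
    (hflat : ∀ᶠ z in 𝓝 (0 : K × W), ∀ k l,
      fderiv ℝ A z (k, A z k) l = fderiv ℝ A z (l, A z l) k) :
    ∃ v : K × W → W, (∀ᶠ z in 𝓝 (0 : K × W), ContDiffAt ℝ ∞ v z) ∧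
      (∀ᶠ y in 𝓝 (0 : W), v (0, y) = y) ∧
      (∀ᶠ z in 𝓝 (0 : K × W), ∀ k, fderiv ℝ v z (k, A z k) = 0) ∧
      ∀ ρ : K × W → ℂ, (∀ᶠ z in 𝓝 (0 : K × W), DifferentiableAt ℝ ρ z ∧
        ∀ k, fderiv ℝ ρ z (k, A z k) = 0) → ∀ᶠ z in 𝓝 (0 : K × W), ρ z = ρ (0, v z) := by
  obtain ⟨c, hc, hnear, hvs, hvc, hv0⟩ := exists_radial_flow hA
  set v : K × W → W := fun z => c z 0 with hv
  have hγ : ∀ᶠ z in 𝓝 (0 : K × W), ∀ s ∈ Set.Icc (0 : ℝ) 1,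
      HasDerivAt (fun s => (s • z.1, c z s)) (z.1, A (s • z.1, c z s) z.1) s := by
    filter_upwards [hc] with z hz s hs
    have h1 : HasDerivAt (fun s : ℝ => s • z.1) z.1 s := by
      simpa using (hasDerivAt_id s).smul_const z.1
    exact h1.prodMk (hz.2 s hs)
  -- `v` is constant along the solution curve, which reaches `z` at `s = 1`. Constancy is known only
  -- on `[0, 1]`, and the one-sided derivative at 1 suffices.
  have hR : ∀ᶠ z in 𝓝 (0 : K × W), fderiv ℝ v z (z.1, A z z.1) = 0 := by
    filter_upwards [hvs, hvc, hγ, hc] with z h1 h2 h3 h4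
    have hz : ((1 : ℝ) • z.1, c z 1) = z := by rw [one_smul, h4.1]
    have hd := h3 1 (by simp)
    have hd2 : HasDerivAt (fun s : ℝ => v (s • z.1, c z s)) (fderiv ℝ v z (z.1, A z z.1)) 1 := by
      have h5 : HasFDerivAt v (fderiv ℝ v z) ((1 : ℝ) • z.1, c z 1) := by
        rw [hz]; exact (h1.differentiableAt (by simp)).hasFDerivAt
      have := h5.comp_hasDerivAt (1 : ℝ) hd
      rwa [hz] at this
    have hd3 : HasDerivWithinAt (fun s : ℝ => v (s • z.1, c z s)) 0 (Set.Icc 0 1) 1 :=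
      (hasDerivWithinAt_const (1 : ℝ) (Set.Icc 0 1) (v z)).congr (fun s hs => h2 s hs)
        (h2 1 (by simp))
    exact (uniqueDiffOn_Icc (zero_lt_one (α := ℝ)) 1 (by simp)).eq_deriv _
      hd2.hasDerivWithinAt hd3
  -- Put w_k = dv(k, A k) and let R = (x, A x) be the radial field. Differentiating dv(R) = 0 along
  -- (k, A k), with D²v symmetric and `hflat`, gives dw_k(R) = −w_k.
  have hw : ∀ᶠ z in 𝓝 (0 : K × W), ∀ k,
      HasFDerivAt (fun z => fderiv ℝ v z (k, A z k))
        ((fderiv ℝ v z).comp ((ContinuousLinearMap.inr ℝ K W).comp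
            ((fderiv ℝ A z).flip k)) + (fderiv ℝ (fderiv ℝ v) z).flip (k, A z k)) z ∧
      ((fderiv ℝ v z).comp ((ContinuousLinearMap.inr ℝ K W).comp
            ((fderiv ℝ A z).flip k)) + (fderiv ℝ (fderiv ℝ v) z).flip (k, A z k)) (z.1, A z z.1)
        = - fderiv ℝ v z (k, A z k) := by
    filter_upwards [hvs, hR.eventually_nhds, hflat] with z h1 h2 h3 k
    have hAd : HasFDerivAt A (fderiv ℝ A z) z := (hA.differentiable (by simp) z).hasFDerivAt
    have hvd : HasFDerivAt (fderiv ℝ v) (fderiv ℝ (fderiv ℝ v) z) z :=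
      ((h1.fderiv_right (m := 1) (by norm_cast)).differentiableAt one_ne_zero).hasFDerivAt
    constructor
    · have hA1 : HasFDerivAt (fun z => A z k) ((fderiv ℝ A z).flip k) z := by
        simpa using hAd.clm_apply (hasFDerivAt_const k z)
      have hX : HasFDerivAt (fun z => (k, A z k))
          ((ContinuousLinearMap.inr ℝ K W).comp ((fderiv ℝ A z).flip k)) z := by
        refine ((hasFDerivAt_const k z).prodMk hA1).congr_fderiv ?_
        ext h <;> simp
      exact hvd.clm_apply hX
    · have hX : HasFDerivAt (fun z : K × W => (z.1, A z z.1))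
          ((ContinuousLinearMap.fst ℝ K W).prod
            ((A z).comp (ContinuousLinearMap.fst ℝ K W) + (fderiv ℝ A z).flip z.1)) z :=
        hasFDerivAt_fst.prodMk (hAd.clm_apply hasFDerivAt_fst)
      have hr := hvd.clm_apply hX
      have hr0 : HasFDerivAt (fun z : K × W => fderiv ℝ v z (z.1, A z z.1))
          (0 : K × W →L[ℝ] W) z :=
        (hasFDerivAt_const (0 : W) z).congr_of_eventuallyEq h2
      have e := DFunLike.congr_fun (hr.unique hr0) (k, A z k)
      have hsym := (h1.isSymmSndFDerivAt (by simp only [minSmoothness_of_isRCLikeNormedField]; norm_cast)).eq (k, A z k) (z.1, A z z.1)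
      simp only [add_apply, ContinuousLinearMap.comp_apply,
        ContinuousLinearMap.flip_apply, ContinuousLinearMap.prod_apply,
        ContinuousLinearMap.coe_fst', zero_apply,
        ContinuousLinearMap.inr_apply] at e ⊢
      rw [← hsym, ← h3 k z.1]
      have e2 : ((k, A z k + fderiv ℝ A z (k, A z k) z.1) : K × W)
          = (k, A z k) + (0, fderiv ℝ A z (k, A z k) z.1) := by simp
      rw [e2, map_add, add_assoc] at e
      rw [eq_neg_iff_add_eq_zero, ← e]
      abel
  refine ⟨v, hvs, hv0, ?_, ?_⟩
  · filter_upwards [hnear _ hw, hγ, hc] with z h1 h2 h3 k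
    have hz : ((1 : ℝ) • z.1, c z 1) = z := by rw [one_smul, h3.1]
    -- Along the curve, s times the velocity is R. Hence s·w_k has derivative w_k − w_k = 0; it
    -- vanishes at s = 0 and so also at s = 1.
    set g : ℝ → W := fun s => s • fderiv ℝ v (s • z.1, c z s) (k, A (s • z.1, c z s) k) with hg
    have hgd : ∀ s ∈ Set.Icc (0 : ℝ) 1, HasDerivAt g 0 s := by
      intro s hs
      have hd := (h1 s hs k).1.comp_hasDerivAt s (h2 s hs)
      have hd2 := (hasDerivAt_id s).smul hd
      refine hd2.congr_deriv ?_
      have e := (h1 s hs k).2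
      simp only [id, one_smul, ← map_smul, Function.comp]
      rw [show s • (z.1, A (s • z.1, c z s) z.1) = (s • z.1, A (s • z.1, c z s) (s • z.1)) by
        rw [Prod.smul_mk, map_smul], e]
      simp
    have := constant_of_has_deriv_right_zero
      (fun s hs => (hgd s hs).continuousAt.continuousWithinAt)
      (fun s hs => (hgd s ⟨hs.1, hs.2.le⟩).hasDerivWithinAt) 1 (by simp)
    simp only [hg, zero_smul, hz] at this
    simpa using this
  · intro ρ hρ
    filter_upwards [hnear _ hρ, hγ, hc] with z h1 h2 h3
    have hz : ((1 : ℝ) • z.1, c z 1) = z := by rw [one_smul, h3.1]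
    have hgd : ∀ s ∈ Set.Icc (0 : ℝ) 1, HasDerivAt (fun s => ρ (s • z.1, c z s)) 0 s := by
      intro s hs
      have hd := (h1 s hs).1.hasFDerivAt.comp_hasDerivAt s (h2 s hs)
      refine hd.congr_deriv ((h1 s hs).2 _)
    have := constant_of_has_deriv_right_zero
      (fun s hs => (hgd s hs).continuousAt.continuousWithinAt)
      (fun s hs => (hgd s ⟨hs.1, hs.2.le⟩).hasDerivWithinAt) 1 (by simp)
    simp only [hz, zero_smul] at this
    exact this

/-- A function that is smooth near a point agrees near that point with a smooth function. -/
theorem exists_contDiff_eventuallyEq {E F : Type*} [NormedAddCommGroup E] [NormedSpace ℝ E]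
    [FiniteDimensional ℝ E] [NormedAddCommGroup F] [NormedSpace ℝ F] {f : E → F} {p : E}
    (hf : ∀ᶠ x in 𝓝 p, ContDiffAt ℝ ∞ f x) :
    ∃ g : E → F, ContDiff ℝ ∞ g ∧ g =ᶠ[𝓝 p] f := by
  obtain ⟨r, hr, H⟩ := Metric.eventually_nhds_iff_ball.1 hf
  let χ : ContDiffBump p := ⟨r / 3, r / 2, by positivity, by linarith⟩
  refine ⟨fun x => χ x • f x, ?_, ?_⟩
  · rw [contDiff_iff_contDiffAt]
    intro x
    by_cases hx : x ∈ Metric.ball p r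
    · exact χ.contDiffAt.smul (H x hx)
    · refine (contDiffAt_const (c := (0 : F))).congr_of_eventuallyEq ?_
      have hmem : (tsupport χ)ᶜ ∈ 𝓝 x := by
        refine (isClosed_tsupport _).isOpen_compl.mem_nhds ?_
        rw [χ.tsupport_eq]
        intro hx'
        apply hx
        simp only [Metric.mem_closedBall, Metric.mem_ball] at hx' ⊢
        have : χ.rOut = r / 2 := rfl
        linarith
      filter_upwards [hmem] with y hy
      rw [image_eq_zero_of_notMem_tsupport hy, zero_smul]
  · filter_upwards [χ.eventuallyEq_one] with x hx
    rw [hx, Pi.one_apply, one_smul]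

/-- First integrals of the distribution `ker θ` for a vector-valued form `θ` whose exterior
derivative vanishes on `ker θ`. -/
theorem exists_first_integral {V W : Type u} [NormedAddCommGroup V] [NormedSpace ℝ V]
    [FiniteDimensional ℝ V] [NormedAddCommGroup W] [NormedSpace ℝ W] [FiniteDimensional ℝ W]
    {θ : V → V →L[ℝ] W} {p : V} (hθ : ∀ᶠ x in 𝓝 p, ContDiffAt ℝ ∞ θ x)
    (hsurj : Function.Surjective (θ p))
    (hintg : ∀ᶠ x in 𝓝 p, ∀ h l, θ x h = 0 → θ x l = 0 →
      fderiv ℝ θ x h l = fderiv ℝ θ x l h) :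
    ∃ (v : V → W) (s : W → V), (∀ᶠ x in 𝓝 p, ContDiffAt ℝ ∞ v x) ∧ ContDiff ℝ ∞ s ∧
      v p = 0 ∧ s 0 = p ∧ fderiv ℝ v p = θ p ∧
      (∀ᶠ x in 𝓝 p, ∀ h, θ x h = 0 → fderiv ℝ v x h = 0) ∧
      ∀ ρ : V → ℂ, (∀ᶠ x in 𝓝 p, DifferentiableAt ℝ ρ x ∧
        ∀ h, θ x h = 0 → fderiv ℝ ρ x h = 0) → ∀ᶠ x in 𝓝 p, ρ x = ρ (s (v x)) := by
  have : CompleteSpace V := FiniteDimensional.complete ℝ V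
  have : CompleteSpace W := FiniteDimensional.complete ℝ W
  -- A right inverse of `θ p` splits `V` into `ker (θ p)` and a copy of `W`. In this splitting the
  -- nearby kernels are graphs over `ker (θ p)`, which reduces to the graph case.
  obtain ⟨r', hr'⟩ := (θ p : V →ₗ[ℝ] W).exists_rightInverse_of_surjective
    (LinearMap.range_eq_top.2 hsurj)
  set r : W →L[ℝ] V := LinearMap.toContinuousLinearMap r' with hr
  have hθr : ∀ w, θ p (r w) = w := fun w => LinearMap.congr_fun hr' w
  set K : Submodule ℝ V := (θ p : V →ₗ[ℝ] W).ker with hK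
  have hKmem : ∀ k : K, θ p k = 0 := fun k => k.2
  set e : (K × W) →L[ℝ] V := K.subtypeL.coprod r with he
  have he_apply : ∀ k w, e (k, w) = (k : V) + r w := fun k w => rfl
  set e' : V →L[ℝ] K × W := ((ContinuousLinearMap.id ℝ V - r.comp (θ p)).codRestrict K
    (fun x => by simp [hK, hθr])).prod (θ p) with he'
  have hee' : ∀ x, e (e' x) = x := by
    intro x
    simp [he, he']
  have he'e : ∀ z, e' (e z) = z := by
    rintro ⟨k, w⟩
    ext
    · simp [he, he', hθr, hKmem]
    · simp [he, he', hθr, hKmem]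
  set τ : K × W → V := fun z => p + e z with hτ
  have hτ0 : τ 0 = p := by simp [hτ]
  have hτs : ContDiff ℝ ∞ τ := contDiff_const.add e.contDiff
  have hτd : ∀ z, HasFDerivAt τ e z := fun z => e.hasFDerivAt.const_add p
  have hτt : Filter.Tendsto τ (𝓝 0) (𝓝 p) := by
    have := hτs.continuous.tendsto 0
    rwa [hτ0] at this
  set B : K × W → W →L[ℝ] W := fun z => (θ (τ z)).comp r with hB
  have hB0 : B 0 = 1 := by
    ext w
    simp [hB, hτ0, hθr]
  have hBs : ∀ᶠ z in 𝓝 (0 : K × W), ContDiffAt ℝ ∞ B z := by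
    filter_upwards [hτt.eventually hθ] with z hz
    exact (hz.comp z hτs.contDiffAt).clm_comp contDiffAt_const
  have hBu : ∀ᶠ z in 𝓝 (0 : K × W), IsUnit (B z) := by
    have h1 : ContinuousAt B 0 := hBs.self_of_nhds.continuousAt
    have h2 : {T : W →L[ℝ] W | IsUnit T} ∈ 𝓝 (B 0) := by
      rw [hB0]
      exact Units.isOpen.mem_nhds isUnit_one
    exact h1 h2
  set A' : K × W → K →L[ℝ] W := fun z =>
    -((Ring.inverse (B z)).comp ((θ (τ z)).comp K.subtypeL)) with hA'
  have hA's : ∀ᶠ z in 𝓝 (0 : K × W), ContDiffAt ℝ ∞ A' z := by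
    filter_upwards [hτt.eventually hθ, hBs, hBu] with z h1 h2 h3
    obtain ⟨b, hb⟩ := h3
    have h4 : ContDiffAt ℝ ∞ (fun z => Ring.inverse (B z)) z := by
      have := contDiffAt_ringInverse ℝ (n := ∞) b
      rw [hb] at this
      exact this.comp z h2
    exact (h4.clm_comp ((h1.comp z hτs.contDiffAt).clm_comp contDiffAt_const)).neg
  have hA'0 : ∀ᶠ z in 𝓝 (0 : K × W), ∀ (k : K) (w : W), θ (τ z) (e (k, w)) = 0 ↔ w = A' z k := by
    filter_upwards [hBu] with z hz k w
    have hleft : ∀ w, Ring.inverse (B z) (B z w) = w := fun w =>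
      DFunLike.congr_fun (Ring.inverse_mul_cancel _ hz) w
    have hright : ∀ w, B z (Ring.inverse (B z) w) = w := fun w =>
      DFunLike.congr_fun (Ring.mul_inverse_cancel _ hz) w
    rw [he_apply, map_add]
    constructor
    · intro h
      have h1 : B z w = -θ (τ z) k := by
        rw [eq_neg_iff_add_eq_zero, add_comm]; exact h
      rw [← hleft w, h1]
      simp [hA']
    · intro h
      rw [h]
      have : θ (τ z) (r (A' z k)) = B z (A' z k) := rfl
      rw [this]
      simp [hA', hright]
  -- The graph case asks for a globally smooth field, and only its germ at 0 matters.
  obtain ⟨A, hAs, hAA'⟩ := exists_contDiff_eventuallyEq hA's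
  have hA0 : ∀ᶠ z in 𝓝 (0 : K × W), ∀ (k : K) (w : W), θ (τ z) (e (k, w)) = 0 ↔ w = A z k := by
    filter_upwards [hA'0, hAA'] with z h1 h2
    rw [h2]; exact h1
  have hflat : ∀ᶠ z in 𝓝 (0 : K × W), ∀ k l,
      fderiv ℝ A z (k, A z k) l = fderiv ℝ A z (l, A z l) k := by
    filter_upwards [hA0.eventually_nhds, hτt.eventually hintg, hτt.eventually hθ, hBu]
      with z h1 h2 h3 h4 k l
    have hθd : HasFDerivAt (fun z => θ (τ z)) ((fderiv ℝ θ (τ z)).comp e) z :=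
      ((h3.differentiableAt (by simp)).hasFDerivAt).comp z (hτd z)
    have hAd : HasFDerivAt A (fderiv ℝ A z) z := (hAs.differentiable (by simp) z).hasFDerivAt
    -- This is the derivative of `θ (e (k, A k)) = 0` along `(l, A l)`. Since `B z` is invertible,
    -- the symmetry of dθ on the kernel passes to `A`.
    have key : ∀ k l : K, fderiv ℝ θ (τ z) (e (l, A z l)) (e (k, A z k))
        + B z (fderiv ℝ A z (l, A z l) k) = 0 := by
      intro k l
      have hA1 : HasFDerivAt (fun z => A z k) ((fderiv ℝ A z).flip k) z := by
        simpa using hAd.clm_apply (hasFDerivAt_const k z)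
      have hX : HasFDerivAt (fun z => e (k, A z k))
          (e.comp ((ContinuousLinearMap.inr ℝ K W).comp ((fderiv ℝ A z).flip k))) z := by
        refine e.hasFDerivAt.comp z (((hasFDerivAt_const k z).prodMk hA1).congr_fderiv ?_)
        ext h <;> simp
      have hr0 : HasFDerivAt (fun z => θ (τ z) (e (k, A z k))) (0 : K × W →L[ℝ] W) z := by
        refine (hasFDerivAt_const (0 : W) z).congr_of_eventuallyEq ?_
        filter_upwards [h1] with y hy
        exact (hy k (A y k)).2 rfl
      have e1 := DFunLike.congr_fun ((hθd.clm_apply hX).unique hr0) (l, A z l)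
      simp only [add_apply, ContinuousLinearMap.comp_apply,
        ContinuousLinearMap.flip_apply, zero_apply,
        ContinuousLinearMap.inr_apply] at e1
      rw [he_apply 0, ZeroMemClass.coe_zero, zero_add] at e1
      rw [add_comm]
      exact e1
    have hsym := h2 (e (k, A z k)) (e (l, A z l)) ((h1.self_of_nhds k _).2 rfl)
      ((h1.self_of_nhds l _).2 rfl)
    have e1 := key k l
    have e2 := key l k
    rw [hsym] at e2
    have e3 : B z (fderiv ℝ A z (k, A z k) l) = B z (fderiv ℝ A z (l, A z l) k) :=
      add_left_cancel (e2.trans e1.symm)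
    have hleft : ∀ w, Ring.inverse (B z) (B z w) = w := fun w =>
      DFunLike.congr_fun (Ring.inverse_mul_cancel _ h4) w
    rw [← hleft (fderiv ℝ A z (k, A z k) l), e3, hleft]
  obtain ⟨v, hvs, hv0, hvk, hvρ⟩ := exists_first_integral_graph hAs hflat
  have he't : ∀ x, HasFDerivAt (fun x => e' (x - p)) e' x := fun x =>
    (e'.hasFDerivAt.comp x ((hasFDerivAt_id x).sub_const p))
  have hκ : Filter.Tendsto (fun x => e' (x - p)) (𝓝 p) (𝓝 0) := by
    have : Continuous (fun x => e' (x - p)) := by fun_prop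
    have := this.tendsto p
    simpa using this
  have hτκ : ∀ x, τ (e' (x - p)) = x := fun x => by simp [hτ, hee']
  have hκ0 : e' (p - p) = 0 := by simp
  have hfd : ∀ {ρ : K × W → W} {x : V} (h : V), DifferentiableAt ℝ ρ (e' (x - p)) →
      fderiv ℝ (fun x => ρ (e' (x - p))) x h = fderiv ℝ ρ (e' (x - p)) (e' h) := by
    intro ρ x h hd
    have h1 : HasFDerivAt (fun x => ρ (e' (x - p))) ((fderiv ℝ ρ (e' (x - p))).comp e') x :=
      hd.hasFDerivAt.comp x (he't x)
    rw [h1.fderiv]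
    rfl
  -- The section is the affine slice over `0 : K`, on which the first integral is the coordinate of
  -- `W`. Functions constant along the leaves are recovered from this slice.
  refine ⟨fun x => v (e' (x - p)), fun w => τ (0, w), ?_, ?_, ?_, ?_, ?_, ?_, ?_⟩
  · filter_upwards [hκ.eventually hvs] with x hx
    exact hx.comp x ((e'.contDiff.comp (contDiff_id.sub contDiff_const)).contDiffAt)
  · exact hτs.comp (contDiff_const.prodMk contDiff_id)
  · simp only [hκ0]
    exact hv0.self_of_nhds
  · exact hτ0
  · ext h
    rw [hfd h (by rw [hκ0]; exact hvs.self_of_nhds.differentiableAt (by simp)), hκ0]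
    have hvd : HasFDerivAt v (fderiv ℝ v 0) 0 :=
      (hvs.self_of_nhds.differentiableAt (by simp)).hasFDerivAt
    have h1 : ∀ k, fderiv ℝ v 0 (k, 0) = 0 := by
      intro k
      have h2 := hvk.self_of_nhds k
      have h3 : (0 : W) = A 0 k := by
        rw [← hA0.self_of_nhds k 0, hτ0, he_apply]
        simp [hKmem]
      rwa [← h3] at h2
    have h2 : ∀ w, fderiv ℝ v 0 (0, w) = w := by
      intro w
      have h3 : HasFDerivAt (fun y : W => v (0, y))
          ((fderiv ℝ v 0).comp (ContinuousLinearMap.inr ℝ K W)) 0 :=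
        HasFDerivAt.comp (0 : W) (g := v) hvd (ContinuousLinearMap.inr ℝ K W).hasFDerivAt
      have h4 : HasFDerivAt (fun y : W => v (0, y)) (ContinuousLinearMap.id ℝ W) 0 :=
        (hasFDerivAt_id (0 : W)).congr_of_eventuallyEq hv0
      exact DFunLike.congr_fun (h3.unique h4) w
    rw [show e' h = ((e' h).1, 0) + (0, (e' h).2) by simp, map_add, h1, h2, zero_add]
    rfl
  · filter_upwards [hκ.eventually hvs, hκ.eventually hvk, hκ.eventually hA0] with x h1 h2 h3 h h4
    rw [hfd h (h1.differentiableAt (by simp))]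
    have h5 := h3 (e' h).1 (e' h).2
    rw [Prod.mk.eta, hee', hτκ] at h5
    have h6 := h2 (e' h).1
    rwa [← h5.1 h4] at h6
  · intro ρ hρ
    have hρ' : ∀ᶠ z in 𝓝 (0 : K × W), DifferentiableAt ℝ (fun z => ρ (τ z)) z ∧
        ∀ k, fderiv ℝ (fun z => ρ (τ z)) z (k, A z k) = 0 := by
      filter_upwards [hτt.eventually hρ, hA0] with z h1 h2
      have hd : HasFDerivAt (fun z => ρ (τ z)) ((fderiv ℝ ρ (τ z)).comp e) z :=
        h1.1.hasFDerivAt.comp z (hτd z)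
      refine ⟨hd.differentiableAt, fun k => ?_⟩
      rw [hd.fderiv]
      exact h1.2 _ ((h2 k _).2 rfl)
    filter_upwards [hκ.eventually (hvρ _ hρ')] with x hx
    rw [hτκ] at hx
    exact hx

end FirstIntegrals

end MetricPencil

end

open scoped ContDiff Topology

noncomputable section

namespace MetricPencil

/-! ### Absolutely convergent Fourier series on the two-dimensional torus. -/

section Wiener

/-- Frequencies of the two-dimensional torus. -/
abbrev Freq := Fin 2 → ℤ

/-- Absolutely summable families of Fourier coefficients. -/
abbrev Wiener := lp (fun _ : Freq => ℂ) 1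

variable {X : Type*} [NormedAddCommGroup X] [NormedSpace ℂ X]

lemma wiener_summable_norm (b : Wiener) : Summable (fun n => ‖b n‖) := by
  simpa using (lp.memℓp b).summable (by simp)

lemma wiener_norm_eq (b : Wiener) : ‖b‖ = ∑' n, ‖b n‖ := by
  simpa using lp.norm_eq_tsum_rpow (by simp) b

/-- The delta family. -/
def delta (n : Freq) : Wiener := lp.single 1 n 1

lemma norm_delta (n : Freq) : ‖delta n‖ = 1 := by
  rw [delta, lp.norm_single (by simp)]; simp

/-- Reduces the operator identities for translations, shifts and the Beurling transform to single
characters. -/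
lemma wiener_ext {T T' : Wiener →L[ℂ] X} (h : ∀ n, T (delta n) = T' (delta n)) : T = T' := by
  refine lp.ext_continuousLinearMap (by simp) fun n => ?_
  ext
  simpa [delta] using h n

variable [CompleteSpace X]

lemma summable_smul (b : Wiener) {φ : Freq → X} {C : ℝ} (hφ : ∀ n, ‖φ n‖ ≤ C) :
    Summable (fun n => b n • φ n) := by
  refine Summable.of_norm_bounded ((wiener_summable_norm b).mul_right C) fun n => ?_
  rw [norm_smul]
  exact mul_le_mul_of_nonneg_left (hφ n) (norm_nonneg _)

/-- The operator on absolutely summable families that maps the delta family at `n` to `φ n`. -/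
def wienerLift (φ : Freq → X) (C : ℝ) (hφ : ∀ n, ‖φ n‖ ≤ C) : Wiener →L[ℂ] X :=
  LinearMap.mkContinuous
    { toFun := fun b => ∑' n, b n • φ n
      map_add' := by
        intro b b'
        rw [← (summable_smul b hφ).tsum_add (summable_smul b' hφ)]
        simp [add_smul]
      map_smul' := by
        intro c b
        rw [RingHom.id_apply, ← (summable_smul b hφ).tsum_const_smul c]
        simp [mul_smul] } C (by
    intro b
    refine (tsum_of_norm_bounded ((wiener_summable_norm b).mul_left C).hasSum fun n => ?_).trans_eq ?_
    · rw [norm_smul, mul_comm]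
      exact mul_le_mul_of_nonneg_right (hφ n) (norm_nonneg _)
    · rw [tsum_mul_left, wiener_norm_eq])

lemma wienerLift_apply (φ : Freq → X) (C : ℝ) (hφ : ∀ n, ‖φ n‖ ≤ C) (b : Wiener) :
    wienerLift φ C hφ b = ∑' n, b n • φ n := rfl

lemma wienerLift_norm_le (φ : Freq → X) (C : ℝ) (hφ : ∀ n, ‖φ n‖ ≤ C) :
    ‖wienerLift φ C hφ‖ ≤ C :=
  LinearMap.mkContinuous_norm_le _ ((norm_nonneg _).trans (hφ 0)) _

@[simp] lemma wienerLift_delta (φ : Freq → X) (C : ℝ) (hφ : ∀ n, ‖φ n‖ ≤ C) (n : Freq) :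
    wienerLift φ C hφ (delta n) = φ n := by
  rw [wienerLift_apply, tsum_eq_single n]
  · simp [delta]
  · intro m hm
    simp [delta, hm]

/-- The linear form `z ↦ n₀ Re z + n₁ Im z`. -/
def freqForm (n : Freq) : ℂ →L[ℝ] ℝ := (n 0 : ℝ) • Complex.reCLM + (n 1 : ℝ) • Complex.imCLM

/-- The character `z ↦ exp (2πi (n₀ Re z + n₁ Im z))`. -/
def char (n : Freq) (z : ℂ) : ℂ := Complex.exp (2 * Real.pi * Complex.I * (freqForm n z : ℝ))

/-- The frequency as a complex number. -/
def freqC (n : Freq) : ℂ := n 0 + n 1 * Complex.I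

lemma norm_char (n : Freq) (z : ℂ) : ‖char n z‖ = 1 := by
  rw [char, show (2 * Real.pi * Complex.I * (freqForm n z : ℝ) : ℂ)
    = ((2 * Real.pi * freqForm n z : ℝ) : ℂ) * Complex.I by push_cast; ring]
  exact Complex.norm_exp_ofReal_mul_I _

lemma char_add_freq (n m : Freq) (z : ℂ) : char (n + m) z = char n z * char m z := by
  simp only [char, freqForm, ← Complex.exp_add]
  congr 1
  simp
  ring

@[simp] lemma char_zero_freq (z : ℂ) : char 0 z = 1 := by simp [char, freqForm]

@[simp] lemma char_zero (n : Freq) : char n 0 = 1 := by simp [char]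

/-- With ν = `freqC n`, this shows that ∂/∂z and ∂/∂z̄ multiply the character by πi·ν̄ and πi·ν.
Hence the symbol ν̄/ν of the transform taking ∂/∂z̄ to ∂/∂z. -/
lemma freqForm_eq (n : Freq) (w : ℂ) :
    (2 * freqForm n w : ℂ) = (starRingEnd ℂ) (freqC n) * w + freqC n * (starRingEnd ℂ) w := by
  apply Complex.ext <;> simp [freqForm, freqC] <;> ring

lemma freqC_ne_zero {n : Freq} (hn : n ≠ 0) : freqC n ≠ 0 := by
  intro h
  apply hn
  have h0 := congrArg Complex.re h
  have h1 := congrArg Complex.im h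
  simp [freqC] at h0 h1
  ext i
  fin_cases i <;> simp [h0, h1]

lemma hasFDerivAt_char (n : Freq) (z : ℂ) : HasFDerivAt (char n)
    ((char n z * (2 * Real.pi * Complex.I)) • Complex.ofRealCLM.comp (freqForm n)) z := by
  have h1 : HasFDerivAt (fun z => (2 * Real.pi * Complex.I * (freqForm n z : ℝ) : ℂ))
      ((2 * Real.pi * Complex.I) • Complex.ofRealCLM.comp (freqForm n)) z :=
    (Complex.ofRealCLM.comp (freqForm n)).hasFDerivAt.const_mul _
  have h2 := h1.cexp
  rw [← mul_smul] at h2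
  exact h2

/-- A weight on frequencies. -/
def freqWeight (n : Freq) : ℝ := 1 + |(n 0 : ℝ)| + |(n 1 : ℝ)|

lemma norm_freqForm_le (n : Freq) : ‖freqForm n‖ ≤ freqWeight n := by
  refine ContinuousLinearMap.opNorm_le_bound _ (by unfold freqWeight; positivity) fun w => ?_
  have h1 : |w.re| ≤ ‖w‖ := Complex.abs_re_le_norm w
  have h2 : |w.im| ≤ ‖w‖ := Complex.abs_im_le_norm w
  have h3 : ‖freqForm n w‖ ≤ |(n 0 : ℝ)| * |w.re| + |(n 1 : ℝ)| * |w.im| := by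
    simp only [freqForm, add_apply, smul_apply,
      Complex.reCLM_apply, Complex.imCLM_apply, smul_eq_mul, Real.norm_eq_abs]
    exact (abs_add_le _ _).trans_eq (by rw [abs_mul, abs_mul])
  have h4 := mul_le_mul_of_nonneg_left h1 (abs_nonneg (n 0 : ℝ))
  have h5 := mul_le_mul_of_nonneg_left h2 (abs_nonneg (n 1 : ℝ))
  unfold freqWeight
  nlinarith [norm_nonneg w]

lemma contDiff_char (n : Freq) : ContDiff ℝ ∞ (char n) := by
  have : ContDiff ℝ ∞ (fun z => (2 * Real.pi * Complex.I * (freqForm n z : ℝ) : ℂ)) :=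
    contDiff_const.mul (Complex.ofRealCLM.comp (freqForm n)).contDiff
  exact this.cexp

/-- The character is a one-variable exponential composed with a linear form. The bound is polynomial
in the frequency, as needed for termwise differentiation. -/
lemma norm_iteratedFDeriv_char_le (n : Freq) (k : ℕ) (z : ℂ) :
    ‖iteratedFDeriv ℝ k (char n) z‖ ≤ (2 * Real.pi * freqWeight n) ^ k := by
  set g : ℝ → ℂ := fun s => Complex.exp ((2 * Real.pi * Complex.I) * s) with hg
  have hg' : ContDiff ℝ ∞ g :=
    (contDiff_const.mul Complex.ofRealCLM.contDiff).cexp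
  have hder : ∀ j : ℕ, iteratedDeriv j g = fun s => (2 * Real.pi * Complex.I) ^ j * g s := by
    intro j
    induction j with
    | zero => simp
    | succ j ih =>
      rw [iteratedDeriv_succ, ih]
      funext s
      have h1 : HasDerivAt (fun s : ℝ => ((2 * Real.pi * Complex.I) * s : ℂ))
          (2 * Real.pi * Complex.I) s := by
        simpa using (Complex.ofRealCLM.hasDerivAt (x := s)).const_mul (2 * Real.pi * Complex.I)
      have h2 := h1.cexp.const_mul ((2 * Real.pi * Complex.I) ^ j)
      rw [h2.deriv, hg]
      ring
  have hcomp : char n = g ∘ freqForm n := rfl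
  rw [hcomp, (freqForm n).iteratedFDeriv_comp_right hg' z (i := k) (by exact_mod_cast le_top)]
  refine (ContinuousMultilinearMap.norm_compContinuousLinearMap_le _ _).trans ?_
  rw [norm_iteratedFDeriv_eq_norm_iteratedDeriv, hder, Finset.prod_const, Finset.card_univ,
    Fintype.card_fin]
  have e1 : ‖g (freqForm n z)‖ = 1 := norm_char n z
  have e2 : ‖(2 * Real.pi * Complex.I : ℂ) ^ k * g (freqForm n z)‖ = (2 * Real.pi) ^ k := by
    simp [e1, abs_of_pos Real.pi_pos]
  simp only [e2]
  rw [mul_pow (2 * Real.pi)]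
  exact mul_le_mul_of_nonneg_left (pow_le_pow_left₀ (norm_nonneg _) (norm_freqForm_le n) k)
    (by positivity)

end Wiener

end MetricPencil

end

open scoped ContDiff Topology

noncomputable section

namespace MetricPencil

/-! ### The Beltrami equation with a small periodic coefficient. -/

section BeltramiPeriodic

/-- The translation of families of Fourier coefficients by a frequency. -/
def freqShift (k : Freq) : Wiener →L[ℂ] Wiener :=
  wienerLift (fun n => delta (k + n)) 1 fun _ => (norm_delta _).le

/-- Evaluation of a Fourier series at a point. -/
def evalAt (z : ℂ) : Wiener →L[ℂ] ℂ :=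
  wienerLift (fun n => char n z) 1 fun n => (norm_char n z).le

/-- The effect of a translation of the argument on Fourier coefficients. -/
def translate (t : ℂ) : Wiener →L[ℂ] Wiener :=
  wienerLift (fun n => char n t • delta n) 1 fun n => by simp [norm_smul, norm_char, norm_delta]

lemma norm_conj_div_le (ν : ℂ) : ‖(starRingEnd ℂ) ν / ν‖ ≤ 1 := by
  rw [norm_div, RCLike.norm_conj]
  exact div_self_le_one _

/-- The Beurling transform, with symbol `conj ν / ν`. -/
def beurling : Wiener →L[ℂ] Wiener :=
  wienerLift (fun n => ((starRingEnd ℂ) (freqC n) / freqC n) • delta n) 1 fun n => by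
    simpa [norm_smul, norm_delta] using norm_conj_div_le (freqC n)

variable {a : Freq → ℂ}

/-- Multiplication by the translate by `t` of the Fourier series with coefficients `a`. -/
def mulOp (a : Freq → ℂ) (t : ℂ) : Wiener →L[ℂ] Wiener :=
  ∑' n, char n t • a n • freqShift n

lemma norm_mulOp_term_le (t : ℂ) (n : Freq) : ‖char n t • a n • freqShift n‖ ≤ ‖a n‖ := by
  rw [norm_smul, norm_smul, norm_char, one_mul]
  exact mul_le_of_le_one_right (norm_nonneg _) (wienerLift_norm_le _ _ _)

lemma summable_mulOp (ha : Summable fun n => ‖a n‖) (t : ℂ) :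
    Summable fun n => char n t • a n • freqShift n :=
  Summable.of_norm_bounded ha (norm_mulOp_term_le t)

lemma norm_mulOp_le (ha : Summable fun n => ‖a n‖) (t : ℂ) : ‖mulOp a t‖ ≤ ∑' n, ‖a n‖ :=
  tsum_of_norm_bounded ha.hasSum (norm_mulOp_term_le t)

lemma mulOp_apply (ha : Summable fun n => ‖a n‖) (t : ℂ) (b : Wiener) :
    mulOp a t b = ∑' n, char n t • a n • freqShift n b :=
  (ContinuousLinearMap.apply ℂ Wiener b).map_tsum (summable_mulOp ha t)

lemma evalAt_freqShift (z : ℂ) (n : Freq) (b : Wiener) :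
    evalAt z (freqShift n b) = char n z * evalAt z b := by
  have : (evalAt z).comp (freqShift n) = char n z • evalAt z :=
    wiener_ext fun m => by simp [evalAt, freqShift, char_add_freq]
  exact DFunLike.congr_fun this b

lemma translate_freqShift (t : ℂ) (n : Freq) (b : Wiener) :
    translate t (freqShift n b) = char n t • freqShift n (translate t b) := by
  have : (translate t).comp (freqShift n) = char n t • (freqShift n).comp (translate t) :=
    wiener_ext fun m => by simp [translate, freqShift, char_add_freq, mul_smul]
  exact DFunLike.congr_fun this b

lemma translate_beurling (t : ℂ) (b : Wiener) :
    translate t (beurling b) = beurling (translate t b) := by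
  have : (translate t).comp beurling = beurling.comp (translate t) :=
    wiener_ext fun m => by simp [translate, beurling, smul_smul, mul_comm]
  exact DFunLike.congr_fun this b

lemma evalAt_zero_translate (t : ℂ) (b : Wiener) : evalAt 0 (translate t b) = evalAt t b := by
  have : (evalAt 0).comp (translate t) = evalAt t :=
    wiener_ext fun m => by simp [translate, evalAt]
  exact DFunLike.congr_fun this b

lemma summable_char (ha : Summable fun n => ‖a n‖) (z : ℂ) : Summable fun n => a n * char n z :=
  Summable.of_norm_bounded ha fun n => by simp [norm_char]

lemma evalAt_mulOp (ha : Summable fun n => ‖a n‖) (z : ℂ) (b : Wiener) :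
    evalAt z (mulOp a 0 b) = (∑' n, a n * char n z) * evalAt z b := by
  have hs : Summable fun n => char n 0 • a n • freqShift n b :=
    (summable_mulOp ha 0).map (ContinuousLinearMap.apply ℂ Wiener b)
      (ContinuousLinearMap.continuous _)
  rw [mulOp_apply ha, (evalAt z).map_tsum hs, ← (summable_char ha z).tsum_mul_right]
  congr 1
  funext n
  simp [evalAt_freqShift, mul_assoc]

/-- Translating a product translates both factors. This lets smoothness in the space variable be
obtained as smoothness in the parameter `t` of `mulOp a t`. -/
lemma translate_mulOp (ha : Summable fun n => ‖a n‖) (t : ℂ) (b : Wiener) :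
    translate t (mulOp a 0 b) = mulOp a t (translate t b) := by
  have hs : Summable fun n => char n 0 • a n • freqShift n b :=
    (summable_mulOp ha 0).map (ContinuousLinearMap.apply ℂ Wiener b)
      (ContinuousLinearMap.continuous _)
  rw [mulOp_apply ha, mulOp_apply ha, (translate t).map_tsum hs]
  congr 1
  funext n
  simp [translate_freqShift, smul_smul, mul_comm]

/-- Termwise differentiation: each derivative in `t` costs one power of the frequency, which the
decay of `a` absorbs. -/
lemma contDiff_mulOp (ha : ∀ k : ℕ, Summable fun n => ‖a n‖ * freqWeight n ^ k) :
    ContDiff ℝ ∞ (mulOp a) := by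
  refine contDiff_tsum (N := ⊤)
    (v := fun k n => ‖a n‖ * (2 * Real.pi * freqWeight n) ^ k) ?_ ?_ ?_
  · intro n
    exact (contDiff_char n).smul contDiff_const
  · intro k _
    have := (ha k).mul_left ((2 * Real.pi) ^ k)
    refine this.congr fun n => ?_
    rw [mul_pow (2 * Real.pi)]
    ring
  · intro k n t _
    have h1 := ((ContinuousLinearMap.toSpanSingleton ℂ
      (a n • freqShift n : Wiener →L[ℂ] Wiener)).restrictScalars ℝ).norm_iteratedFDeriv_comp_left
      (contDiff_char n).contDiffAt (x := t) (n := k) (by exact_mod_cast le_top)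
    refine h1.trans ?_
    refine mul_le_mul ?_ (norm_iteratedFDeriv_char_le n k t) (norm_nonneg _) (norm_nonneg _)
    rw [ContinuousLinearMap.norm_restrictScalars, ContinuousLinearMap.norm_toSpanSingleton,
      norm_smul]
    exact mul_le_of_le_one_right (norm_nonneg _) (wienerLift_norm_le _ _ _)

lemma evalAt_beurling (z : ℂ) (b : Wiener) : evalAt z (beurling b) =
    ∑' n, b n * ((starRingEnd ℂ) (freqC n) / freqC n * char n z) := by
  have hb : ∀ n, ‖(starRingEnd ℂ) (freqC n) / freqC n * char n z‖ ≤ 1 := fun n => by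
    rw [norm_mul, norm_char, mul_one]
    exact norm_conj_div_le _
  have : (evalAt z).comp beurling =
      wienerLift (fun n => (starRingEnd ℂ) (freqC n) / freqC n * char n z) 1 hb :=
    wiener_ext fun m => by simp [beurling, evalAt]
  exact DFunLike.congr_fun this b

lemma norm_evalAt_le (z : ℂ) (b : Wiener) : ‖evalAt z b‖ ≤ ‖b‖ := by
  simpa using (evalAt z).le_of_opNorm_le (wienerLift_norm_le _ _ _) b

lemma norm_beurling_le (b : Wiener) : ‖beurling b‖ ≤ ‖b‖ := by
  simpa using beurling.le_of_opNorm_le (wienerLift_norm_le _ _ _) b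

/-- A primitive of a Fourier series with respect to `∂/∂z̄`, up to its constant term. -/
lemma hasFDerivAt_dbar_primitive (h : Wiener) (z : ℂ) :
    HasFDerivAt (fun z => ∑' n, h n / (Real.pi * Complex.I * freqC n) * char n z)
      (evalAt z (beurling h) • (ContinuousLinearMap.id ℝ ℂ)
        + (evalAt z h - h 0) • (Complex.conjCLE : ℂ →L[ℝ] ℂ)) z := by
  -- At frequency 0 the coefficient `h 0 / 0` is 0, so the primitive omits the constant term of `h`;
  -- this is the `- h 0` in the statement.
  set f' : Freq → ℂ → ℂ →L[ℝ] ℂ := fun n z =>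
    (h n * ((starRingEnd ℂ) (freqC n) / freqC n * char n z)) • (ContinuousLinearMap.id ℝ ℂ)
      + (if n = 0 then 0 else h n * char n z) • (Complex.conjCLE : ℂ →L[ℝ] ℂ) with hf'
  have hnorm1 : ∀ n z, ‖h n * ((starRingEnd ℂ) (freqC n) / freqC n * char n z)‖ ≤ ‖h n‖ := by
    intro n z
    rw [norm_mul, norm_mul, norm_char, mul_one]
    exact mul_le_of_le_one_right (norm_nonneg _) (norm_conj_div_le _)
  have hnorm2 : ∀ n z, ‖(if n = 0 then 0 else h n * char n z : ℂ)‖ ≤ ‖h n‖ := by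
    intro n z
    split_ifs
    · simp
    · rw [norm_mul, norm_char, mul_one]
  have hd : ∀ n z, HasFDerivAt (fun z => h n / (Real.pi * Complex.I * freqC n) * char n z)
      (f' n z) z := by
    intro n z
    by_cases hn : n = 0
    · subst hn
      have : f' 0 z = 0 := by
        ext1 w
        simp [hf', freqC]
      rw [this]
      simpa [freqC] using hasFDerivAt_const (0 : ℂ) z
    · refine ((hasFDerivAt_char n z).const_mul _).congr_fderiv ?_
      ext1 w
      have hν := freqC_ne_zero hn
      have h2 : ((freqForm n w : ℝ) : ℂ) = ((starRingEnd ℂ) (freqC n) * w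
          + freqC n * (starRingEnd ℂ) w) / 2 := by
        rw [← freqForm_eq]; ring
      have hπ : (Real.pi : ℂ) ≠ 0 := by exact_mod_cast Real.pi_ne_zero
      have hI := Complex.I_ne_zero
      simp only [hf', hn, if_false, smul_apply, add_apply, smul_eq_mul,
        ContinuousLinearMap.comp_apply, Complex.ofRealCLM_apply, h2,
        ContinuousLinearMap.id_apply, ContinuousLinearEquiv.coe_coe, Complex.conjCLE_apply]
      field_simp
  have hconj : ‖(Complex.conjCLE : ℂ →L[ℝ] ℂ)‖ ≤ 1 :=
    ContinuousLinearMap.opNorm_le_bound _ zero_le_one fun w => by simp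
  have hid : ‖(ContinuousLinearMap.id ℝ ℂ)‖ ≤ 1 := ContinuousLinearMap.norm_id_le
  have hb : ∀ n z, ‖f' n z‖ ≤ 2 * ‖h n‖ := by
    intro n z
    refine (norm_add_le _ _).trans ?_
    rw [norm_smul, norm_smul, two_mul]
    exact add_le_add
      ((mul_le_of_le_one_right (norm_nonneg _) hid).trans (hnorm1 n z))
      ((mul_le_of_le_one_right (norm_nonneg _) hconj).trans (hnorm2 n z))
  have hsum := wiener_summable_norm h
  have hs0 : Summable fun n => h n / (Real.pi * Complex.I * freqC n) * char n 0 := by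
    refine Summable.of_norm_bounded hsum fun n => ?_
    rw [norm_mul, norm_char, mul_one, norm_div]
    by_cases hn : n = 0
    · subst hn; simp [freqC]
    · have h1 : 1 ≤ ‖freqC n‖ := by
        have hpos : 0 < (n 0) ^ 2 + (n 1) ^ 2 := by
          rcases not_and_or.1 (fun h : n 0 = 0 ∧ n 1 = 0 => hn (by
            ext i; fin_cases i <;> simp [h.1, h.2])) with h | h <;> positivity
        have h2 : (1 : ℝ) ≤ (n 0 : ℝ) ^ 2 + (n 1 : ℝ) ^ 2 := by exact_mod_cast hpos
        have h3 : ‖freqC n‖ ^ 2 = (n 0 : ℝ) ^ 2 + (n 1 : ℝ) ^ 2 := by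
          rw [Complex.sq_norm, Complex.normSq_apply]
          simp [freqC]
          ring
        nlinarith [norm_nonneg (freqC n)]
      refine div_le_self (norm_nonneg _) ?_
      rw [norm_mul, norm_mul, Complex.norm_I, mul_one, Complex.norm_real,
        Real.norm_of_nonneg Real.pi_pos.le]
      nlinarith [Real.pi_gt_three]
  have key := hasFDerivAt_tsum (hsum.mul_left 2) hd hb hs0 z
  refine key.congr_fderiv ?_
  have s1 : Summable fun n => h n * ((starRingEnd ℂ) (freqC n) / freqC n * char n z) :=
    Summable.of_norm_bounded hsum fun n => hnorm1 n z
  have s2 : Summable fun n => (if n = 0 then 0 else h n * char n z : ℂ) :=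
    Summable.of_norm_bounded hsum fun n => hnorm2 n z
  have s3 : Summable fun n => h n * char n z :=
    Summable.of_norm_bounded hsum fun n => by simp [norm_char]
  rw [(s1.smul_const _).tsum_add (s2.smul_const _), s1.tsum_smul_const, s2.tsum_smul_const,
    evalAt_beurling]
  congr 2
  have e : evalAt z h = ∑' n, h n * char n z := rfl
  rw [e, s3.tsum_eq_add_tsum_ite 0]
  simp

/-- The Beltrami equation with a small periodic coefficient. -/
theorem exists_beltrami_periodic (ha : ∀ k : ℕ, Summable fun n => ‖a n‖ * freqWeight n ^ k)
    (hsmall : ∑' n, ‖a n‖ < 1 / 2) :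
    ∃ Φ c : ℂ → ℂ, ContDiff ℝ ∞ Φ ∧ ∀ z, c z ≠ 0 ∧ ∀ w,
      fderiv ℝ Φ z w = c z * (w + (∑' n, a n * char n z) * (starRingEnd ℂ) w) := by
  -- Ansatz: Φ = z + h₀z̄ + (primitive of h − h₀), so that ∂Φ/∂z̄ = h and ∂Φ/∂z = 1 + Sh, with S the
  -- Beurling transform. The equation becomes (1 − aS)h = a, solvable because ‖a‖ < 1/2 and ‖S‖ ≤ 1.
  have ha0 : Summable fun n => ‖a n‖ := by simpa using ha 0
  have hM : ∀ t, ‖mulOp a t‖ < 1 / 2 := fun t => (norm_mulOp_le ha0 t).trans_lt hsmall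
  have hMS : ∀ t, ‖mulOp a t * beurling‖ < 1 := by
    intro t
    refine (norm_mul_le _ _).trans_lt ?_
    have : ‖beurling‖ ≤ 1 := wienerLift_norm_le _ _ _
    nlinarith [hM t, norm_nonneg (mulOp a t), norm_nonneg beurling]
  have hU : ∀ t, IsUnit (1 - mulOp a t * beurling) := fun t =>
    isUnit_one_sub_of_norm_lt_one (hMS t)
  set Q : ℂ → Wiener →L[ℂ] Wiener :=
    fun t => Ring.inverse (1 - mulOp a t * beurling) * mulOp a t with hQ
  have hQs : ContDiff ℝ ∞ Q := by
    have h1 := contDiff_mulOp ha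
    rw [contDiff_iff_contDiffAt]
    intro t
    obtain ⟨b, hb⟩ := hU t
    have h2 := contDiffAt_ringInverse ℝ (n := ∞) b
    rw [hb] at h2
    have h3 : ContDiffAt ℝ ∞ (fun t => 1 - mulOp a t * beurling) t :=
      contDiffAt_const.sub (h1.contDiffAt.mul contDiffAt_const)
    exact (h2.comp t h3).mul h1.contDiffAt
  set h : Wiener := Q 0 (delta 0) with hh
  have hsol : ∀ t, ∀ b : Wiener, b = mulOp a t (beurling b + delta 0) → b = Q t (delta 0) := by
    intro t b hb
    have h1 : (1 - mulOp a t * beurling) b = mulOp a t (delta 0) := by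
      have : (1 - mulOp a t * beurling) b = b - mulOp a t (beurling b) := rfl
      rw [this, sub_eq_iff_eq_add]
      conv_lhs => rw [hb]
      rw [map_add, add_comm]
    have h2 := DFunLike.congr_fun (Ring.inverse_mul_cancel _ (hU t)) b
    calc b = Ring.inverse (1 - mulOp a t * beurling) ((1 - mulOp a t * beurling) b) := h2.symm
      _ = _ := by rw [h1]; rfl
  have heq : h = mulOp a 0 (beurling h + delta 0) := by
    have h2 := DFunLike.congr_fun (Ring.mul_inverse_cancel _ (hU 0)) (mulOp a 0 (delta 0))
    have h3 : h - mulOp a 0 (beurling h) = mulOp a 0 (delta 0) := h2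
    rw [map_add, ← h3]
    abel
  -- The translate of `h` solves the equation with the translated coefficient, so uniqueness
  -- expresses it through `Q t`. Evaluation at `t` is evaluation at 0 of the translate, hence
  -- smooth, without decay estimates for `h`.
  have htr : ∀ t, translate t h = Q t (delta 0) := by
    intro t
    apply hsol
    conv_lhs => rw [heq]
    rw [translate_mulOp ha0, map_add, translate_beurling]
    congr 2
    simp [translate]
  -- From h = a(1 + Sh) with ‖a‖ < 1/2. It follows that |Sh| < 1 pointwise, so the factor 1 + Sh
  -- never vanishes.
  have hnorm : ‖h‖ < 1 := by
    have h1 : ‖h‖ ≤ ‖mulOp a 0‖ * ‖beurling h + delta 0‖ := by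
      conv_lhs => rw [heq]
      exact (mulOp a 0).le_opNorm _
    have h2 : ‖beurling h + delta 0‖ ≤ ‖h‖ + 1 := by
      refine (norm_add_le _ _).trans ?_
      rw [norm_delta]
      linarith [norm_beurling_le h]
    have h3 := hM 0
    have h4 := norm_nonneg (mulOp a 0)
    have h5 := norm_nonneg h
    nlinarith
  have hc1 : ContDiff ℝ ∞ (fun z => evalAt z (beurling h)) := by
    have : (fun z => evalAt z (beurling h)) = (((evalAt 0).comp beurling).comp
        (ContinuousLinearMap.apply ℂ Wiener (delta 0))).restrictScalars ℝ ∘ Q := by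
      funext z
      rw [← evalAt_zero_translate, translate_beurling, htr]
      rfl
    rw [this]
    exact (ContinuousLinearMap.contDiff _).comp hQs
  have hc2 : ContDiff ℝ ∞ (fun z => evalAt z h) := by
    have : (fun z => evalAt z h) = ((evalAt 0).comp
        (ContinuousLinearMap.apply ℂ Wiener (delta 0))).restrictScalars ℝ ∘ Q := by
      funext z
      rw [← evalAt_zero_translate, htr]
      rfl
    rw [this]
    exact (ContinuousLinearMap.contDiff _).comp hQs
  set Φ : ℂ → ℂ := fun z => z + h 0 * (starRingEnd ℂ) z
    + ∑' n, h n / (Real.pi * Complex.I * freqC n) * char n z with hΦ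
  have hΦd : ∀ z, HasFDerivAt Φ ((1 + evalAt z (beurling h)) • (ContinuousLinearMap.id ℝ ℂ)
      + evalAt z h • (Complex.conjCLE : ℂ →L[ℝ] ℂ)) z := by
    intro z
    have h1 : HasFDerivAt (fun z => h 0 * (starRingEnd ℂ) z)
        (h 0 • (Complex.conjCLE : ℂ →L[ℝ] ℂ)) z :=
      (Complex.conjCLE : ℂ →L[ℝ] ℂ).hasFDerivAt.const_mul _
    refine (((hasFDerivAt_id z).add h1).add (hasFDerivAt_dbar_primitive h z)).congr_fderiv ?_
    ext1 w
    simp only [smul_apply, add_apply, smul_eq_mul, ContinuousLinearMap.id_apply,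
      ContinuousLinearEquiv.coe_coe, Complex.conjCLE_apply]
    ring
  refine ⟨Φ, fun z => 1 + evalAt z (beurling h), ?_, fun z => ⟨?_, fun w => ?_⟩⟩
  · rw [contDiff_infty_iff_fderiv]
    refine ⟨fun z => (hΦd z).differentiableAt, ?_⟩
    rw [show fderiv ℝ Φ = _ from funext fun z => (hΦd z).fderiv]
    exact ((contDiff_const.add hc1).smul contDiff_const).add (hc2.smul contDiff_const)
  · intro h0
    have h1 : ‖evalAt z (beurling h)‖ = 1 := by
      rw [eq_neg_of_add_eq_zero_right h0]; simp
    linarith [norm_evalAt_le z (beurling h), norm_beurling_le h]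
  · have h1 : evalAt z h = (∑' n, a n * char n z) * (1 + evalAt z (beurling h)) := by
      conv_lhs => rw [heq]
      rw [evalAt_mulOp ha0, map_add, add_comm (evalAt z (beurling h))]
      congr 2
      simp [evalAt]
    rw [(hΦd z).fderiv, h1]
    simp only [smul_apply, add_apply, smul_eq_mul, ContinuousLinearMap.id_apply,
      ContinuousLinearEquiv.coe_coe, Complex.conjCLE_apply]
    ring

end BeltramiPeriodic

end MetricPencil

end

open scoped ContDiff Topology

noncomputable section

namespace MetricPencil

/-! ### Decay of Fourier coefficients and local solvability of the Beltrami equation. -/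

section FourierCoefficients

open MeasureTheory UnitAddTorus

-- The measure has total mass one, so every Fourier coefficient is bounded by the supremum norm.
local instance : MeasureSpace UnitAddCircle := ⟨AddCircle.haarAddCircle⟩

local instance : Measure.IsAddHaarMeasure (volume : Measure UnitAddCircle) :=
  inferInstanceAs (Measure.IsAddHaarMeasure AddCircle.haarAddCircle)

local instance : IsProbabilityMeasure (volume : Measure UnitAddCircle) :=
  inferInstanceAs (IsProbabilityMeasure AddCircle.haarAddCircle)

/-- The two-dimensional torus. -/
abbrev Torus := UnitAddTorus (Fin 2)

lemma integrable_fourier_mul (f : C(Torus, ℂ)) (n : Freq) :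
    Integrable (fun t => mFourier (-n) t • f t) (volume : Measure Torus) := by
  have h : Continuous (fun t => mFourier (-n) t • f t) := by fun_prop
  exact h.integrable_of_hasCompactSupport (HasCompactSupport.of_compactSpace _)

/-- A Fourier coefficient as a bounded linear functional. -/
def coeffCLM (n : Freq) : C(Torus, ℂ) →L[ℝ] ℂ :=
  LinearMap.mkContinuous
    { toFun := fun f => mFourierCoeff f n
      map_add' := by
        intro f g
        unfold mFourierCoeff
        rw [← integral_add (integrable_fourier_mul f n) (integrable_fourier_mul g n)]
        simp [mul_add]
      map_smul' := by
        intro c f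
        unfold mFourierCoeff
        rw [RingHom.id_apply, ← integral_smul]
        congr 1
        funext t
        simp
        ring } 1 (by
    intro f
    have := norm_integral_le_of_norm_le_const (μ := (volume : Measure Torus)) (C := ‖f‖)
      (f := fun t => mFourier (-n) t • f t) (Filter.Eventually.of_forall fun t => by
        rw [norm_smul]
        have h1 : ‖mFourier (-n) t‖ ≤ 1 :=
          ((mFourier (-n)).norm_coe_le_norm t).trans_eq mFourier_norm
        exact (mul_le_of_le_one_left (norm_nonneg _) h1).trans (f.norm_coe_le_norm t))
    rw [probReal_univ, mul_one] at this
    rw [one_mul]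
    exact this)

lemma coeffCLM_apply (n : Freq) (f : C(Torus, ℂ)) : coeffCLM n f = mFourierCoeff f n := rfl

lemma norm_coeffCLM_apply_le (n : Freq) (f : C(Torus, ℂ)) : ‖coeffCLM n f‖ ≤ ‖f‖ := by
  simpa using (coeffCLM n).le_of_opNorm_le (LinearMap.mkContinuous_norm_le _ zero_le_one _) f

/-- The point of the torus with coordinates `Re z`, `Im z`. -/
def toTorus (z : ℂ) : Torus := ![(z.re : UnitAddCircle), (z.im : UnitAddCircle)]

lemma mFourier_toTorus (n : Freq) (z : ℂ) : mFourier n (toTorus z) = char n z := by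
  simp only [mFourier, ContinuousMap.coe_mk, Fin.prod_univ_two, toTorus, Matrix.cons_val_zero,
    Matrix.cons_val_one, fourier_coe_apply, char, freqForm, ← Complex.exp_add]
  congr 1
  simp
  ring

lemma mFourier_add_apply (n : Freq) (x y : Torus) :
    mFourier n (x + y) = mFourier n x * mFourier n y := by
  simp [mFourier, Fin.prod_univ_two, fourier_apply, AddCircle.toCircle_add, smul_add]
  ring

/-- Invariance of the Haar measure under translation by `toTorus t`. -/
lemma coeff_translate (n : Freq) (f g : C(Torus, ℂ)) (t : ℂ)
    (h : ∀ x, g x = f (x + toTorus t)) : coeffCLM n g = char n t * coeffCLM n f := by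
  rw [coeffCLM_apply, coeffCLM_apply]
  unfold mFourierCoeff
  have h1 : (fun x => mFourier (-n) x • g x) =
      fun x => char n t • (fun y => mFourier (-n) y • f y) (x + toTorus t) := by
    funext x
    have h2 : mFourier n (toTorus t) * mFourier (-n) (toTorus t) = 1 := by
      rw [← mFourier_add, add_neg_cancel, mFourier_zero]; rfl
    simp only [h, ← mFourier_toTorus, mFourier_add_apply, smul_eq_mul]
    linear_combination (-(mFourier (-n) x * f (x + toTorus t))) * h2
  rw [h1, integral_smul, integral_add_right_eq_self (μ := (volume : Measure Torus))
    (fun y => mFourier (-n) y • f y) (toTorus t), smul_eq_mul]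

/-- Families of Fourier coefficients, depending on a parameter `ε` and vanishing for `ε = 0`, of
functions whose translates depend smoothly on `ε` and the translation. -/
def IsFourierFamily (a : Freq → ℝ → ℂ) : Prop :=
  ∃ Ψ : ℝ × ℂ → C(Torus, ℂ), ContDiff ℝ ∞ Ψ ∧ (∀ t, Ψ (0, t) = 0) ∧
    ∀ ε t n, coeffCLM n (Ψ (ε, t)) = char n t * a n ε

lemma IsFourierFamily.sub {a b : Freq → ℝ → ℂ} (ha : IsFourierFamily a) (hb : IsFourierFamily b) :
    IsFourierFamily (fun n ε => a n ε - b n ε) := by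
  obtain ⟨Ψ, h1, h2, h3⟩ := ha
  obtain ⟨Ψ', h1', h2', h3'⟩ := hb
  refine ⟨fun p => Ψ p - Ψ' p, h1.sub h1', fun t => by simp [h2, h2'], fun ε t n => ?_⟩
  rw [map_sub, h3, h3']
  ring

/-- Differentiating the translates in the translation parameter, in the direction `v`,
differentiates the functions and multiplies each coefficient by the logarithmic derivative of its
character. -/
lemma IsFourierFamily.deriv {a : Freq → ℝ → ℂ} (ha : IsFourierFamily a) (v : ℂ) :
    IsFourierFamily (fun n ε => 2 * Real.pi * Complex.I * (freqForm n v : ℝ) * a n ε) := by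
  obtain ⟨Ψ, h1, h2, h3⟩ := ha
  have hd : ∀ ε t, HasFDerivAt (fun t => Ψ (ε, t))
      ((fderiv ℝ Ψ (ε, t)).comp (ContinuousLinearMap.inr ℝ ℝ ℂ)) t := by
    intro ε t
    have h4 : HasFDerivAt (fun t : ℂ => ((ε, t) : ℝ × ℂ)) (ContinuousLinearMap.inr ℝ ℝ ℂ) t := by
      refine ((hasFDerivAt_const ε t).prodMk (hasFDerivAt_id t)).congr_fderiv ?_
      ext w <;> simp
    exact HasFDerivAt.comp t (h1.differentiable (by simp) (ε, t)).hasFDerivAt h4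
  refine ⟨fun p => fderiv ℝ Ψ p (0, v), ?_, fun t => ?_, fun ε t n => ?_⟩
  · exact (h1.fderiv_right (m := ∞) (by simp)).clm_apply contDiff_const
  · have h4 := hd 0 t
    rw [show (fun t => Ψ (0, t)) = fun _ => 0 from funext h2] at h4
    exact DFunLike.congr_fun (h4.unique (hasFDerivAt_const _ _)) v
  · have h4 := (coeffCLM n).hasFDerivAt.comp t (hd ε t)
    have h5 : HasFDerivAt (fun t => char n t * a n ε) _ t := (hasFDerivAt_char n t).mul_const (a n ε)
    rw [show (coeffCLM n ∘ fun t => Ψ (ε, t)) = fun t => char n t * a n ε from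
      funext fun t => h3 ε t n] at h4
    have h6 := DFunLike.congr_fun (h4.unique h5) v
    simp only [ContinuousLinearMap.comp_apply, ContinuousLinearMap.inr_apply, smul_apply,
      smul_eq_mul, Complex.ofRealCLM_apply] at h6
    rw [h6]
    ring

/-- A polynomial weight on frequencies, the symbol of a differential operator. -/
def freqSymbol (n : Freq) : ℝ :=
  (1 + (2 * Real.pi * n 0) ^ 2) * (1 + (2 * Real.pi * n 1) ^ 2)

lemma one_le_freqSymbol (n : Freq) : 1 ≤ freqSymbol n :=
  one_le_mul_of_one_le_of_one_le (by linarith [sq_nonneg (2 * Real.pi * n 0)])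
    (by linarith [sq_nonneg (2 * Real.pi * n 1)])

lemma freqWeight_le (n : Freq) : freqWeight n ≤ freqSymbol n := by
  have key : ∀ m : ℤ, |(m : ℝ)| ≤ (2 * Real.pi * m) ^ 2 := by
    intro m
    have h1 : |(m : ℝ)| ≤ (m : ℝ) ^ 2 := by
      have : |m| ≤ m ^ 2 := by
        rw [← sq_abs]
        rcases eq_or_ne m 0 with h | h
        · simp [h]
        · nlinarith [Int.one_le_abs h]
      exact_mod_cast this
    have h2 : (1 : ℝ) ≤ (2 * Real.pi) ^ 2 := by nlinarith [Real.pi_gt_three]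
    rw [mul_pow]
    nlinarith [sq_nonneg (m : ℝ)]
  unfold freqWeight freqSymbol
  nlinarith [key (n 0), key (n 1), sq_nonneg (2 * Real.pi * n 0), sq_nonneg (2 * Real.pi * n 1),
    mul_nonneg (sq_nonneg (2 * Real.pi * n 0)) (sq_nonneg (2 * Real.pi * n 1))]

/-- `freqSymbol` is the symbol of (1 − ∂²/∂x²)(1 − ∂²/∂y²), applied one factor at a time. Unlike the
symbol of 1 − Δ, its inverse is a product of two summable families. -/
lemma IsFourierFamily.symbol_mul {a : Freq → ℝ → ℂ} (ha : IsFourierFamily a) :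
    IsFourierFamily (fun n ε => freqSymbol n * a n ε) := by
  have h1 : IsFourierFamily (fun n ε => (1 + (2 * Real.pi * n 0) ^ 2) * a n ε) := by
    convert ha.sub ((ha.deriv 1).deriv 1) using 3 with n ε
    simp [freqForm]
    linear_combination ((4 * (Real.pi : ℂ) ^ 2 * (n 0) ^ 2 * a n ε)) * Complex.I_sq
  convert h1.sub ((h1.deriv Complex.I).deriv Complex.I) using 3 with n ε
  simp [freqForm, freqSymbol]
  linear_combination ((4 * (Real.pi : ℂ) ^ 2 * (n 1) ^ 2 *
    ((1 + (2 * Real.pi * n 0) ^ 2) * a n ε))) * Complex.I_sq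

lemma IsFourierFamily.symbol_pow_mul {a : Freq → ℝ → ℂ} (ha : IsFourierFamily a) (k : ℕ) :
    IsFourierFamily (fun n ε => (freqSymbol n : ℂ) ^ k * a n ε) := by
  induction k with
  | zero => simpa using ha
  | succ k ih =>
    convert ih.symbol_mul using 3 with n ε
    ring

/-- The bound is the supremum norm of the function, continuous in `ε` and zero at `ε = 0`. Applied
after `symbol_mul`, it yields decay in the frequency together with smallness in `ε`. -/
lemma IsFourierFamily.bound {a : Freq → ℝ → ℂ} (ha : IsFourierFamily a) :
    ∃ C : ℝ → ℝ, Filter.Tendsto C (𝓝 0) (𝓝 0) ∧ ∀ n ε, ‖a n ε‖ ≤ C ε := by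
  obtain ⟨Ψ, h1, h2, h3⟩ := ha
  refine ⟨fun ε => ‖Ψ (ε, 0)‖, ?_, fun n ε => ?_⟩
  · have : Continuous (fun ε => ‖Ψ (ε, 0)‖) := (h1.continuous.comp (by fun_prop)).norm
    exact this.tendsto' 0 0 (by simp [h2])
  · have := norm_coeffCLM_apply_le n (Ψ (ε, 0))
    rwa [h3, char_zero, one_mul] at this

lemma summable_inv_freqSymbol : Summable fun n : Freq => (freqSymbol n)⁻¹ := by
  have h1 : Summable fun m : ℤ => (1 + (2 * Real.pi * (m : ℝ)) ^ 2)⁻¹ := by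
    refine Summable.of_norm_bounded_eventually
      (Real.summable_one_div_int_pow.2 (by norm_num : 1 < 2)) ?_
    rw [Filter.eventually_cofinite]
    refine (Set.finite_singleton (0 : ℤ)).subset fun m hm => ?_
    by_contra h0
    apply hm
    rw [Real.norm_of_nonneg (by positivity), one_div]
    have : (0 : ℝ) < (m : ℝ) ^ 2 := by
      have : (m : ℝ) ≠ 0 := by exact_mod_cast h0
      positivity
    refine inv_anti₀ this ?_
    have h2 : (1 : ℝ) ≤ (2 * Real.pi) ^ 2 := by nlinarith [Real.pi_gt_three]
    rw [mul_pow]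
    nlinarith
  have h2 := h1.mul_of_nonneg h1 (fun m => by positivity) (fun m => by positivity)
  have h3 := (finTwoArrowEquiv ℤ).summable_iff.2 h2
  refine h3.congr fun n => ?_
  simp [freqSymbol, mul_comm]

/-- Of the `k + 1` powers of the symbol, `k` dominate the weight and the last one makes the series
converge. -/
lemma IsFourierFamily.summable {a : Freq → ℝ → ℂ} (ha : IsFourierFamily a) (ε : ℝ) (k : ℕ) :
    Summable fun n => ‖a n ε‖ * freqWeight n ^ k := by
  obtain ⟨C, -, hC⟩ := (ha.symbol_pow_mul (k + 1)).bound
  refine Summable.of_nonneg_of_le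
    (fun n => mul_nonneg (norm_nonneg _) (pow_nonneg (by unfold freqWeight; positivity) _))
    (fun n => ?_) (summable_inv_freqSymbol.mul_left (C ε))
  have h1 := hC n ε
  have hQ : 0 < freqSymbol n := zero_lt_one.trans_le (one_le_freqSymbol n)
  rw [norm_mul, norm_pow, Complex.norm_real, Real.norm_of_nonneg hQ.le] at h1
  rw [le_mul_inv_iff₀ hQ]
  refine le_trans ?_ h1
  have h2 : freqWeight n ^ k ≤ freqSymbol n ^ k :=
    pow_le_pow_left₀ (by unfold freqWeight; positivity) (freqWeight_le n) k
  rw [pow_succ]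
  nlinarith [mul_le_mul_of_nonneg_left h2 (mul_nonneg (norm_nonneg (a n ε)) hQ.le)]

lemma IsFourierFamily.eventually_small {a : Freq → ℝ → ℂ} (ha : IsFourierFamily a) :
    ∀ᶠ ε in 𝓝 (0 : ℝ), ∑' n, ‖a n ε‖ < 1 / 2 := by
  obtain ⟨C, hC0, hC⟩ := ha.symbol_mul.bound
  have h1 : Filter.Tendsto (fun ε => C ε * ∑' n, (freqSymbol n)⁻¹) (𝓝 0) (𝓝 0) := by
    simpa using hC0.mul_const (∑' n, (freqSymbol n)⁻¹)
  filter_upwards [h1.eventually (gt_mem_nhds (by norm_num : (0 : ℝ) < 1 / 2))] with ε hε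
  refine lt_of_le_of_lt ?_ hε
  rw [← tsum_mul_left]
  refine Summable.tsum_le_tsum (fun n => ?_) (by simpa using ha.summable ε 0)
    (summable_inv_freqSymbol.mul_left _)
  have h2 := hC n ε
  have hQ : 0 < freqSymbol n := zero_lt_one.trans_le (one_le_freqSymbol n)
  rw [norm_mul, Complex.norm_real, Real.norm_of_nonneg hQ.le] at h2
  rwa [le_mul_inv_iff₀ hQ, mul_comm]

/-- A periodic function is written as a smooth function of two circle variables in ℂ². Translation
then rotates these variables, so smoothness in `(ε, t)` follows from `contDiff_postcomp`. -/
lemma exists_fourierFamily {G : ℝ × ℂ × ℂ → ℂ} (hG : ContDiff ℝ ∞ G)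
    (hG0 : ∀ q, G (0, q) = 0) :
    ∃ a : Freq → ℝ → ℂ, IsFourierFamily a ∧ ∀ ε z, ∑' n, a n ε * char n z =
      G (ε, char ![1, 0] z, char ![0, 1] z) := by
  set E : Fin 2 → C(Torus, ℂ) := fun j => ⟨fun x => fourier 1 (x j), by fun_prop⟩ with hE
  have hEn : ∀ j x, ‖E j x‖ = 1 := fun j x => by simp [hE, Circle.norm_coe]
  obtain ⟨L, hLa⟩ : ∃ L : ℝ × ℂ × ℂ →L[ℝ] C(Torus, ℝ × ℂ × ℂ), ∀ p x,
      L p x = (p.1, p.2.1 * E 0 x, p.2.2 * E 1 x) := ⟨LinearMap.mkContinuous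
    { toFun := fun p => ⟨fun x => (p.1, p.2.1 * E 0 x, p.2.2 * E 1 x), by fun_prop⟩
      map_add' := by intro p q; ext x <;> simp [add_mul]
      map_smul' := by intro c p; ext x <;> simp [mul_assoc] } 1 (by
    intro p
    rw [one_mul, ContinuousMap.norm_le _ (norm_nonneg _)]
    intro x
    refine max_le (norm_fst_le p) (max_le ?_ ?_)
    · show ‖p.2.1 * E 0 x‖ ≤ ‖p‖
      rw [norm_mul, hEn, mul_one]
      exact (norm_fst_le p.2).trans (norm_snd_le p)
    · show ‖p.2.2 * E 1 x‖ ≤ ‖p‖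
      rw [norm_mul, hEn, mul_one]
      exact (norm_snd_le p.2).trans (norm_snd_le p)), fun p x => rfl⟩
  set Ψ : ℝ × ℂ → C(Torus, ℂ) := fun p => (⟨G, hG.continuous⟩ : C(ℝ × ℂ × ℂ, ℂ)).comp
    (L (p.1, char ![1, 0] p.2, char ![0, 1] p.2)) with hΨ
  have hΨa : ∀ ε t x, Ψ (ε, t) x = G (ε, char ![1, 0] t * E 0 x, char ![0, 1] t * E 1 x) := by
    intro ε t x
    simp [hΨ, hLa]
  have hΨs : ContDiff ℝ ∞ Ψ := by
    have h1 : ContDiff ℝ ∞ L := by fun_prop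
    refine (contDiff_postcomp hG).comp (h1.comp ?_)
    exact contDiff_fst.prodMk (((contDiff_char _).comp contDiff_snd).prodMk
      ((contDiff_char _).comp contDiff_snd))
  have hE0 : ∀ x t, E 0 (x + toTorus t) = char ![1, 0] t * E 0 x := by
    intro x t
    rw [← mFourier_toTorus]
    simp [hE, mFourier, Fin.prod_univ_two, fourier_apply, AddCircle.toCircle_add, mul_comm]
  have hE1 : ∀ x t, E 1 (x + toTorus t) = char ![0, 1] t * E 1 x := by
    intro x t
    rw [← mFourier_toTorus]
    simp [hE, mFourier, Fin.prod_univ_two, fourier_apply, AddCircle.toCircle_add, mul_comm]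
  have hfam : IsFourierFamily (fun n ε => coeffCLM n (Ψ (ε, 0))) := by
    refine ⟨Ψ, hΨs, fun t => ?_, fun ε t n => ?_⟩
    · ext x
      rw [hΨa, hG0]
      rfl
    · apply coeff_translate
      intro x
      rw [hΨa, hΨa, char_zero, char_zero, one_mul, one_mul, hE0, hE1]
  refine ⟨_, hfam, fun ε z => ?_⟩
  have hs : Summable (mFourierCoeff (Ψ (ε, 0))) := by
    refine Summable.of_norm ?_
    have h0 := hfam.summable ε 0
    simp only [pow_zero, mul_one, coeffCLM_apply] at h0
    exact h0
  have h1 := (hasSum_mFourier_series_apply_of_summable hs (toTorus z)).tsum_eq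
  simp only [smul_eq_mul, mFourier_toTorus] at h1
  have e0 : E 0 (toTorus z) = char ![1, 0] z := by
    rw [← mFourier_toTorus]; simp [hE, mFourier, Fin.prod_univ_two]
  have e1 : E 1 (toTorus z) = char ![0, 1] z := by
    rw [← mFourier_toTorus]; simp [hE, mFourier, Fin.prod_univ_two]
  rw [hΨa, char_zero, char_zero, one_mul, one_mul, e0, e1] at h1
  exact h1

/-- Local solvability of the Beltrami equation with a smooth coefficient vanishing at the
origin. -/
theorem exists_beltrami {ρ : ℂ → ℂ} (hρ : ∀ᶠ z in 𝓝 (0 : ℂ), ContDiffAt ℝ ∞ ρ z)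
    (hρ0 : ρ 0 = 0) :
    ∃ Φ c : ℂ → ℂ, ContDiff ℝ ∞ Φ ∧ ∀ᶠ z in 𝓝 (0 : ℂ), c z ≠ 0 ∧ ∀ w,
      fderiv ℝ Φ z w = c z * (w + ρ z * (starRingEnd ℂ) w) := by
  obtain ⟨r, hr, hrρ⟩ := exists_contDiff_eventuallyEq hρ
  have hr0 : r 0 = 0 := hrρ.self_of_nhds.trans hρ0
  -- With g = arcsin/2π near 0, the function g(sin 2πx) is smooth, periodic and equal to x near 0.
  -- Substituting it for both real coordinates makes ρ(εz) periodic without changing its germ. As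
  -- ρ(0) = 0, small ε makes the coefficient small; the dilation is undone at the end.
  have harc : ∀ᶠ y in 𝓝 (0 : ℝ), ContDiffAt ℝ ∞ (fun y => Real.arcsin y / (2 * Real.pi)) y := by
    filter_upwards [lt_mem_nhds (by norm_num : (-1 : ℝ) < 0),
      gt_mem_nhds (by norm_num : (0 : ℝ) < 1)] with y h1 h2
    exact (Real.contDiffAt_arcsin h1.ne' h2.ne).div_const _
  obtain ⟨g, hg, hgarc⟩ := exists_contDiff_eventuallyEq harc
  have hgsin : ∀ᶠ x in 𝓝 (0 : ℝ), g (Real.sin (2 * Real.pi * x)) = x := by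
    have h1 : Filter.Tendsto (fun x => Real.sin (2 * Real.pi * x)) (𝓝 0) (𝓝 0) := by
      have : Continuous (fun x => Real.sin (2 * Real.pi * x)) := by fun_prop
      exact this.tendsto' 0 0 (by simp)
    filter_upwards [h1.eventually hgarc, lt_mem_nhds (by norm_num : (-(1 / 4) : ℝ) < 0),
      gt_mem_nhds (by norm_num : (0 : ℝ) < 1 / 4)] with x hx h2 h3
    rw [hx, Real.arcsin_sin (by nlinarith [Real.pi_pos]) (by nlinarith [Real.pi_pos])]
    field_simp
  set G : ℝ × ℂ × ℂ → ℂ := fun p =>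
    r (p.1 * ((g p.2.1.im : ℝ) + (g p.2.2.im : ℝ) * Complex.I)) with hG
  have hGs : ContDiff ℝ ∞ G := by
    have e1 : ContDiff ℝ ∞ (fun p : ℝ × ℂ × ℂ => ((p.1 : ℝ) : ℂ)) :=
      Complex.ofRealCLM.contDiff.comp contDiff_fst
    have e2 : ContDiff ℝ ∞ (fun p : ℝ × ℂ × ℂ => ((g p.2.1.im : ℝ) : ℂ)) :=
      Complex.ofRealCLM.contDiff.comp (hg.comp (Complex.imCLM.contDiff.comp
        (contDiff_fst.comp contDiff_snd)))
    have e3 : ContDiff ℝ ∞ (fun p : ℝ × ℂ × ℂ => ((g p.2.2.im : ℝ) : ℂ)) :=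
      Complex.ofRealCLM.contDiff.comp (hg.comp (Complex.imCLM.contDiff.comp
        (contDiff_snd.comp contDiff_snd)))
    exact hr.comp (e1.mul (e2.add (e3.mul contDiff_const)))
  obtain ⟨a, ha, hasum⟩ := exists_fourierFamily hGs (fun q => by simp [hG, hr0])
  obtain ⟨ε, hε, hsmall⟩ : ∃ ε : ℝ, 0 < ε ∧ ∑' n, ‖a n ε‖ < 1 / 2 := by
    have h1 : ∀ᶠ ε in 𝓝[>] (0 : ℝ), ∑' n, ‖a n ε‖ < 1 / 2 :=
      nhdsWithin_le_nhds ha.eventually_small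
    obtain ⟨ε, h2, h3⟩ := (h1.and self_mem_nhdsWithin).exists
    exact ⟨ε, h3, h2⟩
  obtain ⟨Φ, c, hΦ, hΦc⟩ := exists_beltrami_periodic (fun k => ha.summable ε k) hsmall
  have him : ∀ z, (char ![1, 0] z).im = Real.sin (2 * Real.pi * z.re) ∧
      (char ![0, 1] z).im = Real.sin (2 * Real.pi * z.im) := by
    intro z
    constructor
    · rw [char, show (2 * Real.pi * Complex.I * (freqForm ![1, 0] z : ℝ) : ℂ)
        = ((2 * Real.pi * z.re : ℝ) : ℂ) * Complex.I by simp [freqForm]; ring]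
      exact Complex.exp_ofReal_mul_I_im _
    · rw [char, show (2 * Real.pi * Complex.I * (freqForm ![0, 1] z : ℝ) : ℂ)
        = ((2 * Real.pi * z.im : ℝ) : ℂ) * Complex.I by simp [freqForm]; ring]
      exact Complex.exp_ofReal_mul_I_im _
  have hcoef : ∀ᶠ z in 𝓝 (0 : ℂ), ∑' n, a n ε * char n z = ρ (ε * z) := by
    have t1 : Filter.Tendsto Complex.re (𝓝 0) (𝓝 0) := Complex.continuous_re.tendsto 0
    have t2 : Filter.Tendsto Complex.im (𝓝 0) (𝓝 0) := Complex.continuous_im.tendsto 0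
    have t3 : Filter.Tendsto (fun z : ℂ => ε * z) (𝓝 0) (𝓝 0) := by
      have : Continuous (fun z : ℂ => ε * z) := by fun_prop
      exact this.tendsto' 0 0 (by simp)
    filter_upwards [t1.eventually hgsin, t2.eventually hgsin, t3.eventually hrρ] with z h1 h2 h3
    rw [hasum, hG]
    simp only [him, h1, h2, Complex.re_add_im, h3]
  have hεC : (ε : ℂ) ≠ 0 := by exact_mod_cast hε.ne'
  set m : ℂ →L[ℝ] ℂ := ε⁻¹ • ContinuousLinearMap.id ℝ ℂ with hm
  refine ⟨Φ ∘ m, fun z => c (m z) * (ε : ℂ)⁻¹, hΦ.comp m.contDiff, ?_⟩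
  have t4 : Filter.Tendsto m (𝓝 0) (𝓝 0) := m.continuous.tendsto' 0 0 (map_zero m)
  filter_upwards [t4.eventually hcoef] with z hz
  refine ⟨mul_ne_zero (hΦc _).1 (inv_ne_zero hεC), fun w => ?_⟩
  have hd : HasFDerivAt (Φ ∘ m) ((fderiv ℝ Φ (m z)).comp m) z :=
    ((hΦ.differentiable (by simp)) (m z)).hasFDerivAt.comp z m.hasFDerivAt
  rw [hd.fderiv, ContinuousLinearMap.comp_apply, (hΦc _).2, hz]
  have hmz : ∀ z, m z = (ε : ℂ)⁻¹ * z := fun z => by simp [hm]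
  rw [hmz, hmz, map_mul, map_inv₀, Complex.conj_ofReal, mul_inv_cancel_left₀ hεC]
  ring

end FourierCoefficients

end MetricPencil

end

open scoped ContDiff Topology

noncomputable section

namespace MetricPencil

/-! ### Coordinates whose differential is proportional to an integrable form. -/

section Coordinates

variable {V : Type} [NormedAddCommGroup V] [NormedSpace ℝ V]

/-- If `ker θ ⊆ ker α` then `α` factors through `θ`, smoothly near a point where `θ` is onto. -/
lemma exists_smooth_factor {W : Type*} [NormedAddCommGroup W] [NormedSpace ℝ W]
    [FiniteDimensional ℝ W] {θ α : V → V →L[ℝ] W} {p : V}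
    (hθ : ∀ᶠ x in 𝓝 p, ContDiffAt ℝ ∞ θ x) (hα : ∀ᶠ x in 𝓝 p, ContDiffAt ℝ ∞ α x)
    (hsurj : Function.Surjective (θ p)) (hp : α p = θ p)
    (hker : ∀ᶠ x in 𝓝 p, ∀ h, θ x h = 0 → α x h = 0) :
    ∃ Q : V → W →L[ℝ] W, Q p = 1 ∧ (∀ᶠ x in 𝓝 p, ContDiffAt ℝ ∞ Q x) ∧
      ∀ᶠ x in 𝓝 p, Function.Surjective (θ x) ∧ ∀ h, α x h = Q x (θ x h) := by
  have : CompleteSpace W := FiniteDimensional.complete ℝ W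
  obtain ⟨r', hr'⟩ := (θ p : V →ₗ[ℝ] W).exists_rightInverse_of_surjective
    (LinearMap.range_eq_top.2 hsurj)
  set r : W →L[ℝ] V := LinearMap.toContinuousLinearMap r' with hr
  have hθr : ∀ w, θ p (r w) = w := fun w => LinearMap.congr_fun hr' w
  set B : V → W →L[ℝ] W := fun x => (θ x).comp r with hB
  have hB0 : B p = 1 := by
    ext w
    simp [hB, hθr]
  have hBs : ∀ᶠ x in 𝓝 p, ContDiffAt ℝ ∞ B x := by
    filter_upwards [hθ] with z hz
    exact hz.clm_comp contDiffAt_const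
  have hBu : ∀ᶠ x in 𝓝 p, IsUnit (B x) := by
    have h1 : ContinuousAt B p := hBs.self_of_nhds.continuousAt
    have h2 : {T : W →L[ℝ] W | IsUnit T} ∈ 𝓝 (B p) := by
      rw [hB0]
      exact Units.isOpen.mem_nhds isUnit_one
    exact h1 h2
  -- `r ∘ B⁻¹` is a right inverse of `θ x`, so `h - r (B⁻¹ (θ x h))` lies in `ker θ x` and is killed
  -- by `α x`.
  refine ⟨fun x => ((α x).comp r).comp (Ring.inverse (B x)), ?_, ?_, ?_⟩
  · simp only [hB0, Ring.inverse_one, hp]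
    exact hB0
  · filter_upwards [hα, hBs, hBu] with z h1 h2 h3
    obtain ⟨b, hb⟩ := h3
    have h4 : ContDiffAt ℝ ∞ (fun z => Ring.inverse (B z)) z := by
      have := contDiffAt_ringInverse ℝ (n := ∞) b
      rw [hb] at this
      exact this.comp z h2
    exact (h1.clm_comp contDiffAt_const).clm_comp h4
  · filter_upwards [hBu, hker] with x h1 h2
    have hright : ∀ w, θ x (r (Ring.inverse (B x) w)) = w := fun w =>
      DFunLike.congr_fun (Ring.mul_inverse_cancel _ h1) w
    refine ⟨fun w => ⟨_, hright w⟩, fun h => ?_⟩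
    have h3 := h2 (h - r (Ring.inverse (B x) (θ x h))) (by rw [map_sub, hright, sub_self])
    rw [map_sub, sub_eq_zero] at h3
    exact h3

variable [FiniteDimensional ℝ V]

/-- A real coordinate whose differential is proportional to an integrable form `θ`. -/
theorem exists_real_coordinate {θ : V → V →L[ℝ] ℝ} {p : V}
    (hθ : ∀ᶠ x in 𝓝 p, ContDiffAt ℝ ∞ θ x) (hsurj : Function.Surjective (θ p))
    (hintg : ∀ᶠ x in 𝓝 p, ∀ h l, θ x h = 0 → θ x l = 0 →
      fderiv ℝ θ x h l = fderiv ℝ θ x l h)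
    {φ : V → ℂ} (hφ : ∀ᶠ x in 𝓝 p, ContDiffAt ℝ ∞ φ x)
    (hφθ : ∀ᶠ x in 𝓝 p, ∀ h, θ x h = 0 → fderiv ℝ φ x h = 0) :
    ∃ (u : V → ℝ) (F : ℝ → ℂ), (∀ᶠ x in 𝓝 p, ContDiffAt ℝ ∞ u x) ∧
      (∀ᶠ x in 𝓝 p, ∃ c : ℝ, c ≠ 0 ∧ ∀ h, fderiv ℝ u x h = c * θ x h) ∧
      (∀ᶠ t in 𝓝 (u p), ContDiffAt ℝ ∞ F t) ∧ ∀ᶠ x in 𝓝 p, φ x = F (u x) := by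
  obtain ⟨v, s, hv, hs, hvp, hsp, hdp, hker, hρ⟩ := exists_first_integral hθ hsurj hintg
  have hα : ∀ᶠ x in 𝓝 p, ContDiffAt ℝ ∞ (fderiv ℝ v) x := by
    filter_upwards [hv] with x hx using hx.fderiv_right (m := ∞) (by simp)
  obtain ⟨Q, hQp, hQs, hQ⟩ := exists_smooth_factor hθ hα hsurj hdp hker
  refine ⟨v, φ ∘ s, hv, ?_, ?_, ?_⟩
  · have h1 : ∀ᶠ x in 𝓝 p, Q x 1 ≠ 0 := by
      have h2 : ContinuousAt (fun x => Q x 1) p :=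
        hQs.self_of_nhds.continuousAt.clm_apply continuousAt_const
      exact h2.eventually_ne (by rw [hQp]; simp)
    filter_upwards [h1, hQ] with x h1 h2
    refine ⟨Q x 1, h1, fun h => ?_⟩
    rw [h2.2, mul_comm, ← smul_eq_mul, ← map_smul, smul_eq_mul, mul_one]
  · rw [hvp]
    have h1 : Filter.Tendsto s (𝓝 0) (𝓝 p) := hs.continuous.tendsto' 0 p hsp
    filter_upwards [h1.eventually hφ] with t ht
    exact ht.comp t hs.contDiffAt
  · refine hρ φ ?_
    filter_upwards [hφ, hφθ] with x h1 h2
    exact ⟨h1.differentiableAt (by simp), h2⟩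

/-- Splits off the complex-antilinear part, which measures the failure of dv to be a complex
multiple of θ. -/
lemma realLinear_eq (Q : ℂ →L[ℝ] ℂ) (w : ℂ) :
    Q w = (Q 1 - Complex.I * Q Complex.I) / 2 * w
      + (Q 1 + Complex.I * Q Complex.I) / 2 * (starRingEnd ℂ) w := by
  have h1 : Q w = w.re * Q 1 + w.im * Q Complex.I := by
    conv_lhs => rw [show w = w.re • (1 : ℂ) + w.im • Complex.I by simp [Complex.re_add_im]]
    rw [map_add, map_smul, map_smul]
    simp
  have h2 : w = w.re + w.im * Complex.I := (Complex.re_add_im w).symm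
  have h3 : (starRingEnd ℂ) w = w.re - w.im * Complex.I := by
    apply Complex.ext <;> simp
  rw [h1, h3]
  conv_rhs => rw [h2]
  simp only [Complex.add_re, Complex.ofReal_re, Complex.mul_re, Complex.I_re, mul_zero,
    Complex.ofReal_im, Complex.I_im, mul_one, sub_self, add_zero, Complex.add_im, Complex.mul_im,
    zero_add]
  linear_combination ((w.im : ℂ) * Q Complex.I) * Complex.I_sq

/-- A complex coordinate whose differential is proportional to an integrable complex form `θ`. -/
theorem exists_complex_coordinate {θ : V → V →L[ℝ] ℂ} {p : V}
    (hθ : ∀ᶠ x in 𝓝 p, ContDiffAt ℝ ∞ θ x) (hsurj : Function.Surjective (θ p))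
    (hintg : ∀ᶠ x in 𝓝 p, ∀ h, θ x h = 0 → ∃ k : ℂ, ∀ l,
      fderiv ℝ θ x h l - fderiv ℝ θ x l h = k * θ x l)
    {φ : V → ℂ} (hφ : ∀ᶠ x in 𝓝 p, ContDiffAt ℝ ∞ φ x)
    (hφθ : ∀ᶠ x in 𝓝 p, ∃ k : ℂ, ∀ h, fderiv ℝ φ x h = k * θ x h) :
    ∃ (u : V → ℂ) (F : ℂ → ℂ), (∀ᶠ x in 𝓝 p, ContDiffAt ℝ ∞ u x) ∧
      (∀ᶠ x in 𝓝 p, ∃ c : ℂ, c ≠ 0 ∧ ∀ h, fderiv ℝ u x h = c * θ x h) ∧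
      (∀ᶠ ζ in 𝓝 (u p), DifferentiableAt ℂ F ζ) ∧ ∀ᶠ x in 𝓝 p, φ x = F (u x) := by
  -- Over ℝ, `ker θ` has codimension two and its first integral gives only dv = aθ + bθ̄, with a = 1
  -- and b = 0 at `p`. A change of variable u = Φ(v) has to remove θ̄.
  obtain ⟨v, s, hv, hs, hvp, hsp, hdp, hker, hρ⟩ := exists_first_integral hθ hsurj (by
    filter_upwards [hintg] with x hx h l hh hl
    obtain ⟨k, hk⟩ := hx h hh
    have := hk l
    rwa [hl, mul_zero, sub_eq_zero] at this)
  have hα : ∀ᶠ x in 𝓝 p, ContDiffAt ℝ ∞ (fderiv ℝ v) x := by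
    filter_upwards [hv] with x hx using hx.fderiv_right (m := ∞) (by simp)
  obtain ⟨Q, hQp, hQs, hQ⟩ := exists_smooth_factor hθ hα hsurj hdp hker
  set a : V → ℂ := fun x => (Q x 1 - Complex.I * Q x Complex.I) / 2 with ha
  set b : V → ℂ := fun x => (Q x 1 + Complex.I * Q x Complex.I) / 2 with hb
  have hap : a p = 1 := by simp [ha, hQp]
  have hbp : b p = 0 := by simp [hb, hQp]
  have has : ∀ᶠ x in 𝓝 p, ContDiffAt ℝ ∞ a x := by
    filter_upwards [hQs] with x hx
    exact ((hx.clm_apply contDiffAt_const).sub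
      (contDiffAt_const.mul (hx.clm_apply contDiffAt_const))).div_const _
  have hbs : ∀ᶠ x in 𝓝 p, ContDiffAt ℝ ∞ b x := by
    filter_upwards [hQs] with x hx
    exact ((hx.clm_apply contDiffAt_const).add
      (contDiffAt_const.mul (hx.clm_apply contDiffAt_const))).div_const _
  have hane : ∀ᶠ x in 𝓝 p, a x ≠ 0 :=
    has.self_of_nhds.continuousAt.eventually_ne (by rw [hap]; exact one_ne_zero)
  have hdv : ∀ᶠ x in 𝓝 p, Function.Surjective (θ x) ∧
      ∀ l, fderiv ℝ v x l = a x * θ x l + b x * (starRingEnd ℂ) (θ x l) := by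
    filter_upwards [hQ] with x hx
    refine ⟨hx.1, fun l => ?_⟩
    rw [hx.2, realLinear_eq]
  have hconj : ∀ (g : V → ℂ) (x : V), DifferentiableAt ℝ g x →
      HasFDerivAt (fun y => (starRingEnd ℂ) (g y))
        ((Complex.conjCLE : ℂ →L[ℝ] ℂ).comp (fderiv ℝ g x)) x := fun g x hg =>
    (Complex.conjCLE : ℂ →L[ℝ] ℂ).hasFDerivAt.comp x hg.hasFDerivAt
  have hconjs : ∀ (g : V → ℂ) (x : V), ContDiffAt ℝ ∞ g x →
      ContDiffAt ℝ ∞ (fun y => (starRingEnd ℂ) (g y)) x := fun g x hg =>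
    (Complex.conjCLE : ℂ →L[ℝ] ℂ).contDiff.contDiffAt.comp x hg
  -- If dΦ(w) = c(w + ρ₀w̄), the coefficient of θ̄ in d(Φ∘v) is c(b + ρ₀ā), which this choice
  -- annihilates.
  set ρ₀ : V → ℂ := fun x => -(b x * ((starRingEnd ℂ) (a x))⁻¹) with hρ₀
  have hρ₀s : ∀ᶠ x in 𝓝 p, ContDiffAt ℝ ∞ ρ₀ x := by
    filter_upwards [has, hbs, hane] with x h1 h2 h3
    exact (h2.mul ((hconjs a x h1).inv (by simpa using h3))).neg
  -- For h in ker θ let k be the factor with dθ(h, ·) = kθ. Symmetry of the second derivative of v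
  -- gives da(h) = −ak and db(h) = −bk̄, so b/ā is constant along the leaves. Thus ρ₀ is a function
  -- of v and the Beltrami equation lives on ℂ.
  have hρ₀d : ∀ᶠ x in 𝓝 p, ∀ h, θ x h = 0 → fderiv ℝ ρ₀ x h = 0 := by
    filter_upwards [hdv.eventually_nhds, hv, has, hbs, hane, hθ, hintg] with x h1 h2 h3 h4 h5 h6
      h7 h hh
    obtain ⟨k, hk⟩ := h7 h hh
    have da := (h3.differentiableAt (by simp)).hasFDerivAt
    have db := (h4.differentiableAt (by simp)).hasFDerivAt
    have dθ : ∀ l, HasFDerivAt (fun y => θ y l) ((fderiv ℝ θ x).flip l) x := fun l => by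
      simpa using (h6.differentiableAt (by simp)).hasFDerivAt.clm_apply (hasFDerivAt_const l x)
    have hvd : HasFDerivAt (fderiv ℝ v) (fderiv ℝ (fderiv ℝ v) x) x :=
      ((h2.fderiv_right (m := 1) (by norm_cast)).differentiableAt one_ne_zero).hasFDerivAt
    have hsym := (h2.isSymmSndFDerivAt
      (by simp only [minSmoothness_of_isRCLikeNormedField]; norm_cast)).eq
    have key : ∀ l m, fderiv ℝ (fderiv ℝ v) x m l =
        fderiv ℝ a x m * θ x l + a x * fderiv ℝ θ x m l
        + (fderiv ℝ b x m * (starRingEnd ℂ) (θ x l)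
          + b x * (starRingEnd ℂ) (fderiv ℝ θ x m l)) := by
      intro l m
      have e1 : HasFDerivAt (fun y => fderiv ℝ v y l) ((fderiv ℝ (fderiv ℝ v) x).flip l) x := by
        simpa using hvd.clm_apply (hasFDerivAt_const l x)
      have e2 := (da.mul (dθ l)).add (db.mul (hconj _ x (dθ l).differentiableAt))
      have e3 := e1.congr_of_eventuallyEq (f₁ := fun y => a y * θ y l + b y * (starRingEnd ℂ) (θ y l))
        (by filter_upwards [h1] with y hy using (hy.2 l).symm)
      have e4 := DFunLike.congr_fun (e3.unique e2) m
      simp only [ContinuousLinearMap.flip_apply, add_apply, smul_apply, smul_eq_mul,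
        ContinuousLinearMap.comp_apply, (dθ l).fderiv, ContinuousLinearEquiv.coe_coe,
        Complex.conjCLE_apply] at e4
      rw [e4]
      ring
    have hAB : ∀ w : ℂ, (fderiv ℝ a x h + a x * k) * w
        + (fderiv ℝ b x h + b x * (starRingEnd ℂ) k) * (starRingEnd ℂ) w = 0 := by
      intro w
      obtain ⟨l, rfl⟩ := h1.self_of_nhds.1 w
      have e1 := hsym h l
      rw [key l h, key h l, hh, map_zero, mul_zero, mul_zero, zero_add, zero_add] at e1
      have e2 := hk l
      have e3 := congrArg (starRingEnd ℂ) e2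
      rw [map_sub, map_mul] at e3
      linear_combination e1 - a x * e2 - b x * e3
    have hA1 := hAB 1
    have hA2 := hAB Complex.I
    simp only [map_one, mul_one, Complex.conj_I] at hA1 hA2
    have hA : fderiv ℝ a x h = -(a x * k) := by
      linear_combination (1 / 2) * hA1 - (Complex.I / 2) * hA2
        + (1 / 2) * ((fderiv ℝ a x h + a x * k) - (fderiv ℝ b x h + b x * (starRingEnd ℂ) k))
          * Complex.I_sq
    have hB : fderiv ℝ b x h = -(b x * (starRingEnd ℂ) k) := by
      linear_combination hA1 - hA
    have hca : (starRingEnd ℂ) (a x) ≠ 0 := by simpa using h5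
    have hinv : HasFDerivAt (fun y => ((starRingEnd ℂ) (a y))⁻¹) _ x :=
      (hasFDerivAt_inv hca).restrictScalars ℝ |>.comp x (hconj a x da.differentiableAt)
    have hd : HasFDerivAt ρ₀ _ x := (db.mul hinv).neg
    rw [hd.fderiv]
    simp only [neg_apply, add_apply, smul_apply, smul_eq_mul, ContinuousLinearMap.comp_apply,
      ContinuousLinearEquiv.coe_coe, Complex.conjCLE_apply, hA, hB,
      ContinuousLinearMap.coe_restrictScalars', ContinuousLinearMap.toSpanSingleton_apply,
      map_neg, map_mul]
    field_simp
    ring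
  have hρ₀v : ∀ᶠ x in 𝓝 p, ρ₀ x = ρ₀ (s (v x)) := by
    refine hρ ρ₀ ?_
    filter_upwards [hρ₀s, hρ₀d] with x h1 h2
    exact ⟨h1.differentiableAt (by simp), h2⟩
  have hst : Filter.Tendsto s (𝓝 0) (𝓝 p) := hs.continuous.tendsto' 0 p hsp
  have hvt : Filter.Tendsto v (𝓝 p) (𝓝 0) := by
    have := hv.self_of_nhds.continuousAt.tendsto
    rwa [hvp] at this
  obtain ⟨Φ, c, hΦ, hΦc⟩ := exists_beltrami (ρ := ρ₀ ∘ s) (by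
    filter_upwards [hst.eventually hρ₀s] with w hw
    exact hw.comp w hs.contDiffAt) (by simp [hsp, hρ₀, hbp])
  have hΦd : ∀ x, HasFDerivAt Φ (fderiv ℝ Φ x) x := fun x =>
    (hΦ.differentiable (by simp) x).hasFDerivAt
  have hinv : (fderiv ℝ Φ 0).IsInvertible := by
    have h0 := hΦc.self_of_nhds
    have hc := h0.1
    refine ⟨(ContinuousLinearEquiv.smulLeft (Units.mk0 (c 0) hc) : ℂ ≃L[ℝ] ℂ), ?_⟩
    ext1 w
    rw [h0.2]
    simp [hsp, hρ₀, hbp, Units.smul_def]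
  obtain ⟨ψ, hψ0, hψs, -, hψ⟩ := exists_smooth_localInverse
    (Filter.Eventually.of_forall fun z => hΦ.contDiffAt) hinv
  have hus : ∀ᶠ x in 𝓝 p, ContDiffAt ℝ ∞ (Φ ∘ v) x := by
    filter_upwards [hv] with x hx using hΦ.contDiffAt.comp x hx
  have hud : ∀ᶠ x in 𝓝 p, ∃ c : ℂ, c ≠ 0 ∧ ∀ h, fderiv ℝ (Φ ∘ v) x h = c * θ x h := by
    have hm : ∀ᶠ x in 𝓝 p, a x + ρ₀ x * (starRingEnd ℂ) (b x) ≠ 0 := by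
      have : ContinuousAt (fun x => a x + ρ₀ x * (starRingEnd ℂ) (b x)) p :=
        has.self_of_nhds.continuousAt.add (hρ₀s.self_of_nhds.continuousAt.mul
          (hconjs b p hbs.self_of_nhds).continuousAt)
      exact this.eventually_ne (by simp [hap, hbp])
    filter_upwards [hvt.eventually hΦc, hdv, hv, hρ₀v, hane, hm] with x h1 h2 h3 h4 h5 h6
    refine ⟨c (v x) * (a x + ρ₀ x * (starRingEnd ℂ) (b x)), mul_ne_zero h1.1 h6, fun h => ?_⟩
    have hca : (starRingEnd ℂ) (a x) ≠ 0 := by simpa using h5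
    rw [((hΦd (v x)).comp x (h3.differentiableAt (by simp)).hasFDerivAt).fderiv,
      ContinuousLinearMap.comp_apply, h1.2, Function.comp_apply, ← h4, h2.2]
    have e : b x + ρ₀ x * (starRingEnd ℂ) (a x) = 0 := by
      simp only [hρ₀]
      field_simp
      ring
    simp only [map_add, map_mul, Complex.conj_conj]
    linear_combination (c (v x) * (starRingEnd ℂ) (θ x h)) * e
  have hφF : ∀ᶠ x in 𝓝 p, φ x = φ (s (ψ (Φ (v x)))) := by
    have h1 : ∀ᶠ x in 𝓝 p, φ x = φ (s (v x)) := by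
      refine hρ φ ?_
      filter_upwards [hφ, hφθ] with x h1 h2
      refine ⟨h1.differentiableAt (by simp), fun h hh => ?_⟩
      obtain ⟨k, hk⟩ := h2
      rw [hk, hh, mul_zero]
    filter_upwards [h1, hvt.eventually hψ] with x h1 h2
    rw [h2, h1]
  have hFs : ∀ᶠ ζ in 𝓝 ((Φ ∘ v) p), ContDiffAt ℝ ∞ (fun ζ => φ (s (ψ ζ))) ζ := by
    rw [Function.comp_apply, hvp]
    have h1 : Filter.Tendsto (fun ζ => s (ψ ζ)) (𝓝 (Φ 0)) (𝓝 p) := by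
      have h2 : Filter.Tendsto ψ (𝓝 (Φ 0)) (𝓝 0) := by
        have := hψs.self_of_nhds.continuousAt.tendsto
        rwa [hψ0] at this
      exact hst.comp h2
    filter_upwards [h1.eventually hφ, hψs] with ζ h2 h3
    exact h2.comp ζ (hs.contDiffAt.comp ζ h3)
  refine ⟨Φ ∘ v, fun ζ => φ (s (ψ ζ)), hus, hud, ?_, hφF⟩
  have hsurju : Function.Surjective (fderiv ℝ (Φ ∘ v) p) := by
    obtain ⟨c, hc, hcd⟩ := hud.self_of_nhds
    intro w
    obtain ⟨l, hl⟩ := hsurj (w / c)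
    exact ⟨l, by rw [hcd, hl]; field_simp⟩
  have hstrict : HasStrictFDerivAt (Φ ∘ v) (fderiv ℝ (Φ ∘ v) p) p :=
    hus.self_of_nhds.hasStrictFDerivAt (by simp)
  have hcompl : CompleteSpace V := FiniteDimensional.complete ℝ V
  -- The coordinate is a submersion, so points near its value at `p` are values `u x`. There dφ = kθ
  -- = (k/c')du, hence the real derivative of `F` is multiplication by k/c' and `F` is holomorphic.
  rw [← hstrict.map_nhds_eq_of_surj (LinearMap.range_eq_top.2 hsurju), Filter.eventually_map]
  have hut : Filter.Tendsto (Φ ∘ v) (𝓝 p) (𝓝 ((Φ ∘ v) p)) :=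
    hus.self_of_nhds.continuousAt
  filter_upwards [hut.eventually hFs, hus, hud, hφθ, hφF.eventually_nhds, hdv]
    with x h1 h2 h3 h4 h5 h6
  obtain ⟨c', hc', hcd⟩ := h3
  obtain ⟨k, hk⟩ := h4
  have dF := (h1.differentiableAt (by simp)).hasFDerivAt
  have du := (h2.differentiableAt (by simp)).hasFDerivAt
  have dφ : HasFDerivAt φ _ x := (dF.comp x du).congr_of_eventuallyEq h5
  have e : (k / c') • (ContinuousLinearMap.id ℂ ℂ).restrictScalars ℝ
      = fderiv ℝ (fun ζ => φ (s (ψ ζ))) ((Φ ∘ v) x) := by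
    ext1 w
    obtain ⟨l, hl⟩ := h6.1 (w / c')
    have e1 := hk l
    rw [dφ.fderiv, ContinuousLinearMap.comp_apply, hcd, hl] at e1
    rw [show c' * (w / c') = w by field_simp] at e1
    rw [e1]
    simp
    field_simp
  exact (hasFDerivAt_of_restrictScalars ℝ dF (f' := (k / c') • ContinuousLinearMap.id ℂ ℂ)
    e).differentiableAt

end Coordinates

end MetricPencil

end

open scoped ContDiff Topology Matrix

noncomputable section

namespace MetricPencil

/-! ### Partial derivatives of matrix-valued functions. -/

section MatrixCalculus

variable {N : ℕ} {𝕜 : Type*} [RCLike 𝕜]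

/-- The matrix of the partial derivatives of the entries. -/
def pdMat (m : Fin N) (A : Coord N → Matrix (Fin N) (Fin N) 𝕜) (x : Coord N) :
    Matrix (Fin N) (Fin N) 𝕜 :=
  Matrix.of fun i j => pd m (fun y => A y i j) x

/-- All entries are smooth at `x`. -/
def SmoothEntries (A : Coord N → Matrix (Fin N) (Fin N) 𝕜) (x : Coord N) : Prop :=
  ∀ i j, ContDiffAt ℝ ∞ (fun y => A y i j) x

lemma pd_congr {F : Type*} [NormedAddCommGroup F] [NormedSpace ℝ F] {m : Fin N}
    {f g : Coord N → F} {x : Coord N} (h : f =ᶠ[𝓝 x] g) : pd m f x = pd m g x := by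
  rw [pd, pd, h.fderiv_eq]

lemma pd_const {F : Type*} [NormedAddCommGroup F] [NormedSpace ℝ F] (m : Fin N)
    (c : F) (x : Coord N) : pd m (fun _ => c) x = 0 := by
  simp [pd]

lemma pd_add {F : Type*} [NormedAddCommGroup F] [NormedSpace ℝ F] {m : Fin N}
    {f g : Coord N → F} {x : Coord N} (hf : DifferentiableAt ℝ f x)
    (hg : DifferentiableAt ℝ g x) : pd m (fun y => f y + g y) x = pd m f x + pd m g x := by
  rw [pd, pd, pd, fderiv_fun_add hf hg]
  rfl

lemma pd_sum {F ι : Type*} [NormedAddCommGroup F] [NormedSpace ℝ F] {m : Fin N} (s : Finset ι)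
    {f : ι → Coord N → F} {x : Coord N} (hf : ∀ i ∈ s, DifferentiableAt ℝ (f i) x) :
    pd m (fun y => ∑ i ∈ s, f i y) x = ∑ i ∈ s, pd m (f i) x := by
  rw [pd, fderiv_fun_sum hf, sum_apply]
  rfl

lemma pd_mul {m : Fin N} {f g : Coord N → 𝕜} {x : Coord N} (hf : DifferentiableAt ℝ f x)
    (hg : DifferentiableAt ℝ g x) :
    pd m (fun y => f y * g y) x = pd m f x * g x + f x * pd m g x := by
  rw [pd, pd, pd, fderiv_fun_mul hf hg]
  simp
  ring

lemma pd_const_mul {m : Fin N} {f : Coord N → 𝕜} {x : Coord N} (c : 𝕜)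
    (hf : DifferentiableAt ℝ f x) : pd m (fun y => c * f y) x = c * pd m f x := by
  rw [pd_mul (differentiableAt_const c) hf, pd_const, zero_mul, zero_add]

lemma pd_ofReal {m : Fin N} {f : Coord N → ℝ} {x : Coord N} (hf : DifferentiableAt ℝ f x) :
    pd m (fun y => (f y : ℂ)) x = ((pd m f x : ℝ) : ℂ) := by
  have : HasFDerivAt (fun y => (f y : ℂ)) (Complex.ofRealCLM.comp (fderiv ℝ f x)) x :=
    Complex.ofRealCLM.hasFDerivAt.comp x hf.hasFDerivAt
  rw [pd, this.fderiv]
  rfl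

lemma contDiffAt_pd {F : Type*} [NormedAddCommGroup F] [NormedSpace ℝ F] {m : Fin N}
    {f : Coord N → F} {x : Coord N} (hf : ContDiffAt ℝ ∞ f x) : ContDiffAt ℝ ∞ (pd m f) x :=
  (hf.fderiv_right (m := ∞) (by simp)).clm_apply contDiffAt_const

lemma fderiv_eq_sum_pd {F : Type*} [NormedAddCommGroup F] [NormedSpace ℝ F]
    (f : Coord N → F) (x h : Coord N) : fderiv ℝ f x h = ∑ m, h m • pd m f x := by
  conv_lhs => rw [← Finset.univ_sum_single h]
  rw [map_sum]
  refine Finset.sum_congr rfl fun m _ => ?_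
  rw [pd, ← map_smul, ← Pi.single_smul', smul_eq_mul, mul_one]

lemma SmoothEntries.differentiableAt {A : Coord N → Matrix (Fin N) (Fin N) 𝕜} {x : Coord N}
    (hA : SmoothEntries A x) (i j : Fin N) : DifferentiableAt ℝ (fun y => A y i j) x :=
  (hA i j).differentiableAt (by simp)

lemma SmoothEntries.mul {A B : Coord N → Matrix (Fin N) (Fin N) 𝕜} {x : Coord N}
    (hA : SmoothEntries A x) (hB : SmoothEntries B x) : SmoothEntries (fun y => A y * B y) x := by
  intro i j
  simp only [Matrix.mul_apply]
  exact ContDiffAt.sum fun k _ => (hA i k).mul (hB k j)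

lemma SmoothEntries.transpose {A : Coord N → Matrix (Fin N) (Fin N) 𝕜} {x : Coord N}
    (hA : SmoothEntries A x) : SmoothEntries (fun y => (A y)ᵀ) x := fun i j => hA j i

lemma pdMat_transpose (m : Fin N) (A : Coord N → Matrix (Fin N) (Fin N) 𝕜) (x : Coord N) :
    pdMat m (fun y => (A y)ᵀ) x = (pdMat m A x)ᵀ := rfl

lemma pdMat_mul {m : Fin N} {A B : Coord N → Matrix (Fin N) (Fin N) 𝕜} {x : Coord N}
    (hA : SmoothEntries A x) (hB : SmoothEntries B x) :
    pdMat m (fun y => A y * B y) x = pdMat m A x * B x + A x * pdMat m B x := by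
  ext i j
  simp only [pdMat, Matrix.of_apply, Matrix.mul_apply, Matrix.add_apply]
  rw [pd_sum _ fun k _ => (hA.differentiableAt i k).fun_mul (hB.differentiableAt k j),
    ← Finset.sum_add_distrib]
  exact Finset.sum_congr rfl fun k _ => pd_mul (hA.differentiableAt i k) (hB.differentiableAt k j)

lemma pdMat_congr {m : Fin N} {A B : Coord N → Matrix (Fin N) (Fin N) 𝕜} {x : Coord N}
    (h : A =ᶠ[𝓝 x] B) : pdMat m A x = pdMat m B x := by
  ext i j
  exact pd_congr (h.mono fun y hy => by simp only [hy])

lemma SmoothEntries.det {A : Coord N → Matrix (Fin N) (Fin N) 𝕜} {x : Coord N}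
    (hA : SmoothEntries A x) : ContDiffAt ℝ ∞ (fun y => (A y).det) x := by
  simp only [Matrix.det_apply']
  refine ContDiffAt.sum fun σ _ => contDiffAt_const.mul ?_
  exact contDiffAt_prod fun i _ => hA (σ i) i

lemma SmoothEntries.inv {A : Coord N → Matrix (Fin N) (Fin N) 𝕜} {x : Coord N}
    (hA : SmoothEntries A x) (hdet : (A x).det ≠ 0) : SmoothEntries (fun y => (A y)⁻¹) x := by
  intro i j
  simp only [Matrix.inv_def, Ring.inverse_eq_inv', Matrix.smul_apply, smul_eq_mul,
    Matrix.adjugate_apply]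
  refine (hA.det.inv hdet).mul (SmoothEntries.det fun k l => ?_)
  by_cases hk : k = j
  · subst hk
    simp only [Matrix.updateRow_self]
    exact contDiffAt_const
  · simp only [Matrix.updateRow_ne hk]
    exact hA k l

end MatrixCalculus

/-! ### The Levi-Civita connection and its curvature in matrix form. -/

section LeviCivita

variable {N : ℕ} {G : Coord N → Matrix (Fin N) (Fin N) ℝ} {x : Coord N}

/-- A metric near a point: smooth, symmetric and nondegenerate there. -/
structure IsMetricNear (G : Coord N → Matrix (Fin N) (Fin N) ℝ) (x : Coord N) : Prop where
  smooth : SmoothEntries G x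
  symm : ∀ᶠ y in 𝓝 x, (G y).IsSymm
  det_ne : (G x).det ≠ 0

/-- The matrix `Γ^i_{jm}` with row index `i` and column index `j`. -/
def gammaMat (G : Coord N → Matrix (Fin N) (Fin N) ℝ) (m : Fin N) (x : Coord N) :
    Matrix (Fin N) (Fin N) ℝ :=
  Matrix.of fun i j => christoffel G i j m x

lemma IsMetricNear.isUnit (h : IsMetricNear G x) : IsUnit (G x).det := isUnit_iff_ne_zero.2 h.det_ne

lemma IsMetricNear.eventually_det (h : IsMetricNear G x) : ∀ᶠ y in 𝓝 x, (G y).det ≠ 0 :=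
  h.smooth.det.continuousAt.eventually_ne h.det_ne

lemma IsMetricNear.pd_inv_symm (h : IsMetricNear G x) (s i j : Fin N) :
    pd s (fun y => (G y)⁻¹ i j) x = pd s (fun y => (G y)⁻¹ j i) x := by
  refine pd_congr ?_
  filter_upwards [h.symm] with y hy
  have : ((G y)⁻¹)ᵀ = (G y)⁻¹ := by rw [Matrix.transpose_nonsing_inv, hy]
  exact congrFun (congrFun this j) i

lemma IsMetricNear.christoffel_symm (h : IsMetricNear G x) (i j k : Fin N) :
    christoffel G i j k x = christoffel G i k j x := by
  unfold christoffel
  congr 1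
  refine Finset.sum_congr rfl fun s _ => ?_
  rw [h.pd_inv_symm s j k, h.pd_inv_symm j s k, h.pd_inv_symm k j s]
  ring

/-- The relation between the derivatives of a metric and of its inverse. -/
lemma IsMetricNear.pdMat_inv (h : IsMetricNear G x) (m : Fin N) :
    pdMat m G x = -(G x * pdMat m (fun y => (G y)⁻¹) x * G x) := by
  have h1 := pdMat_mul (m := m) h.smooth (h.smooth.inv h.det_ne)
  have h2 : pdMat m (fun y => G y * (G y)⁻¹) x = 0 := by
    rw [pdMat_congr (B := fun _ => 1) (by
      filter_upwards [h.eventually_det] with y hy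
      exact Matrix.mul_nonsing_inv _ (isUnit_iff_ne_zero.2 hy))]
    ext i j
    exact pd_const _ _ _
  rw [h2] at h1
  have h3 := congrArg (· * G x) h1
  simp only [zero_mul, add_mul, Matrix.mul_assoc, Matrix.nonsing_inv_mul _ h.isUnit,
    Matrix.mul_one] at h3
  rw [Matrix.mul_assoc, eq_neg_iff_add_eq_zero]
  exact h3.symm

/-- Lowering the upper index cancels the factor `G` and leaves the Christoffel symbols of the first
kind. -/
lemma IsMetricNear.inv_mul_gamma (h : IsMetricNear G x) (a j k : Fin N) :
    ((G x)⁻¹ * gammaMat G k x) a j = (1 / 2) * (pd j (fun y => (G y)⁻¹ a k) x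
      + pd k (fun y => (G y)⁻¹ j a) x - pd a (fun y => (G y)⁻¹ j k) x) := by
  set v : Fin N → ℝ := fun s => pd j (fun y => (G y)⁻¹ s k) x
      + pd k (fun y => (G y)⁻¹ j s) x - pd s (fun y => (G y)⁻¹ j k) x with hv
  have h1 : ∀ i, gammaMat G k x i j = (1 / 2) * (G x *ᵥ v) i := fun i => rfl
  rw [Matrix.mul_apply]
  simp only [h1]
  have h2 : (G x)⁻¹ *ᵥ (G x *ᵥ v) = v := by
    rw [Matrix.mulVec_mulVec, Matrix.nonsing_inv_mul _ h.isUnit, Matrix.one_mulVec]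
  have h3 := congrFun h2 a
  simp only [Matrix.mulVec, dotProduct] at h3
  rw [show (pd j (fun y => (G y)⁻¹ a k) x + pd k (fun y => (G y)⁻¹ j a) x
    - pd a (fun y => (G y)⁻¹ j k) x) = v a from rfl, ← h3, Finset.mul_sum]
  refine Finset.sum_congr rfl fun s _ => ?_
  simp only [Matrix.mulVec, dotProduct]
  ring

/-- The Levi-Civita connection is metric. -/
lemma IsMetricNear.metric_compat (h : IsMetricNear G x) (m : Fin N) :
    pdMat m G x = -(gammaMat G m x * G x) - G x * (gammaMat G m x)ᵀ := by
  have hs : (G x)ᵀ = G x := h.symm.self_of_nhds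
  have key : pdMat m (fun y => (G y)⁻¹) x =
      (G x)⁻¹ * gammaMat G m x + ((G x)⁻¹ * gammaMat G m x)ᵀ := by
    ext a j
    rw [Matrix.add_apply, Matrix.transpose_apply, h.inv_mul_gamma, h.inv_mul_gamma,
      h.pd_inv_symm m j a, h.pd_inv_symm j a m, h.pd_inv_symm a j m]
    simp only [pdMat, Matrix.of_apply]
    ring
  rw [h.pdMat_inv, key, Matrix.transpose_mul, Matrix.transpose_nonsing_inv, hs, Matrix.mul_add,
    Matrix.add_mul, ← Matrix.mul_assoc, Matrix.mul_nonsing_inv _ h.isUnit, Matrix.one_mul,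
    Matrix.mul_assoc (G x), Matrix.mul_assoc _ (G x)⁻¹, Matrix.nonsing_inv_mul _ h.isUnit,
    Matrix.mul_one]
  abel

/-- The Levi-Civita connection is the only symmetric metric connection. -/
lemma IsMetricNear.gamma_unique (h : IsMetricNear G x) {C : Fin N → Matrix (Fin N) (Fin N) ℝ}
    (hC : ∀ i j k, C k i j = C j i k)
    (hm : ∀ m, pdMat m G x = -(C m * G x) - G x * (C m)ᵀ) (m : Fin N) :
    gammaMat G m x = C m := by
  have hs : (G x)ᵀ = G x := h.symm.self_of_nhds
  have key : ∀ m, pdMat m (fun y => (G y)⁻¹) x = (G x)⁻¹ * C m + ((G x)⁻¹ * C m)ᵀ := by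
    intro m
    have h1 := hm m
    rw [h.pdMat_inv] at h1
    have h2 : pdMat m (fun y => (G y)⁻¹) x =
        (G x)⁻¹ * (G x * pdMat m (fun y => (G y)⁻¹) x * G x) * (G x)⁻¹ := by
      simp only [Matrix.mul_assoc, Matrix.mul_nonsing_inv _ h.isUnit, Matrix.mul_one]
      rw [← Matrix.mul_assoc, Matrix.nonsing_inv_mul _ h.isUnit, Matrix.one_mul]
    rw [h2, neg_eq_iff_eq_neg.1 h1, Matrix.transpose_mul, Matrix.transpose_nonsing_inv, hs]
    simp only [neg_sub, sub_neg_eq_add, Matrix.mul_add, Matrix.add_mul, Matrix.mul_assoc,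
      Matrix.mul_nonsing_inv _ h.isUnit, Matrix.mul_one]
    rw [← Matrix.mul_assoc, Matrix.nonsing_inv_mul _ h.isUnit, Matrix.one_mul]
    abel
  have key' : ∀ m a j, pd m (fun y => (G y)⁻¹ a j) x =
      ((G x)⁻¹ * C m) a j + ((G x)⁻¹ * C m) j a := fun m a j =>
    congrFun (congrFun (key m) a) j
  have hsym : ∀ a j k, ((G x)⁻¹ * C k) a j = ((G x)⁻¹ * C j) a k := by
    intro a j k
    rw [Matrix.mul_apply, Matrix.mul_apply]
    exact Finset.sum_congr rfl fun s _ => by rw [hC]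
  -- Koszul's formula: in the alternating sum of three derivatives of the covariant metric, symmetry
  -- cancels everything except twice the lowered coefficient.
  have h3 : (G x)⁻¹ * gammaMat G m x = (G x)⁻¹ * C m := by
    ext a j
    rw [h.inv_mul_gamma, key', key', key', hsym j m a, hsym m j a, hsym a m j]
    ring
  have h4 := congrArg (G x * ·) h3
  simpa only [← Matrix.mul_assoc, Matrix.mul_nonsing_inv _ h.isUnit, Matrix.one_mul] using h4

lemma christoffelUp_eq (hs : (G x).IsSymm) (i j k : Fin N) :
    christoffelUp G i j k x = (gammaMat G k x * G x) j i := by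
  rw [christoffelUp, Matrix.mul_apply]
  refine Finset.sum_congr rfl fun s _ => ?_
  rw [← hs.apply i s, mul_comm]
  rfl

lemma IsMetricNear.contDiffAt_christoffel (h : IsMetricNear G x) (i j k : Fin N) :
    ContDiffAt ℝ ∞ (christoffel G i j k) x := by
  have hi := h.smooth.inv h.det_ne
  exact contDiffAt_const.mul (ContDiffAt.sum fun s _ => (h.smooth i s).mul
    (((contDiffAt_pd (hi s k)).add (contDiffAt_pd (hi j s))).sub (contDiffAt_pd (hi j k))))

/-- The curvature in terms of the connection coefficients with a raised index. -/
lemma IsMetricNear.riemannUp_eq (h : IsMetricNear G x) (i j k l : Fin N) :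
    riemannUp G i j k l x = pd k (christoffelUp G i j l) x - pd l (christoffelUp G i j k) x
      + (gammaMat G l x * G x * (gammaMat G k x)ᵀ - gammaMat G k x * G x * (gammaMat G l x)ᵀ) j i
      := by
  have hs : (G x).IsSymm := h.symm.self_of_nhds
  have hup : ∀ k l, pd k (christoffelUp G i j l) x =
      ∑ s, (pd k (fun y => G y i s) x * christoffel G j s l x
        + G x i s * pd k (christoffel G j s l) x) := by
    intro k l
    have hd : ∀ s, DifferentiableAt ℝ (christoffel G j s l) x := fun s =>
      (h.contDiffAt_christoffel j s l).differentiableAt (by simp)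
    have : christoffelUp G i j l = fun y => ∑ s, G y i s * christoffel G j s l y := rfl
    rw [this, pd_sum _ fun s _ => (h.smooth.differentiableAt i s).fun_mul (hd s)]
    exact Finset.sum_congr rfl fun s _ => pd_mul (h.smooth.differentiableAt i s) (hd s)
  have hdG : ∀ k s, pd k (fun y => G y i s) x =
      -(gammaMat G k x * G x) i s - (G x * (gammaMat G k x)ᵀ) i s := fun k s =>
    congrFun (congrFun (h.metric_compat k) i) s
  -- Moving `G` inside the derivative costs ∂G, which `metric_compat` replaces by Γ terms. After
  -- antisymmetrization the products ΓΓG cancel those of `e2`, and only ΓGΓᵀ remains.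
  have e1 : ∀ k l, ∑ s, G x i s * pd k (christoffel G j s l) x = pd k (christoffelUp G i j l) x
      + (gammaMat G l x * G x * (gammaMat G k x)ᵀ) j i
      + (gammaMat G l x * (gammaMat G k x * G x)) j i := by
    intro k l
    rw [hup, Finset.sum_add_distrib]
    have : ∑ s, pd k (fun y => G y i s) x * christoffel G j s l x =
        -(gammaMat G l x * (G x * (gammaMat G k x)ᵀ)) j i
          - (gammaMat G l x * (gammaMat G k x * G x)) j i := by
      have hA : (gammaMat G k x * G x)ᵀ = G x * (gammaMat G k x)ᵀ := by
        rw [Matrix.transpose_mul, hs]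
      rw [Matrix.mul_apply, Matrix.mul_apply, ← Finset.sum_neg_distrib,
        ← Finset.sum_sub_distrib]
      refine Finset.sum_congr rfl fun s _ => ?_
      have a1 : (G x * (gammaMat G k x)ᵀ) s i = (gammaMat G k x * G x) i s := by
        rw [← hA]; rfl
      have a2 : (gammaMat G k x * G x) s i = (G x * (gammaMat G k x)ᵀ) i s := by
        rw [← hA]; rfl
      rw [hdG, a1, a2]
      simp only [gammaMat, Matrix.of_apply]
      ring
    rw [this, Matrix.mul_assoc]
    ring
  have e2 : ∀ k l, ∑ s, G x i s * ∑ p, christoffel G j p k x * christoffel G p s l x =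
      (gammaMat G k x * (gammaMat G l x * G x)) j i := by
    intro k l
    rw [← Matrix.mul_assoc, Matrix.mul_apply]
    refine Finset.sum_congr rfl fun s _ => ?_
    rw [Matrix.mul_apply, ← hs.apply i s, mul_comm]
    rfl
  have e3 : riemannUp G i j k l x = ∑ s, G x i s * pd k (christoffel G j s l) x
      - ∑ s, G x i s * pd l (christoffel G j s k) x
      + (∑ s, G x i s * ∑ p, christoffel G j p k x * christoffel G p s l x
        - ∑ s, G x i s * ∑ p, christoffel G j p l x * christoffel G p s k x) := by
    rw [riemannUp, ← Finset.sum_sub_distrib, ← Finset.sum_sub_distrib, ← Finset.sum_add_distrib]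
    refine Finset.sum_congr rfl fun s _ => ?_
    rw [riemann, Finset.sum_sub_distrib]
    ring
  rw [e3, e1, e1, e2, e2, Matrix.sub_apply]
  ring

end LeviCivita

end MetricPencil

end

open scoped ContDiff Topology Matrix

noncomputable section

namespace MetricPencil

section Complexify

variable {N : ℕ}

lemma complexify_mul (A B : Matrix (Fin N) (Fin N) ℝ) :
    complexify (A * B) = complexify A * complexify B :=
  Matrix.map_mul (f := Complex.ofRealHom)

lemma complexify_add (A B : Matrix (Fin N) (Fin N) ℝ) :
    complexify (A + B) = complexify A + complexify B := by
  ext i j; simp [complexify]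

lemma complexify_sub (A B : Matrix (Fin N) (Fin N) ℝ) :
    complexify (A - B) = complexify A - complexify B := by
  ext i j; simp [complexify]

lemma complexify_neg (A : Matrix (Fin N) (Fin N) ℝ) : complexify (-A) = -complexify A := by
  ext i j; simp [complexify]

lemma complexify_smul (c : ℝ) (A : Matrix (Fin N) (Fin N) ℝ) :
    complexify (c • A) = (c : ℂ) • complexify A := by
  ext i j; simp [complexify]

lemma complexify_one : complexify (1 : Matrix (Fin N) (Fin N) ℝ) = 1 :=
  Matrix.map_one _ Complex.ofReal_zero Complex.ofReal_one

lemma complexify_transpose (A : Matrix (Fin N) (Fin N) ℝ) :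
    complexify Aᵀ = (complexify A)ᵀ := rfl

lemma det_complexify (A : Matrix (Fin N) (Fin N) ℝ) : (complexify A).det = (A.det : ℂ) :=
  (Complex.ofRealHom.map_det A).symm

lemma complexify_injective : Function.Injective (complexify (N := N)) :=
  Matrix.map_injective Complex.ofReal_injective

lemma pdMat_complexify {G : Coord N → Matrix (Fin N) (Fin N) ℝ} {x : Coord N}
    (h : SmoothEntries G x) (m : Fin N) :
    pdMat m (fun y => complexify (G y)) x = complexify (pdMat m G x) := by
  ext i j
  exact pd_ofReal (h.differentiableAt i j)

lemma SmoothEntries.complexify {G : Coord N → Matrix (Fin N) (Fin N) ℝ} {x : Coord N}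
    (h : SmoothEntries G x) : SmoothEntries (fun y => complexify (G y)) x := fun i j =>
  Complex.ofRealCLM.contDiff.contDiffAt.comp x (h i j)

end Complexify

/-! ### Linear combinations of two metrics with diagonal connection difference. -/

section Pencil

variable {N : ℕ} {G₁ G₂ : Coord N → Matrix (Fin N) (Fin N) ℝ} {x : Coord N}

/-- The difference `T^i_{jm}` of the connections of two metrics is diagonal in its lower indices
with respect to a frame that diagonalizes both metrics. -/
def HasDiagonalDifference (G₁ G₂ : Coord N → Matrix (Fin N) (Fin N) ℝ) (x : Coord N) : Prop :=
  ∃ (Θ τ : Matrix (Fin N) (Fin N) ℂ) (h₁ h₂ : Fin N → ℂ), Θ.det ≠ 0 ∧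
    Θ * complexify (G₁ x) * Θᵀ = Matrix.diagonal h₁ ∧
    Θ * complexify (G₂ x) * Θᵀ = Matrix.diagonal h₂ ∧
    ∀ m, complexify (gammaMat G₁ m x - gammaMat G₂ m x) =
      τ * Matrix.diagonal (fun c => Θ c m) * Θ

/-- Two metrics diagonal in the same frame: `g₁ g⁻¹` is diagonal as well. -/
lemma mul_mul_inv_eq_diagonal {Θ C₁ C : Matrix (Fin N) (Fin N) ℂ} {h₁ h : Fin N → ℂ}
    (hΘ : Θ.det ≠ 0) (hC : C.det ≠ 0) (e₁ : Θ * C₁ * Θᵀ = Matrix.diagonal h₁)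
    (e : Θ * C * Θᵀ = Matrix.diagonal h) :
    (∀ i, h i ≠ 0) ∧ Θ * (C₁ * C⁻¹) = Matrix.diagonal (fun i => h₁ i / h i) * Θ := by
  have hh : ∀ i, h i ≠ 0 := by
    have : (Matrix.diagonal h).det ≠ 0 := by
      rw [← e, Matrix.det_mul, Matrix.det_mul, Matrix.det_transpose]
      exact mul_ne_zero (mul_ne_zero hΘ hC) hΘ
    rw [Matrix.det_diagonal, Finset.prod_ne_zero_iff] at this
    exact fun i => this i (Finset.mem_univ i)
  refine ⟨hh, ?_⟩
  have hT : IsUnit (Θᵀ).det := by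
    rw [Matrix.det_transpose]; exact isUnit_iff_ne_zero.2 hΘ
  have h1 : Θ * C₁ = Matrix.diagonal (fun i => h₁ i / h i) * (Θ * C) := by
    have : Θ * C₁ * Θᵀ = Matrix.diagonal (fun i => h₁ i / h i) * (Θ * C) * Θᵀ := by
      rw [e₁, Matrix.mul_assoc, e, Matrix.diagonal_mul_diagonal]
      congr 1
      funext i
      rw [div_mul_cancel₀ _ (hh i)]
    have h2 := congrArg (· * (Θᵀ)⁻¹) this
    simpa only [Matrix.mul_nonsing_inv_cancel_right _ _ hT] using h2
  rw [← Matrix.mul_assoc, h1, Matrix.mul_assoc, Matrix.mul_assoc,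
    Matrix.mul_nonsing_inv _ (isUnit_iff_ne_zero.2 hC), Matrix.mul_one]

lemma pencil_apply (l₁ l₂ : ℝ) (y : Coord N) : pencil l₁ l₂ G₁ G₂ y = l₁ • G₁ y + l₂ • G₂ y := rfl

lemma IsMetricNear.pencil (h₁ : IsMetricNear G₁ x) (h₂ : IsMetricNear G₂ x) {l₁ l₂ : ℝ}
    (hd : (pencil l₁ l₂ G₁ G₂ x).det ≠ 0) : IsMetricNear (pencil l₁ l₂ G₁ G₂) x where
  smooth i j := (contDiffAt_const.mul (h₁.smooth i j)).add (contDiffAt_const.mul (h₂.smooth i j))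
  symm := by
    filter_upwards [h₁.symm, h₂.symm] with y a b
    exact (a.smul l₁).add (b.smul l₂)
  det_ne := hd

lemma pdMat_pencil (h₁ : IsMetricNear G₁ x) (h₂ : IsMetricNear G₂ x) (l₁ l₂ : ℝ) (m : Fin N) :
    pdMat m (pencil l₁ l₂ G₁ G₂) x = l₁ • pdMat m G₁ x + l₂ • pdMat m G₂ x := by
  ext i j
  have a := h₁.smooth.differentiableAt i j
  have b := h₂.smooth.differentiableAt i j
  change pd m (fun y => l₁ * G₁ y i j + l₂ * G₂ y i j) x = l₁ * _ + l₂ * _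
  rw [pd_add (a.const_mul l₁) (b.const_mul l₂), pd_const_mul _ a, pd_const_mul _ b]
  rfl

/-- The connection of a linear combination, provided that the candidate is symmetric. -/
lemma gammaMat_pencil (h₁ : IsMetricNear G₁ x) (h₂ : IsMetricNear G₂ x) {l₁ l₂ : ℝ}
    (hd : (pencil l₁ l₂ G₁ G₂ x).det ≠ 0)
    (hsym : ∀ i j m, ((gammaMat G₁ m x - gammaMat G₂ m x) *
        (G₁ x * (pencil l₁ l₂ G₁ G₂ x)⁻¹)) i j =
      ((gammaMat G₁ j x - gammaMat G₂ j x) * (G₁ x * (pencil l₁ l₂ G₁ G₂ x)⁻¹)) i m)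
    (m : Fin N) :
    gammaMat (pencil l₁ l₂ G₁ G₂) m x = gammaMat G₂ m x +
      l₁ • ((gammaMat G₁ m x - gammaMat G₂ m x) * (G₁ x * (pencil l₁ l₂ G₁ G₂ x)⁻¹)) := by
  have h := h₁.pencil h₂ hd
  -- The candidate C_m satisfies C_m P = l₁Γ₁G₁ + l₂Γ₂G₂, so it preserves P by the metricity of the
  -- two connections. Symmetry is the only real condition.
  refine h.gamma_unique (C := fun m => gammaMat G₂ m x +
      l₁ • ((gammaMat G₁ m x - gammaMat G₂ m x) * (G₁ x * (MetricPencil.pencil l₁ l₂ G₁ G₂ x)⁻¹)))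
    (fun i j k => ?_) (fun m => ?_) m
  · rw [Matrix.add_apply, Matrix.add_apply, Matrix.smul_apply, Matrix.smul_apply, hsym]
    congr 1
    exact h₂.christoffel_symm i j k
  · have hs : (MetricPencil.pencil l₁ l₂ G₁ G₂ x)ᵀ = MetricPencil.pencil l₁ l₂ G₁ G₂ x :=
      h.symm.self_of_nhds
    have e : (gammaMat G₂ m x + l₁ • ((gammaMat G₁ m x - gammaMat G₂ m x) *
        (G₁ x * (MetricPencil.pencil l₁ l₂ G₁ G₂ x)⁻¹))) * MetricPencil.pencil l₁ l₂ G₁ G₂ x =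
        l₁ • (gammaMat G₁ m x * G₁ x) + l₂ • (gammaMat G₂ m x * G₂ x) := by
      rw [Matrix.add_mul, Matrix.smul_mul, Matrix.mul_assoc, Matrix.mul_assoc,
        Matrix.nonsing_inv_mul _ h.isUnit, Matrix.mul_one, pencil_apply, Matrix.mul_add,
        Matrix.mul_smul, Matrix.mul_smul, Matrix.sub_mul, smul_sub]
      abel
    have e' := congrArg Matrix.transpose e
    rw [Matrix.transpose_mul, hs] at e'
    rw [e, e', pdMat_pencil h₁ h₂, h₁.metric_compat, h₂.metric_compat, Matrix.transpose_add,
      Matrix.transpose_smul, Matrix.transpose_smul, Matrix.transpose_mul, Matrix.transpose_mul,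
      show (G₁ x)ᵀ = G₁ x from h₁.symm.self_of_nhds, show (G₂ x)ᵀ = G₂ x from h₂.symm.self_of_nhds]
    simp only [smul_sub, smul_neg]
    abel

/-- `G₁`, `G₁P⁻¹` and `G₁P⁻¹G₁` are all diagonal in the frame. Inserted into T_m = τ·diag(Θ_{cm})·Θ
they only rescale the summands, which are symmetric in the lower indices; likewise T_l B T_kᵀ =
τ·diag(Θ_{cl} d_c Θ_{ck})·τᵀ is symmetric in k, l. -/
lemma HasDiagonalDifference.symm_mul (h : HasDiagonalDifference G₁ G₂ x) {l₁ l₂ : ℝ}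
    (hd : (pencil l₁ l₂ G₁ G₂ x).det ≠ 0) :
    (∀ i j m, ((gammaMat G₁ m x - gammaMat G₂ m x) *
        (G₁ x * (pencil l₁ l₂ G₁ G₂ x)⁻¹)) i j =
      ((gammaMat G₁ j x - gammaMat G₂ j x) * (G₁ x * (pencil l₁ l₂ G₁ G₂ x)⁻¹)) i m) ∧
    (∀ k l, (gammaMat G₁ l x - gammaMat G₂ l x) * G₁ x * (gammaMat G₁ k x - gammaMat G₂ k x)ᵀ =
      (gammaMat G₁ k x - gammaMat G₂ k x) * G₁ x * (gammaMat G₁ l x - gammaMat G₂ l x)ᵀ) ∧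
    (∀ k l, (gammaMat G₁ l x - gammaMat G₂ l x) * (G₁ x * (pencil l₁ l₂ G₁ G₂ x)⁻¹ * G₁ x) *
        (gammaMat G₁ k x - gammaMat G₂ k x)ᵀ =
      (gammaMat G₁ k x - gammaMat G₂ k x) * (G₁ x * (pencil l₁ l₂ G₁ G₂ x)⁻¹ * G₁ x) *
        (gammaMat G₁ l x - gammaMat G₂ l x)ᵀ) := by
  obtain ⟨Θ, τ, a₁, a₂, hΘ, e₁, e₂, hT⟩ := h
  set P := pencil l₁ l₂ G₁ G₂ x with hP
  have hC : (complexify P).det ≠ 0 := by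
    rw [det_complexify]; exact_mod_cast hd
  have e : Θ * complexify P * Θᵀ = Matrix.diagonal (fun i => l₁ * a₁ i + l₂ * a₂ i) := by
    rw [hP, pencil_apply, complexify_add, complexify_smul, complexify_smul, Matrix.mul_add,
      Matrix.add_mul, Matrix.mul_smul, Matrix.mul_smul, Matrix.smul_mul, Matrix.smul_mul, e₁, e₂]
    ext i j
    by_cases hij : i = j
    · subst hij; simp
    · simp [hij]
  obtain ⟨hne, hA⟩ := mul_mul_inv_eq_diagonal hΘ hC e₁ e
  have hinv : complexify P⁻¹ = (complexify P)⁻¹ := by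
    refine (Matrix.inv_eq_right_inv ?_).symm
    rw [← complexify_mul, Matrix.mul_nonsing_inv _ (isUnit_iff_ne_zero.2 hd), complexify_one]
  set q : Fin N → ℂ := fun i => a₁ i / (l₁ * a₁ i + l₂ * a₂ i) with hq
  have sandwich : ∀ (B : Matrix (Fin N) (Fin N) ℝ) (d : Fin N → ℂ),
      Θ * complexify B * Θᵀ = Matrix.diagonal d → ∀ k l,
      (gammaMat G₁ l x - gammaMat G₂ l x) * B * (gammaMat G₁ k x - gammaMat G₂ k x)ᵀ =
      (gammaMat G₁ k x - gammaMat G₂ k x) * B * (gammaMat G₁ l x - gammaMat G₂ l x)ᵀ := by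
    intro B d hB
    have key : ∀ k l, complexify ((gammaMat G₁ l x - gammaMat G₂ l x) * B *
        (gammaMat G₁ k x - gammaMat G₂ k x)ᵀ) =
        τ * Matrix.diagonal (fun c => Θ c l * d c * Θ c k) * τᵀ := by
      intro k l
      rw [complexify_mul, complexify_mul, complexify_transpose, hT, hT, Matrix.transpose_mul,
        Matrix.transpose_mul, Matrix.diagonal_transpose]
      have : τ * Matrix.diagonal (fun c => Θ c l) * Θ * complexify B *
          (Θᵀ * (Matrix.diagonal (fun c => Θ c k) * τᵀ)) =
          τ * (Matrix.diagonal (fun c => Θ c l) * (Θ * complexify B * Θᵀ) *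
          Matrix.diagonal (fun c => Θ c k)) * τᵀ := by
        simp only [Matrix.mul_assoc]
      rw [this, hB, Matrix.diagonal_mul_diagonal, Matrix.diagonal_mul_diagonal]
    intro k l
    apply complexify_injective
    rw [key, key]
    congr 3
    funext c
    ring
  refine ⟨fun i j m => ?_, sandwich _ _ e₁, sandwich _ (fun i => q i * a₁ i) ?_⟩
  · have key : ∀ j m, ((complexify ((gammaMat G₁ m x - gammaMat G₂ m x) * (G₁ x * P⁻¹))) i j) =
        ∑ c, τ i c * (Θ c m * q c) * Θ c j := by
      intro j m
      rw [complexify_mul, complexify_mul, hinv, hT, Matrix.mul_assoc, hA, ← Matrix.mul_assoc,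
        Matrix.mul_assoc τ, Matrix.diagonal_mul_diagonal, Matrix.mul_apply]
      simp only [Matrix.mul_diagonal]
    have : ((((gammaMat G₁ m x - gammaMat G₂ m x) * (G₁ x * P⁻¹)) i j : ℝ) : ℂ) =
        ((((gammaMat G₁ j x - gammaMat G₂ j x) * (G₁ x * P⁻¹)) i m : ℝ) : ℂ) := by
      change (complexify _) i j = (complexify _) i m
      rw [key, key]
      exact Finset.sum_congr rfl fun c _ => by ring
    exact_mod_cast this
  · rw [complexify_mul, complexify_mul, hinv, ← Matrix.mul_assoc, hA, Matrix.mul_assoc,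
      Matrix.mul_assoc, ← Matrix.mul_assoc Θ, e₁, Matrix.diagonal_mul_diagonal]

/-- If the difference of the connections is diagonal, then the connections and the curvatures
combine linearly. -/
lemma linear_of_hasDiagonalDifference (h₁ : ∀ᶠ y in 𝓝 x, IsMetricNear G₁ y)
    (h₂ : ∀ᶠ y in 𝓝 x, IsMetricNear G₂ y)
    (h : ∀ᶠ y in 𝓝 x, HasDiagonalDifference G₁ G₂ y) {l₁ l₂ : ℝ}
    (hd : (pencil l₁ l₂ G₁ G₂ x).det ≠ 0) :
    (∀ i j k, christoffelUp (pencil l₁ l₂ G₁ G₂) i j k x =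
      l₁ * christoffelUp G₁ i j k x + l₂ * christoffelUp G₂ i j k x) ∧
    (∀ i j k l, riemannUp (pencil l₁ l₂ G₁ G₂) i j k l x =
      l₁ * riemannUp G₁ i j k l x + l₂ * riemannUp G₂ i j k l x) := by
  have hP := h₁.self_of_nhds.pencil h₂.self_of_nhds hd
  have mulP : ∀ y, IsMetricNear G₁ y → IsMetricNear G₂ y → HasDiagonalDifference G₁ G₂ y →
      (pencil l₁ l₂ G₁ G₂ y).det ≠ 0 → ∀ k, gammaMat (pencil l₁ l₂ G₁ G₂) k y *
        pencil l₁ l₂ G₁ G₂ y =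
        l₁ • (gammaMat G₁ k y * G₁ y) + l₂ • (gammaMat G₂ k y * G₂ y) := by
    intro y a₁ a₂ a b k
    rw [gammaMat_pencil a₁ a₂ b (a.symm_mul b).1, Matrix.add_mul, Matrix.smul_mul,
      Matrix.mul_assoc, Matrix.mul_assoc, Matrix.nonsing_inv_mul _ (isUnit_iff_ne_zero.2 b),
      Matrix.mul_one, pencil_apply, Matrix.mul_add, Matrix.mul_smul, Matrix.mul_smul,
      Matrix.sub_mul, smul_sub]
    abel
  have hup : ∀ᶠ y in 𝓝 x, ∀ i j k, christoffelUp (pencil l₁ l₂ G₁ G₂) i j k y =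
      l₁ * christoffelUp G₁ i j k y + l₂ * christoffelUp G₂ i j k y := by
    filter_upwards [h₁, h₂, h, hP.eventually_det] with y a₁ a₂ a b i j k
    rw [christoffelUp_eq (a₁.pencil a₂ b).symm.self_of_nhds,
      christoffelUp_eq a₁.symm.self_of_nhds, christoffelUp_eq a₂.symm.self_of_nhds,
      mulP y a₁ a₂ a b]
    rfl
  refine ⟨hup.self_of_nhds, fun i j k l => ?_⟩
  replace h₁ := h₁.self_of_nhds
  replace h₂ := h₂.self_of_nhds
  replace h := h.self_of_nhds
  have dUp : ∀ {G : Coord N → Matrix (Fin N) (Fin N) ℝ}, IsMetricNear G x → ∀ i j k,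
      DifferentiableAt ℝ (christoffelUp G i j k) x := fun hG i j k =>
    (ContDiffAt.sum fun s _ => (hG.smooth i s).mul
      (hG.contDiffAt_christoffel j s k)).differentiableAt (n := ∞) (by simp)
  have hpd : ∀ k l, pd k (christoffelUp (pencil l₁ l₂ G₁ G₂) i j l) x =
      l₁ * pd k (christoffelUp G₁ i j l) x + l₂ * pd k (christoffelUp G₂ i j l) x := by
    intro k l
    rw [pd_congr (g := fun y => l₁ * christoffelUp G₁ i j l y + l₂ * christoffelUp G₂ i j l y)
      (hup.mono fun y hy => hy i j l), pd_add ((dUp h₁ i j l).const_mul l₁)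
      ((dUp h₂ i j l).const_mul l₂), pd_const_mul _ (dUp h₁ i j l), pd_const_mul _ (dUp h₂ i j l)]
  obtain ⟨s₁, s₂, s₃⟩ := h.symm_mul hd
  have hs₁ : (G₁ x)ᵀ = G₁ x := h₁.symm.self_of_nhds
  have hsP : (pencil l₁ l₂ G₁ G₂ x)ᵀ = pencil l₁ l₂ G₁ G₂ x := hP.symm.self_of_nhds
  -- The deviation of the quadratic term from linearity has the form T_l B T_kᵀ; by `s₂` and `s₃` it
  -- is symmetric in k, l and disappears from the curvature.
  have quad : ∀ k l, gammaMat (pencil l₁ l₂ G₁ G₂) l x * pencil l₁ l₂ G₁ G₂ x *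
      (gammaMat (pencil l₁ l₂ G₁ G₂) k x)ᵀ =
      l₁ • (gammaMat G₁ l x * G₁ x * (gammaMat G₁ k x)ᵀ) +
      l₂ • (gammaMat G₂ l x * G₂ x * (gammaMat G₂ k x)ᵀ) +
      ((l₁ * l₁) • ((gammaMat G₁ l x - gammaMat G₂ l x) *
        (G₁ x * (pencil l₁ l₂ G₁ G₂ x)⁻¹ * G₁ x) * (gammaMat G₁ k x - gammaMat G₂ k x)ᵀ) -
      l₁ • ((gammaMat G₁ l x - gammaMat G₂ l x) * G₁ x *
        (gammaMat G₁ k x - gammaMat G₂ k x)ᵀ)) := by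
    intro k l
    have e1 := mulP x h₁ h₂ h hd l
    have e2 : pencil l₁ l₂ G₁ G₂ x * (pencil l₁ l₂ G₁ G₂ x)⁻¹ = 1 :=
      Matrix.mul_nonsing_inv _ (isUnit_iff_ne_zero.2 hd)
    have e4 : (gammaMat (pencil l₁ l₂ G₁ G₂) k x)ᵀ = (gammaMat G₂ k x)ᵀ +
        l₁ • ((pencil l₁ l₂ G₁ G₂ x)⁻¹ * (G₁ x * (gammaMat G₁ k x - gammaMat G₂ k x)ᵀ)) := by
      rw [gammaMat_pencil h₁ h₂ hd s₁, Matrix.transpose_add, Matrix.transpose_smul,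
        Matrix.transpose_mul, Matrix.transpose_mul, Matrix.transpose_nonsing_inv, hsP, hs₁,
        Matrix.mul_assoc]
    have e5 : gammaMat (pencil l₁ l₂ G₁ G₂) l x * pencil l₁ l₂ G₁ G₂ x *
        (pencil l₁ l₂ G₁ G₂ x)⁻¹ = gammaMat G₂ l x + l₁ • ((gammaMat G₁ l x - gammaMat G₂ l x) *
          (G₁ x * (pencil l₁ l₂ G₁ G₂ x)⁻¹)) := by
      rw [Matrix.mul_assoc, e2, Matrix.mul_one, gammaMat_pencil h₁ h₂ hd s₁]
    rw [e4, Matrix.mul_add, Matrix.mul_smul, ← Matrix.mul_assoc (_ * _), e5, e1]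
    simp only [Matrix.add_mul, Matrix.sub_mul, Matrix.mul_sub, Matrix.smul_mul,
      Matrix.transpose_sub, smul_sub, smul_add, Matrix.mul_assoc, mul_smul]
    abel
  rw [hP.riemannUp_eq, h₁.riemannUp_eq, h₂.riemannUp_eq, hpd, hpd, quad k l, quad l k, s₂ k l,
    s₃ k l]
  simp only [Matrix.add_apply, Matrix.sub_apply, Matrix.smul_apply, smul_eq_mul]
  ring

end Pencil

end MetricPencil

end

open scoped ContDiff Topology Matrix

noncomputable section

namespace MetricPencil

/-! ### Algebra of frame components. -/

section FrameAlgebra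

variable {N : ℕ}

/-- The components `S^i_{jn} = S^i_{lm} K^l_j K^m_n` in the frame formed by the columns of `K`. -/
def frameCoeff (K : Matrix (Fin N) (Fin N) ℂ) (S : Fin N → Matrix (Fin N) (Fin N) ℂ)
    (i j n : Fin N) : ℂ :=
  ∑ m, (S m * K) i j * K m n

lemma frameCoeff_symm (K : Matrix (Fin N) (Fin N) ℂ) {S : Fin N → Matrix (Fin N) (Fin N) ℂ}
    (hS : ∀ i j m, S m i j = S j i m) (i j n : Fin N) :
    frameCoeff K S i j n = frameCoeff K S i n j := by
  simp only [frameCoeff, Matrix.mul_apply, Finset.sum_mul]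
  rw [Finset.sum_comm]
  refine Finset.sum_congr rfl fun m _ => Finset.sum_congr rfl fun l _ => ?_
  rw [hS i m l]
  ring

lemma frameCoeff_sub (K : Matrix (Fin N) (Fin N) ℂ) (S T : Fin N → Matrix (Fin N) (Fin N) ℂ)
    (i j n : Fin N) :
    frameCoeff K (fun m => S m - T m) i j n = frameCoeff K S i j n - frameCoeff K T i j n := by
  simp only [frameCoeff, Matrix.sub_apply, sub_mul, Finset.sum_sub_distrib]

/-- A covector evaluated through its frame components. -/
lemma sum_mul_eq_frame {K Θ : Matrix (Fin N) (Fin N) ℂ} (hK : K * Θ = 1) (v h : Fin N → ℂ) :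
    ∑ m, v m * h m = ∑ n, (∑ m, v m * K m n) * (Θ *ᵥ h) n := by
  have : v ⬝ᵥ h = (v ᵥ* K) ⬝ᵥ (Θ *ᵥ h) := by
    rw [Matrix.dotProduct_mulVec, Matrix.vecMul_vecMul, hK, Matrix.vecMul_one]
  exact this

lemma frameCoeff_expand {K Θ : Matrix (Fin N) (Fin N) ℂ} (hK : K * Θ = 1)
    (S : Fin N → Matrix (Fin N) (Fin N) ℂ) (i j m : Fin N) :
    (S m * K) i j = ∑ n, frameCoeff K S i j n * Θ n m := by
  have := sum_mul_eq_frame hK (fun m => (S m * K) i j) (Pi.single m 1)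
  simpa [frameCoeff, Pi.single_apply] using this

/-- Coefficients symmetric in the last two indices and skew in the first two after weighting
vanish for distinct indices. -/
lemma eq_zero_of_symm_of_skew {s : Fin N → Fin N → Fin N → ℂ} {h : Fin N → ℂ}
    (hh : ∀ i, h i ≠ 0) (hs : ∀ i j n, s i j n = s i n j)
    (ha : ∀ i j n, i ≠ j → s i j n * h j + s j i n * h i = 0) {i j n : Fin N}
    (hij : i ≠ j) (hin : i ≠ n) (hjn : j ≠ n) : s i j n = 0 := by
  -- Passing round the cycle of three indices with the two symmetries returns the same component
  -- with the opposite sign.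
  have e1 := ha i j n hij
  have e2 := ha j n i hjn
  have e3 := ha n i j hin.symm
  rw [hs j i n] at e1
  rw [hs n j i] at e2
  rw [hs i n j] at e3
  have : 2 * (h i * h j * h n) * s i j n = 0 := by
    linear_combination (h i * h n) * e1 - (h i * h i) * e2 + (h i * h j) * e3
  have h2 : (2 : ℂ) * (h i * h j * h n) ≠ 0 :=
    mul_ne_zero two_ne_zero (mul_ne_zero (mul_ne_zero (hh i) (hh j)) (hh n))
  exact (mul_eq_zero.1 this).resolve_left h2

end FrameAlgebra

/-! ### Connections of a simultaneously diagonal pair in its coframe. -/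

section FrameDerivative

variable {N : ℕ} {G G₁ G₂ : Coord N → Matrix (Fin N) (Fin N) ℝ} {x : Coord N}
  {Θ : Coord N → Matrix (Fin N) (Fin N) ℂ}

/-- Minus the covariant derivative of the coframe `Θ`. -/
def coframeDeriv (G : Coord N → Matrix (Fin N) (Fin N) ℝ) (Θ : Coord N → Matrix (Fin N) (Fin N) ℂ)
    (x : Coord N) (m : Fin N) : Matrix (Fin N) (Fin N) ℂ :=
  Θ x * complexify (gammaMat G m x) - pdMat m Θ x

/-- `hD` is closedness of the rows of `Θ`; the connection term is symmetric because the torsion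
vanishes. -/
lemma coframeDeriv_symm (hG : IsMetricNear G x)
    (hD : ∀ i j m, pdMat m Θ x i j = pdMat j Θ x i m) (i j m : Fin N) :
    coframeDeriv G Θ x m i j = coframeDeriv G Θ x j i m := by
  rw [coframeDeriv, coframeDeriv, Matrix.sub_apply, Matrix.sub_apply, hD, Matrix.mul_apply,
    Matrix.mul_apply]
  congr 1
  refine Finset.sum_congr rfl fun s _ => ?_
  simp only [complexify, Matrix.map_apply, gammaMat, Matrix.of_apply]
  rw [hG.christoffel_symm]

/-- The derivatives of a metric that is diagonal in a coframe. -/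
lemma pd_diagonal_eq (hG : IsMetricNear G x) (hΘ : SmoothEntries Θ x) (hdet : (Θ x).det ≠ 0)
    {h : Coord N → Fin N → ℂ}
    (e : ∀ᶠ y in 𝓝 x, Θ y * complexify (G y) * (Θ y)ᵀ = Matrix.diagonal (h y)) (i j n : Fin N) :
    ∑ m, pd m (fun y => Matrix.diagonal (h y) i j) x * (Θ x)⁻¹ m n =
      -(frameCoeff (Θ x)⁻¹ (coframeDeriv G Θ x) i j n * h x j
        + frameCoeff (Θ x)⁻¹ (coframeDeriv G Θ x) j i n * h x i) := by
  have hu : IsUnit (Θ x).det := isUnit_iff_ne_zero.2 hdet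
  set K := (Θ x)⁻¹ with hK
  have hsym : (complexify (G x))ᵀ = complexify (G x) := by
    rw [← complexify_transpose, show (G x)ᵀ = G x from hG.symm.self_of_nhds]
  have hCK : complexify (G x) * (Θ x)ᵀ = K * Matrix.diagonal (h x) := by
    rw [← e.self_of_nhds, Matrix.mul_assoc, ← Matrix.mul_assoc, hK, Matrix.nonsing_inv_mul _ hu,
      Matrix.one_mul]
  have hKC : Θ x * complexify (G x) = (K * Matrix.diagonal (h x))ᵀ := by
    rw [← hCK, Matrix.transpose_mul, Matrix.transpose_transpose, hsym]
  -- Differentiate ΘGΘᵀ and replace ∂G by `metric_compat`: each ∂Θ joins a ΘΓ into `coframeDeriv`.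
  have key : ∀ m, pdMat m (fun y => Matrix.diagonal (h y)) x =
      -(coframeDeriv G Θ x m * K * Matrix.diagonal (h x) +
        (coframeDeriv G Θ x m * K * Matrix.diagonal (h x))ᵀ) := by
    intro m
    rw [← pdMat_congr e, pdMat_mul (hΘ.mul hG.smooth.complexify) hΘ.transpose,
      pdMat_mul hΘ hG.smooth.complexify, pdMat_transpose, pdMat_complexify hG.smooth,
      hG.metric_compat, complexify_sub, complexify_neg, complexify_mul, complexify_mul,
      complexify_transpose, Matrix.mul_assoc (coframeDeriv G Θ x m), Matrix.transpose_mul, ← hKC,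
      ← hCK, coframeDeriv, Matrix.transpose_sub, Matrix.transpose_mul]
    simp only [Matrix.mul_sub, Matrix.sub_mul, Matrix.add_mul, Matrix.mul_neg, Matrix.neg_mul,
      Matrix.mul_assoc]
    abel
  have key' : ∀ m, pd m (fun y => Matrix.diagonal (h y) i j) x =
      -((coframeDeriv G Θ x m * K) i j * h x j + (coframeDeriv G Θ x m * K) j i * h x i) := by
    intro m
    have := congrFun (congrFun (key m) i) j
    rw [Matrix.neg_apply, Matrix.add_apply, Matrix.transpose_apply, Matrix.mul_diagonal,
      Matrix.mul_diagonal] at this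
    exact this
  simp only [key', frameCoeff, Finset.sum_mul, ← Finset.sum_add_distrib, ← Finset.sum_neg_distrib]
  exact Finset.sum_congr rfl fun m _ => by ring

/-- The off-diagonal entries of the metric in the coframe vanish identically, so their derivatives
do too. -/
lemma frameCoeff_skew (hG : IsMetricNear G x) (hΘ : SmoothEntries Θ x) (hdet : (Θ x).det ≠ 0)
    {h : Coord N → Fin N → ℂ}
    (e : ∀ᶠ y in 𝓝 x, Θ y * complexify (G y) * (Θ y)ᵀ = Matrix.diagonal (h y)) (i j n : Fin N)
    (hij : i ≠ j) :
    frameCoeff (Θ x)⁻¹ (coframeDeriv G Θ x) i j n * h x j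
        + frameCoeff (Θ x)⁻¹ (coframeDeriv G Θ x) j i n * h x i = 0 := by
  have := pd_diagonal_eq hG hΘ hdet e i j n
  simp only [Matrix.diagonal_apply_ne _ hij, pd_const, zero_mul, Finset.sum_const_zero] at this
  exact neg_eq_zero.1 this.symm

lemma frameCoeff_diag (hG : IsMetricNear G x) (hΘ : SmoothEntries Θ x) (hdet : (Θ x).det ≠ 0)
    {h : Coord N → Fin N → ℂ}
    (e : ∀ᶠ y in 𝓝 x, Θ y * complexify (G y) * (Θ y)ᵀ = Matrix.diagonal (h y)) (i n : Fin N) :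
    ∑ m, pd m (fun y => h y i) x * (Θ x)⁻¹ m n =
      -(2 * frameCoeff (Θ x)⁻¹ (coframeDeriv G Θ x) i i n * h x i) := by
  have := pd_diagonal_eq hG hΘ hdet e i i n
  simp only [Matrix.diagonal_apply_eq] at this
  rw [this]
  ring

lemma smoothEntries_diag (hG : SmoothEntries G x) (hΘ : SmoothEntries Θ x)
    {h : Coord N → Fin N → ℂ}
    (e : ∀ᶠ y in 𝓝 x, Θ y * complexify (G y) * (Θ y)ᵀ = Matrix.diagonal (h y)) (i : Fin N) :
    ContDiffAt ℝ ∞ (fun y => h y i) x := by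
  refine (((hΘ.mul hG.complexify).mul hΘ.transpose) i i).congr_of_eventuallyEq ?_
  filter_upwards [e] with y hy
  rw [hy, Matrix.diagonal_apply_eq]

lemma diag_ne_zero (hG : (G x).det ≠ 0) (hdet : (Θ x).det ≠ 0) {h : Fin N → ℂ}
    (e : Θ x * complexify (G x) * (Θ x)ᵀ = Matrix.diagonal h) (i : Fin N) : h i ≠ 0 := by
  have hC : (complexify (G x)).det ≠ 0 := by
    rw [det_complexify]; exact_mod_cast hG
  exact (mul_mul_inv_eq_diagonal hdet hC e e).1 i

/-- The frame derivatives of the ratio of the diagonal entries of two metrics. -/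
lemma frame_pd_ratio (h₁ : IsMetricNear G₁ x) (h₂ : IsMetricNear G₂ x) (hΘ : SmoothEntries Θ x)
    (hdet : (Θ x).det ≠ 0) {f h : Coord N → Fin N → ℂ}
    (e₁ : ∀ᶠ y in 𝓝 x, Θ y * complexify (G₁ y) * (Θ y)ᵀ =
      Matrix.diagonal (fun i => f y i * h y i))
    (e₂ : ∀ᶠ y in 𝓝 x, Θ y * complexify (G₂ y) * (Θ y)ᵀ = Matrix.diagonal (h y)) (i n : Fin N)
    (hf : DifferentiableAt ℝ (fun y => f y i) x) :
    ∑ m, pd m (fun y => f y i) x * (Θ x)⁻¹ m n = -(2 * f x i *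
      (frameCoeff (Θ x)⁻¹ (coframeDeriv G₁ Θ x) i i n
        - frameCoeff (Θ x)⁻¹ (coframeDeriv G₂ Θ x) i i n)) := by
  have hne := diag_ne_zero h₂.det_ne hdet e₂.self_of_nhds i
  have d2 := frameCoeff_diag h₂ hΘ hdet e₂ i n
  have d1 := frameCoeff_diag (h := fun y i => f y i * h y i) h₁ hΘ hdet e₁ i n
  have hh : DifferentiableAt ℝ (fun y => h y i) x :=
    (smoothEntries_diag h₂.smooth hΘ e₂ i).differentiableAt (by simp)
  have : ∑ m, pd m (fun y => f y i * h y i) x * (Θ x)⁻¹ m n =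
      (∑ m, pd m (fun y => f y i) x * (Θ x)⁻¹ m n) * h x i +
      f x i * ∑ m, pd m (fun y => h y i) x * (Θ x)⁻¹ m n := by
    rw [Finset.sum_mul, Finset.mul_sum, ← Finset.sum_add_distrib]
    refine Finset.sum_congr rfl fun m _ => ?_
    rw [pd_mul hf hh]
    ring
  rw [this, d2] at d1
  refine mul_right_cancel₀ hne ?_
  linear_combination d1

lemma coframeDeriv_sub (m : Fin N) :
    coframeDeriv G₁ Θ x m - coframeDeriv G₂ Θ x m =
      Θ x * complexify (gammaMat G₁ m x - gammaMat G₂ m x) := by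
  rw [coframeDeriv, coframeDeriv, complexify_sub, Matrix.mul_sub]
  abel

/-- A pair that is diagonal in a closed coframe, with the ratios depending on one coordinate each,
has connections with diagonal difference. -/
lemma hasDiagonalDifference_of_closed (h₁ : IsMetricNear G₁ x) (h₂ : IsMetricNear G₂ x)
    (hΘ : SmoothEntries Θ x) (hdet : (Θ x).det ≠ 0)
    (hD : ∀ i j m, pdMat m Θ x i j = pdMat j Θ x i m) {f h : Coord N → Fin N → ℂ}
    (e₁ : ∀ᶠ y in 𝓝 x, Θ y * complexify (G₁ y) * (Θ y)ᵀ =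
      Matrix.diagonal (fun i => f y i * h y i))
    (e₂ : ∀ᶠ y in 𝓝 x, Θ y * complexify (G₂ y) * (Θ y)ᵀ = Matrix.diagonal (h y))
    (hf : ∀ i, DifferentiableAt ℝ (fun y => f y i) x)
    (hfΘ : ∀ i, ∃ κ : ℂ, ∀ m, pd m (fun y => f y i) x = κ * Θ x i m) :
    HasDiagonalDifference G₁ G₂ x := by
  have hu : IsUnit (Θ x).det := isUnit_iff_ne_zero.2 hdet
  have hKΘ : (Θ x)⁻¹ * Θ x = 1 := Matrix.nonsing_inv_mul _ hu
  have hΘK : Θ x * (Θ x)⁻¹ = 1 := Matrix.mul_nonsing_inv _ hu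
  set K := (Θ x)⁻¹ with hK
  set s₁ := frameCoeff K (coframeDeriv G₁ Θ x) with hs₁
  set s₂ := frameCoeff K (coframeDeriv G₂ Θ x) with hs₂
  have n₁ : ∀ i, f x i * h x i ≠ 0 := diag_ne_zero h₁.det_ne hdet e₁.self_of_nhds
  have n₂ : ∀ i, h x i ≠ 0 := diag_ne_zero h₂.det_ne hdet e₂.self_of_nhds
  have y₁ : ∀ i j n, s₁ i j n = s₁ i n j := frameCoeff_symm K (coframeDeriv_symm h₁ hD)
  have y₂ : ∀ i j n, s₂ i j n = s₂ i n j := frameCoeff_symm K (coframeDeriv_symm h₂ hD)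
  -- The differential of `f i` is a multiple of row `i`, so its derivative along the frame vector
  -- `n` vanishes. `frame_pd_ratio` identifies that derivative with the difference of the two
  -- components.
  have diag : ∀ i n, i ≠ n → s₁ i i n = s₂ i i n := by
    intro i n hin
    have := frame_pd_ratio h₁ h₂ hΘ hdet e₁ e₂ i n (hf i)
    obtain ⟨κ, hκ⟩ := hfΘ i
    have z : ∑ m, pd m (fun y => f y i) x * (Θ x)⁻¹ m n = 0 := by
      simp only [hκ, mul_assoc, ← Finset.mul_sum]
      rw [← Matrix.mul_apply, ← hK, hΘK, Matrix.one_apply_ne hin, mul_zero]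
    rw [z, eq_comm, neg_eq_zero] at this
    have hfi : f x i ≠ 0 := left_ne_zero_of_mul (n₁ i)
    exact sub_eq_zero.1 ((mul_eq_zero.1 this).resolve_left (mul_ne_zero two_ne_zero hfi))
  have off : ∀ i j n, j ≠ n → s₁ i j n = s₂ i j n := by
    intro i j n hjn
    by_cases hij : i = j
    · subst hij; exact diag i n hjn
    by_cases hin : i = n
    · subst hin
      rw [y₁, y₂]
      exact diag i j hij
    rw [eq_zero_of_symm_of_skew n₁ y₁ (frameCoeff_skew h₁ hΘ hdet e₁) hij hin hjn,
      eq_zero_of_symm_of_skew n₂ y₂ (frameCoeff_skew h₂ hΘ hdet e₂) hij hin hjn]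
  refine ⟨Θ x, K * Matrix.of (fun i j => s₁ i j j - s₂ i j j), _, _, hdet, e₁.self_of_nhds,
    e₂.self_of_nhds, fun m => ?_⟩
  set T := complexify (gammaMat G₁ m x - gammaMat G₂ m x) with hT
  have e : Θ x * T * K = Matrix.of (fun i j => s₁ i j j - s₂ i j j) *
      Matrix.diagonal (fun c => Θ x c m) := by
    ext i j
    rw [hT, ← coframeDeriv_sub, Matrix.mul_diagonal, Matrix.of_apply,
      frameCoeff_expand hKΘ (fun m => coframeDeriv G₁ Θ x m - coframeDeriv G₂ Θ x m) i j m]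
    simp only [frameCoeff_sub]
    rw [Finset.sum_eq_single j]
    · intro n _ hn
      have := off i j n hn.symm
      rw [hs₁, hs₂] at this
      rw [this, sub_self, zero_mul]
    · simp
  calc T = K * (Θ x * T * K) * Θ x := by
        rw [← Matrix.mul_assoc, ← Matrix.mul_assoc, hKΘ, Matrix.one_mul, Matrix.mul_assoc, hKΘ,
          Matrix.mul_one]
    _ = _ := by rw [e, ← Matrix.mul_assoc]

/-- If one linear combination has the right connection, then the eigencovectors `Θ i` of the pair
generate integrable ideals and the eigenvalues vary only along them. -/
lemma integrable_of_connection (h₁ : IsMetricNear G₁ x) (h₂ : IsMetricNear G₂ x)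
    (hΘ : SmoothEntries Θ x) (hdet : (Θ x).det ≠ 0) {f h : Coord N → Fin N → ℂ}
    (e₁ : ∀ᶠ y in 𝓝 x, Θ y * complexify (G₁ y) * (Θ y)ᵀ =
      Matrix.diagonal (fun i => f y i * h y i))
    (e₂ : ∀ᶠ y in 𝓝 x, Θ y * complexify (G₂ y) * (Θ y)ᵀ = Matrix.diagonal (h y))
    (hf : ∀ i, DifferentiableAt ℝ (fun y => f y i) x) (hinj : ∀ i j, i ≠ j → f x i ≠ f x j)
    {ε : ℝ} (hε : ε ≠ 0) (hd : (pencil 1 ε G₁ G₂ x).det ≠ 0)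
    (hlin : ∀ i j k, christoffelUp (pencil 1 ε G₁ G₂) i j k x =
      1 * christoffelUp G₁ i j k x + ε * christoffelUp G₂ i j k x) (i : Fin N) :
    (∀ v : Fin N → ℂ, (Θ x *ᵥ v) i = 0 → ∃ k : ℂ, ∀ w : Fin N → ℂ,
      ∑ m, ∑ l, pd m (fun y => Θ y i l) x * (v m * w l - w m * v l) = k * (Θ x *ᵥ w) i) ∧
    ∃ κ : ℂ, ∀ v : Fin N → ℂ, ∑ m, pd m (fun y => f y i) x * v m = κ * (Θ x *ᵥ v) i := by
  have hu : IsUnit (Θ x).det := isUnit_iff_ne_zero.2 hdet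
  have hKΘ : (Θ x)⁻¹ * Θ x = 1 := Matrix.nonsing_inv_mul _ hu
  have hΘK : Θ x * (Θ x)⁻¹ = 1 := Matrix.mul_nonsing_inv _ hu
  have hP := h₁.pencil h₂ hd
  set P := pencil 1 ε G₁ G₂ x with hPdef
  have n₂ : ∀ i, h x i ≠ 0 := diag_ne_zero h₂.det_ne hdet e₂.self_of_nhds
  set T : Fin N → Matrix (Fin N) (Fin N) ℝ := fun m => gammaMat G₁ m x - gammaMat G₂ m x with hT
  have hTsym : ∀ i j m, T m i j = T j i m := by
    intro i j m
    simp only [hT, Matrix.sub_apply, gammaMat, Matrix.of_apply]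
    rw [h₁.christoffel_symm, h₂.christoffel_symm]
  -- Multiplying the assumed identity by P⁻¹ shows that T_m G₁P⁻¹ is a difference of two
  -- torsion-free connections, hence symmetric in the lower indices.
  have hTA : ∀ m, T m * (G₁ x * P⁻¹) =
      gammaMat (pencil 1 ε G₁ G₂) m x - gammaMat G₂ m x := by
    intro m
    have e : gammaMat (pencil 1 ε G₁ G₂) m x * P =
        gammaMat G₁ m x * G₁ x + ε • (gammaMat G₂ m x * G₂ x) := by
      ext j i
      have := hlin i j m
      rw [christoffelUp_eq hP.symm.self_of_nhds, christoffelUp_eq h₁.symm.self_of_nhds,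
        christoffelUp_eq h₂.symm.self_of_nhds, one_mul] at this
      exact this
    have e' : (gammaMat (pencil 1 ε G₁ G₂) m x - gammaMat G₂ m x) * P = T m * G₁ x := by
      rw [Matrix.sub_mul, e, hPdef, pencil_apply, one_smul, Matrix.mul_add, Matrix.mul_smul, hT,
        Matrix.sub_mul]
      abel
    rw [← Matrix.mul_assoc, ← e', Matrix.mul_nonsing_inv_cancel_right _ _ hP.isUnit]
  have hTAsym : ∀ i j m, (T m * (G₁ x * P⁻¹)) i j = (T j * (G₁ x * P⁻¹)) i m := by
    intro i j m
    rw [hTA, hTA]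
    simp only [Matrix.sub_apply, gammaMat, Matrix.of_apply]
    rw [hP.christoffel_symm, h₂.christoffel_symm]
  set K := (Θ x)⁻¹ with hK
  set s₁ := frameCoeff K (coframeDeriv G₁ Θ x) with hs₁
  set s₂ := frameCoeff K (coframeDeriv G₂ Θ x) with hs₂
  have mulsym : ∀ (R : Fin N → Matrix (Fin N) (Fin N) ℝ), (∀ i j m, R m i j = R j i m) →
      ∀ i j m, (Θ x * complexify (R m)) i j = (Θ x * complexify (R j)) i m := by
    intro R hR i j m
    rw [Matrix.mul_apply, Matrix.mul_apply]
    refine Finset.sum_congr rfl fun s _ => ?_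
    simp only [complexify, Matrix.map_apply]
    rw [hR]
  have ht : ∀ i j n, s₁ i j n - s₂ i j n = frameCoeff K (fun m => Θ x * complexify (T m)) i j n :=
    fun i j n => by
      rw [hs₁, hs₂, ← frameCoeff_sub]
      congr 1
      funext m
      exact coframeDeriv_sub m
  have hC : (complexify P).det ≠ 0 := by
    rw [det_complexify]; exact_mod_cast hd
  have hinv : complexify P⁻¹ = (complexify P)⁻¹ := by
    refine (Matrix.inv_eq_right_inv ?_).symm
    rw [← complexify_mul, Matrix.mul_nonsing_inv _ hP.isUnit, complexify_one]
  have e : Θ x * complexify P * (Θ x)ᵀ = Matrix.diagonal (fun i => (f x i + ε) * h x i) := by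
    rw [hPdef, pencil_apply, one_smul, complexify_add, complexify_smul, Matrix.mul_add,
      Matrix.add_mul, Matrix.mul_smul, Matrix.smul_mul, e₁.self_of_nhds, e₂.self_of_nhds]
    ext i j
    by_cases hij : i = j
    · subst hij; simp; ring
    · simp [hij]
  obtain ⟨hne, hA⟩ := mul_mul_inv_eq_diagonal hdet hC e₁.self_of_nhds e
  set q : Fin N → ℂ := fun i => f x i * h x i / ((f x i + ε) * h x i) with hq
  -- q = f/(f + ε) is a Möbius function of f, injective because ε ≠ 0.
  have hqinj : ∀ j n, j ≠ n → q j ≠ q n := by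
    intro j n hjn hEq
    have a := hne j
    have b := hne n
    rw [hq] at hEq
    simp only at hEq
    rw [mul_div_mul_right _ _ (n₂ j), mul_div_mul_right _ _ (n₂ n), div_eq_div_iff
      (left_ne_zero_of_mul a) (left_ne_zero_of_mul b)] at hEq
    have : (ε : ℂ) * (f x j - f x n) = 0 := by linear_combination hEq
    exact hinj j n hjn (sub_eq_zero.1 ((mul_eq_zero.1 this).resolve_left (by exact_mod_cast hε)))
  have hqt : ∀ i j n, frameCoeff K (fun m => Θ x * complexify (T m * (G₁ x * P⁻¹))) i j n =
      frameCoeff K (fun m => Θ x * complexify (T m)) i j n * q j := by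
    intro i j n
    have hAK : complexify (G₁ x) * (complexify P)⁻¹ * K = K * Matrix.diagonal q := by
      calc complexify (G₁ x) * (complexify P)⁻¹ * K
          = K * (Θ x * (complexify (G₁ x) * (complexify P)⁻¹)) * K := by
            rw [← Matrix.mul_assoc K, hKΘ, Matrix.one_mul]
        _ = _ := by
            rw [hA, ← Matrix.mul_assoc, Matrix.mul_assoc, hΘK, Matrix.mul_one]
    simp only [frameCoeff, Finset.sum_mul]
    refine Finset.sum_congr rfl fun m _ => ?_
    rw [complexify_mul, complexify_mul, hinv, Matrix.mul_assoc, Matrix.mul_assoc, hAK,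
      ← Matrix.mul_assoc, ← Matrix.mul_assoc, Matrix.mul_diagonal, Matrix.mul_assoc]
    ring
  -- The coframe need not be closed, so `s₁` and `s₂` need not be symmetric; their difference t is.
  -- Since t_{ijn}q_j is symmetric in j, n as well, t_{ijn}(q_j − q_n) = 0.
  have off : ∀ i j n, j ≠ n → s₁ i j n = s₂ i j n := by
    intro i j n hjn
    have a := frameCoeff_symm K (mulsym _ hTAsym) i j n
    have b := frameCoeff_symm K (mulsym _ hTsym) i j n
    rw [hqt, hqt, ← b, ← ht] at a
    have : (s₁ i j n - s₂ i j n) * (q j - q n) = 0 := by linear_combination a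
    exact sub_eq_zero.1 ((mul_eq_zero.1 this).resolve_right (sub_ne_zero.2 (hqinj j n hjn)))
  -- For distinct indices the two connections now have the same components, skew with respect to the
  -- weights h and also f·h. Since f_i ≠ f_j, the two relations are independent.
  have dist : ∀ i j n, i ≠ j → i ≠ n → j ≠ n → s₂ i j n = 0 := by
    intro i j n hij hin hjn
    have a := frameCoeff_skew (h := fun y i => f y i * h y i) h₁ hΘ hdet e₁ i j n hij
    have b := frameCoeff_skew h₂ hΘ hdet e₂ i j n hij
    rw [← hK] at a b
    change s₁ i j n * (f x j * h x j) + s₁ j i n * (f x i * h x i) = 0 at a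
    change s₂ i j n * h x j + s₂ j i n * h x i = 0 at b
    rw [off i j n hjn, off j i n hin] at a
    have : s₂ i j n * (h x j * (f x j - f x i)) = 0 := by linear_combination a - f x i * b
    exact (mul_eq_zero.1 this).resolve_right
      (mul_ne_zero (n₂ j) (sub_ne_zero.2 (hinj j i hij.symm)))
  refine ⟨fun v hv => ?_, ?_⟩
  · refine ⟨-∑ n, (s₂ i i n - s₂ i n i) * (Θ x *ᵥ v) n, fun w => ?_⟩
    have bil : ∀ v w : Fin N → ℂ, ∑ m, ∑ l, coframeDeriv G₂ Θ x m i l * v m * w l =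
        ∑ n, ∑ j, s₂ i j n * (Θ x *ᵥ v) n * (Θ x *ᵥ w) j := by
      intro v w
      have a : ∀ m, ∑ l, coframeDeriv G₂ Θ x m i l * w l =
          ∑ j, (coframeDeriv G₂ Θ x m * K) i j * (Θ x *ᵥ w) j := fun m => by
        rw [sum_mul_eq_frame hKΘ]
        rfl
      calc ∑ m, ∑ l, coframeDeriv G₂ Θ x m i l * v m * w l
          = ∑ m, (∑ j, (coframeDeriv G₂ Θ x m * K) i j * (Θ x *ᵥ w) j) * v m := by
            refine Finset.sum_congr rfl fun m _ => ?_
            rw [← a, Finset.sum_mul]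
            exact Finset.sum_congr rfl fun l _ => by ring
        _ = ∑ n, (∑ m, (∑ j, (coframeDeriv G₂ Θ x m * K) i j * (Θ x *ᵥ w) j) * K m n) *
              (Θ x *ᵥ v) n := sum_mul_eq_frame hKΘ _ _
        _ = _ := by
            refine Finset.sum_congr rfl fun n _ => ?_
            simp only [hs₂, frameCoeff, Finset.sum_mul]
            rw [Finset.sum_comm]
            exact Finset.sum_congr rfl fun j _ => Finset.sum_congr rfl fun m _ => by ring
    have gsym : ∑ m, ∑ l, (Θ x * complexify (gammaMat G₂ m x)) i l * (v m * w l - w m * v l) =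
        0 := by
      have c := mulsym (fun m => gammaMat G₂ m x) (fun i j m => h₂.christoffel_symm i j m) i
      have : ∑ m, ∑ l, (Θ x * complexify (gammaMat G₂ m x)) i l * (w m * v l) =
          ∑ m, ∑ l, (Θ x * complexify (gammaMat G₂ m x)) i l * (v m * w l) := by
        rw [Finset.sum_comm]
        refine Finset.sum_congr rfl fun m _ => Finset.sum_congr rfl fun l _ => ?_
        rw [c m l]
        ring
      simp only [mul_sub, Finset.sum_sub_distrib]
      rw [this, sub_self]
    -- The exterior derivative of row `i` is minus the antisymmetrized `coframeDeriv`, because the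
    -- connection term is symmetric. By `dist` only index pairs containing `i` contribute, and those
    -- containing the `i`-th component of `v` vanish by `hv`.
    have e3 : ∑ m, ∑ l, pd m (fun y => Θ y i l) x * (v m * w l - w m * v l) =
        -(∑ n, ∑ j, s₂ i j n * (Θ x *ᵥ v) n * (Θ x *ᵥ w) j
          - ∑ n, ∑ j, s₂ i j n * (Θ x *ᵥ w) n * (Θ x *ᵥ v) j) := by
      rw [← bil, ← bil, ← sub_eq_zero, sub_neg_eq_add, ← gsym]
      simp only [← Finset.sum_sub_distrib, ← Finset.sum_add_distrib]
      refine Finset.sum_congr rfl fun m _ => Finset.sum_congr rfl fun l _ => ?_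
      rw [coframeDeriv, Matrix.sub_apply]
      simp only [pdMat, Matrix.of_apply]
      ring
    have e4 : ∑ n, ∑ j, s₂ i j n * (Θ x *ᵥ w) n * (Θ x *ᵥ v) j =
        ∑ n, ∑ j, s₂ i n j * (Θ x *ᵥ v) n * (Θ x *ᵥ w) j := by
      rw [Finset.sum_comm]
      exact Finset.sum_congr rfl fun j _ => Finset.sum_congr rfl fun m _ => by ring
    rw [e3, e4, ← Finset.sum_sub_distrib, neg_mul, Finset.sum_mul]
    congr 1
    refine Finset.sum_congr rfl fun n _ => ?_
    rw [← Finset.sum_sub_distrib, Finset.sum_eq_single i]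
    · ring
    · intro j _ hji
      by_cases hni : n = i
      · subst hni; rw [hv]; ring
      by_cases hjn : j = n
      · subst hjn; ring
      rw [dist i j n (Ne.symm hji) (Ne.symm hni) hjn, dist i n j (Ne.symm hni) (Ne.symm hji)
        (Ne.symm hjn)]
      ring
    · simp
  · refine ⟨∑ m, pd m (fun y => f y i) x * K m i, fun v => ?_⟩
    rw [sum_mul_eq_frame hKΘ, Finset.sum_eq_single i]
    · intro n _ hn
      have := frame_pd_ratio h₁ h₂ hΘ hdet e₁ e₂ i n (hf i)
      rw [← hK] at this
      rw [this]
      change -(2 * f x i * (s₁ i i n - s₂ i i n)) * _ = 0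
      rw [off i i n hn.symm]
      ring
    · simp

end FrameDerivative

end MetricPencil

end

open scoped ContDiff Topology Matrix

noncomputable section

namespace MetricPencil

/-! ### Surjectivity of the real and complex coordinate differentials. -/

section Rows

variable {N : ℕ} {M : Matrix (Fin N) (Fin N) ℂ}

lemma row_ne_zero (hM : M.det ≠ 0) (i : Fin N) : ∃ k, M i k ≠ 0 := by
  by_contra! h
  exact hM (Matrix.det_eq_zero_of_row_eq_zero i h)

lemma surjective_of_real_row (hM : M.det ≠ 0) (i : Fin N) (L : Coord N →L[ℝ] ℝ)
    (hL : ∀ k, ((L (Pi.single k 1) : ℝ) : ℂ) = M i k) : Function.Surjective L := by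
  obtain ⟨k, hk⟩ := row_ne_zero hM i
  have h0 : L (Pi.single k 1) ≠ 0 := by
    intro h
    rw [← hL, h] at hk
    exact hk Complex.ofReal_zero
  intro t
  refine ⟨(t / L (Pi.single k 1)) • Pi.single k 1, ?_⟩
  rw [map_smul, smul_eq_mul, div_mul_cancel₀ _ h0]

/-- If the image were a proper real subspace of ℂ, some nonzero functional Re(c·) would kill it.
Then c times row `i` plus c̄ times row `j` vanishes, contradicting independence of the rows. -/
lemma surjective_of_conj_rows (hM : M.det ≠ 0) {i j : Fin N} (hij : i ≠ j)
    (hc : ∀ k, M j k = (starRingEnd ℂ) (M i k)) (L : Coord N →L[ℝ] ℂ)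
    (hL : ∀ k, L (Pi.single k 1) = M i k) : Function.Surjective L := by
  by_contra hns
  have hlt : (LinearMap.range (L : Coord N →ₗ[ℝ] ℂ)) < ⊤ :=
    lt_top_iff_ne_top.2 fun h => hns (LinearMap.range_eq_top.1 h)
  obtain ⟨φ, hφ, hker⟩ := Submodule.exists_le_ker_of_lt_top _ hlt
  set c : ℂ := ⟨φ 1, -φ Complex.I⟩ with hcdef
  have hre : ∀ z : ℂ, φ z = (c * z).re := by
    intro z
    have : z = z.re • (1 : ℂ) + z.im • Complex.I := by
      simp [Complex.re_add_im]
    conv_lhs => rw [this, map_add, map_smul, map_smul]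
    simp [hcdef, Complex.mul_re]
    ring
  have hzero : ∀ k, c * M i k + (starRingEnd ℂ) c * M j k = 0 := by
    intro k
    have h1 : φ (L (Pi.single k 1)) = 0 := hker ⟨_, rfl⟩
    rw [hre, hL] at h1
    rw [hc, ← map_mul, Complex.add_conj, h1]
    simp
  have hw : (Pi.single i c + Pi.single j ((starRingEnd ℂ) c) : Fin N → ℂ) = 0 := by
    refine Matrix.eq_zero_of_vecMul_eq_zero hM ?_
    funext k
    rw [Matrix.add_vecMul, Matrix.single_vecMul, Matrix.single_vecMul]
    simpa using hzero k
  have hc0 : c = 0 := by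
    have := congrFun hw i
    simpa [Pi.single_apply, hij] using this
  refine hφ (LinearMap.ext fun z => ?_)
  rw [hre, hc0]
  simp

end Rows

/-! ### From the diagonal form to compatibility and the values of f. -/

section Diagonal

variable {N : ℕ} {Ω U : Set (Coord N)} {G G₁ G₂ : Coord N → Matrix (Fin N) (Fin N) ℝ}
  {x : Coord N} {σ : Equiv.Perm (Fin N)} {u : Coord N → Fin N → ℂ} {f : Fin N → ℂ → ℂ}
  {g : Fin N → Coord N → ℂ}

lemma IsMetric.isMetricNear (hG : IsMetric Ω G) (hΩ : IsOpen Ω) (hx : x ∈ Ω) :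
    IsMetricNear G x where
  smooth i j := (hG.smooth i j).contDiffAt (hΩ.mem_nhds hx)
  symm := by
    filter_upwards [hΩ.mem_nhds hx] with y hy using hG.symm y hy
  det_ne := hG.nondegenerate x hx

lemma pd_pd_comm {v : Coord N → ℂ} (hv : ContDiffAt ℝ ∞ v x) (m k : Fin N) :
    pd m (pd k v) x = pd k (pd m v) x := by
  have hd : DifferentiableAt ℝ (fderiv ℝ v) x :=
    (hv.fderiv_right (m := 1) (by norm_cast)).differentiableAt (by simp)
  have key : ∀ m k, pd m (pd k v) x = fderiv ℝ (fderiv ℝ v) x (Pi.single m 1) (Pi.single k 1) := by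
    intro m k
    have : HasFDerivAt (pd k v) ((fderiv ℝ (fderiv ℝ v) x).flip (Pi.single k 1)) x := by
      have := hd.hasFDerivAt.clm_apply (hasFDerivAt_const (Pi.single k (1 : ℝ)) x)
      simp only [ContinuousLinearMap.comp_zero, zero_add] at this
      exact this
    rw [pd, this.fderiv]
    rfl
  rw [key, key]
  exact (hv.isSymmSndFDerivAt
    (by simp only [minSmoothness_of_isRCLikeNormedField]; norm_cast)).eq _ _

lemma IsCoordinateSystem.contDiffAt (hu : IsCoordinateSystem U σ u) (hx : x ∈ U) (i : Fin N) :
    ContDiffAt ℝ ∞ (fun y => u y i) x := (hu.smooth i).contDiffAt (hu.isOpen.mem_nhds hx)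

lemma IsCoordinateSystem.smoothEntries (hu : IsCoordinateSystem U σ u) (hx : x ∈ U) :
    SmoothEntries (jacobian u) x := fun i _ => contDiffAt_pd (hu.contDiffAt hx i)

/-- In a coordinate system, a function of the single coordinate `u^i` is differentiable, with a
differential proportional to that of `u^i`. -/
lemma IsDiagonalForm.pd_factor (h : IsDiagonalForm U G₁ G₂ σ u f g) (hx : x ∈ U) (i : Fin N) :
    DifferentiableAt ℝ (fun y => f i (u y i)) x ∧
      ∃ κ : ℂ, ∀ m, pd m (fun y => f i (u y i)) x = κ * jacobian u x i m := by
  have hu := h.coordinates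
  have hU : U ∈ 𝓝 x := hu.isOpen.mem_nhds hx
  have hdu : DifferentiableAt ℝ (fun y => u y i) x := (hu.contDiffAt hx i).differentiableAt (by simp)
  have hsu : HasStrictFDerivAt (fun y => u y i) (fderiv ℝ (fun y => u y i) x) x :=
    (hu.contDiffAt hx i).hasStrictFDerivAt (by simp)
  by_cases hσ : σ i = i
  · set v : Coord N → ℝ := fun y => (u y i).re with hv
    have huv : ∀ y ∈ U, u y i = (v y : ℂ) := fun y hy => by
      have := hu.conj y hy i
      rw [hσ] at this
      exact (Complex.conj_eq_iff_re.1 this.symm).symm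
    have hsv : HasStrictFDerivAt v (Complex.reCLM.comp (fderiv ℝ (fun y => u y i) x)) x :=
      Complex.reCLM.hasStrictFDerivAt.comp x hsu
    have huv' : (fun y => u y i) =ᶠ[𝓝 x] fun y => (v y : ℂ) := by
      filter_upwards [hU] with y hy using huv y hy
    have hpd : ∀ m, jacobian u x i m = ((pd m v x : ℝ) : ℂ) := fun m => by
      rw [← pd_ofReal hsv.hasFDerivAt.differentiableAt]
      exact pd_congr huv'
    have hsurj : Function.Surjective (Complex.reCLM.comp (fderiv ℝ (fun y => u y i) x)) := by
      refine surjective_of_real_row (hu.regular x hx) i _ fun k => ?_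
      rw [hpd, pd, hsv.hasFDerivAt.fderiv]
    -- `f i` is smooth only on the set of values of the coordinate; since the coordinate is a
    -- submersion, this set is a neighbourhood of each of its points.
    have hS : {t : ℝ | ∃ y ∈ U, u y i = (t : ℂ)} ∈ 𝓝 (v x) := by
      rw [← hsv.map_nhds_eq_of_surj (LinearMap.range_eq_top.2 hsurj), Filter.mem_map]
      filter_upwards [hU] with y hy
      exact ⟨y, hy, huv y hy⟩
    have hF : DifferentiableAt ℝ (fun t : ℝ => f i (t : ℂ)) (v x) :=
      ((h.smooth_real i hσ).contDiffAt hS).differentiableAt (by simp)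
    have hcomp : HasFDerivAt (fun y => f i (v y : ℂ))
        ((fderiv ℝ (fun t : ℝ => f i (t : ℂ)) (v x)).comp
          (Complex.reCLM.comp (fderiv ℝ (fun y => u y i) x))) x :=
      hF.hasFDerivAt.comp x hsv.hasFDerivAt
    have hEq : (fun y => f i (u y i)) =ᶠ[𝓝 x] fun y => f i (v y : ℂ) := by
      filter_upwards [hU] with y hy
      rw [huv y hy]
    refine ⟨hcomp.differentiableAt.congr_of_eventuallyEq hEq,
      fderiv ℝ (fun t : ℝ => f i (t : ℂ)) (v x) 1, fun m => ?_⟩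
    rw [pd_congr hEq, pd, hcomp.fderiv, hpd, pd, hsv.hasFDerivAt.fderiv]
    rw [ContinuousLinearMap.comp_apply]
    set r := (Complex.reCLM.comp (fderiv ℝ (fun y => u y i) x)) (Pi.single m 1)
    conv_lhs => rw [show r = r • (1 : ℝ) by simp, map_smul]
    rw [Complex.real_smul, mul_comm]
  · have hconj : ∀ k, jacobian u x (σ i) k = (starRingEnd ℂ) (jacobian u x i k) := by
      intro k
      have hE : (fun y => u y (σ i)) =ᶠ[𝓝 x] fun y => (starRingEnd ℂ) (u y i) := by
        filter_upwards [hU] with y hy using hu.conj y hy i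
      have hd : HasFDerivAt (fun y => (starRingEnd ℂ) (u y i))
          (Complex.conjCLE.toContinuousLinearMap.comp (fderiv ℝ (fun y => u y i) x)) x :=
        Complex.conjCLE.toContinuousLinearMap.hasFDerivAt.comp x hdu.hasFDerivAt
      change pd k (fun y => u y (σ i)) x = _
      rw [pd_congr hE, pd, hd.fderiv]
      rfl
    have hsurj : Function.Surjective (fderiv ℝ (fun y => u y i) x) :=
      surjective_of_conj_rows (hu.regular x hx) (Ne.symm hσ) hconj _ fun k => rfl
    have hS : (fun y => u y i) '' U ∈ 𝓝 (u x i) := by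
      rw [← hsu.map_nhds_eq_of_surj (LinearMap.range_eq_top.2 hsurj), Filter.mem_map]
      filter_upwards [hU] with y hy
      exact ⟨y, hy, rfl⟩
    have hF : DifferentiableAt ℂ (f i) (u x i) := (h.holomorphic i hσ).differentiableAt hS
    have hcomp : HasFDerivAt (fun y => f i (u y i))
        (((fderiv ℂ (f i) (u x i)).restrictScalars ℝ).comp (fderiv ℝ (fun y => u y i) x)) x :=
      (hF.hasFDerivAt.restrictScalars ℝ).comp x hdu.hasFDerivAt
    refine ⟨hcomp.differentiableAt, fderiv ℂ (f i) (u x i) 1, fun m => ?_⟩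
    rw [pd, hcomp.fderiv, ContinuousLinearMap.comp_apply]
    change fderiv ℂ (f i) (u x i) (jacobian u x i m) = _
    set r := jacobian u x i m
    conv_lhs => rw [show r = r • (1 : ℂ) by simp, map_smul]
    rw [smul_eq_mul, mul_comm]

lemma IsDiagonalForm.hasDiagonalDifference (h : IsDiagonalForm U G₁ G₂ σ u f g) (hx : x ∈ U)
    (h₁ : IsMetricNear G₁ x) (h₂ : IsMetricNear G₂ x) : HasDiagonalDifference G₁ G₂ x := by
  have hu := h.coordinates
  have hU : U ∈ 𝓝 x := hu.isOpen.mem_nhds hx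
  refine hasDiagonalDifference_of_closed (Θ := jacobian u) (f := fun y i => f i (u y i))
    (h := fun y i => g i y) h₁ h₂ (hu.smoothEntries hx) (hu.regular x hx) ?_ ?_ ?_
    (fun i => (h.pd_factor hx i).1) (fun i => (h.pd_factor hx i).2)
  · intro i j m
    exact pd_pd_comm (hu.contDiffAt hx i) m j
  · filter_upwards [hU] with y hy using h.form₁ y hy
  · filter_upwards [hU] with y hy using h.form₂ y hy

/-- Pairs of the diagonal form are compatible. -/
lemma LocallyDiagonal.compatible (hΩ : IsOpen Ω) (hG₁ : IsMetric Ω G₁) (hG₂ : IsMetric Ω G₂)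
    (h : LocallyDiagonal Ω G₁ G₂) : Compatible Ω G₁ G₂ := by
  intro l₁ l₂ x hx hd
  obtain ⟨U, σ, u, f, g, hxU, hUΩ, hU⟩ := h x hx
  have hΩx := hΩ.mem_nhds hx
  refine linear_of_hasDiagonalDifference ?_ ?_ ?_ hd
  · filter_upwards [hΩx] with y hy using hG₁.isMetricNear hΩ hy
  · filter_upwards [hΩx] with y hy using hG₂.isMetricNear hΩ hy
  · filter_upwards [hU.coordinates.isOpen.mem_nhds hxU] with y hy
    exact hU.hasDiagonalDifference hy (hG₁.isMetricNear hΩ (hUΩ hy))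
      (hG₂.isMetricNear hΩ (hUΩ hy))

/-- The roots of `det (C₁ - μ C₂)` for a simultaneously diagonalized pair. -/
lemma setOf_det_eq_range {Θ C₁ C₂ : Matrix (Fin N) (Fin N) ℂ} {φ h : Fin N → ℂ}
    (hΘ : Θ.det ≠ 0) (hh : ∀ i, h i ≠ 0)
    (e₁ : Θ * C₁ * Θᵀ = Matrix.diagonal fun i => φ i * h i)
    (e₂ : Θ * C₂ * Θᵀ = Matrix.diagonal h) :
    {μ : ℂ | (C₁ - μ • C₂).det = 0} = Set.range φ := by
  ext μ
  have e : Θ * (C₁ - μ • C₂) * Θᵀ = Matrix.diagonal fun i => (φ i - μ) * h i := by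
    rw [Matrix.mul_sub, Matrix.sub_mul, Matrix.mul_smul, Matrix.smul_mul, e₁, e₂]
    ext i j
    by_cases hij : i = j
    · subst hij; simp; ring
    · simp [hij]
  have hd := congrArg Matrix.det e
  rw [Matrix.det_mul, Matrix.det_mul, Matrix.det_transpose, Matrix.det_diagonal] at hd
  simp only [Set.mem_ofPred_eq, Set.mem_range]
  constructor
  · intro h0
    rw [h0, mul_zero, zero_mul, eq_comm, Finset.prod_eq_zero_iff] at hd
    obtain ⟨i, -, hi⟩ := hd
    exact ⟨i, sub_eq_zero.1 ((mul_eq_zero.1 hi).resolve_right (hh i))⟩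
  · rintro ⟨i, rfl⟩
    rw [Finset.prod_eq_zero (Finset.mem_univ i) (by rw [sub_self, zero_mul])] at hd
    have := (mul_eq_zero.1 hd).resolve_right hΘ
    exact (mul_eq_zero.1 this).resolve_left hΘ

lemma injective_of_ncard_range {φ : Fin N → ℂ} (h : (Set.range φ).ncard = N) :
    Function.Injective φ := by
  have e : Set.range φ = ↑(Finset.univ.image φ) := by simp
  rw [e, Set.ncard_coe_finset] at h
  have : (Finset.univ.image φ).card = (Finset.univ : Finset (Fin N)).card := by simpa using h
  intro i j hij
  exact Finset.card_image_iff.1 this (by simp) (by simp) hij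

/-- f^i g^i is a diagonal entry of a nondegenerate form, hence nonzero. The values f^i exhaust the
roots μ, and N roots among N values leave no coincidence. -/
lemma IsDiagonalForm.factor_ne (hG₁ : IsMetric Ω G₁) (hG₂ : IsMetric Ω G₂) (hUΩ : U ⊆ Ω)
    (h : IsDiagonalForm U G₁ G₂ σ u f g) :
    (∀ x ∈ U, ∀ i, f i (u x i) ≠ 0) ∧ (IsNonsingularPair Ω G₁ G₂ →
        ∀ x ∈ U, ∀ i j, i ≠ j → f i (u x i) ≠ f j (u x j)) := by
  have hu := h.coordinates
  refine ⟨fun x hx i => ?_, fun hns x hx i j hij hEq => hij ?_⟩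
  · exact left_ne_zero_of_mul (diag_ne_zero (Θ := jacobian u)
      (hG₁.nondegenerate x (hUΩ hx)) (hu.regular x hx) (h.form₁ x hx) i)
  · have hg : ∀ i, g i x ≠ 0 := diag_ne_zero (Θ := jacobian u)
      (hG₂.nondegenerate x (hUΩ hx)) (hu.regular x hx) (h.form₂ x hx)
    have hc := hns x (hUΩ hx)
    rw [setOf_det_eq_range (hu.regular x hx) hg (h.form₁ x hx) (h.form₂ x hx)] at hc
    exact injective_of_ncard_range hc hEq

end Diagonal

end MetricPencil

end

open scoped ContDiff Topology Matrix

noncomputable section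

namespace MetricPencil

/-! ### Linear algebra of eigencovectors of a pair of symmetric matrices. -/

section EigenRows

variable {N : ℕ} {Θ C₁ C₂ : Matrix (Fin N) (Fin N) ℂ} {φ : Fin N → ℂ}

lemma eigenrows_iff : Θ * C₁ = Matrix.diagonal φ * (Θ * C₂) ↔
    ∀ i, Θ i ᵥ* C₁ = φ i • (Θ i ᵥ* C₂) := by
  constructor
  · intro h i
    funext j
    have := congrFun (congrFun h i) j
    rw [Matrix.diagonal_mul, Matrix.mul_apply_eq_vecMul, Matrix.mul_apply_eq_vecMul] at this
    exact this
  · intro h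
    ext i j
    rw [Matrix.diagonal_mul, Matrix.mul_apply_eq_vecMul, Matrix.mul_apply_eq_vecMul]
    exact congrFun (h i) j

/-- Eigencovectors for distinct eigenvalues are orthogonal for both forms. -/
lemma diagonal_of_eigenrows (hC₁ : C₁.IsSymm) (hC₂ : C₂.IsSymm) (hφ : Function.Injective φ)
    (e : Θ * C₁ = Matrix.diagonal φ * (Θ * C₂)) :
    Θ * C₂ * Θᵀ = Matrix.diagonal (fun i => (Θ * C₂ * Θᵀ) i i) ∧
      Θ * C₁ * Θᵀ = Matrix.diagonal (fun i => φ i * (Θ * C₂ * Θᵀ) i i) := by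
  set H := Θ * C₂ * Θᵀ with hH
  have e₁ : Θ * C₁ * Θᵀ = Matrix.diagonal φ * H := by
    rw [e, Matrix.mul_assoc]
  have s₂ : Hᵀ = H := by
    rw [hH, Matrix.transpose_mul, Matrix.transpose_mul, Matrix.transpose_transpose, hC₂,
      Matrix.mul_assoc]
  have s₁ : (Matrix.diagonal φ * H)ᵀ = Matrix.diagonal φ * H := by
    rw [← e₁, Matrix.transpose_mul, Matrix.transpose_mul, Matrix.transpose_transpose, hC₁,
      Matrix.mul_assoc]
  have off : ∀ i j, i ≠ j → H i j = 0 := by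
    intro i j hij
    have a := congrFun (congrFun s₁ i) j
    have b := congrFun (congrFun s₂ i) j
    rw [Matrix.transpose_apply, Matrix.diagonal_mul, Matrix.diagonal_mul] at a
    rw [Matrix.transpose_apply] at b
    rw [b] at a
    have : (φ j - φ i) * H i j = 0 := by linear_combination a
    exact (mul_eq_zero.1 this).resolve_left (sub_ne_zero.2 fun h => hij (hφ h).symm)
  have hd : H = Matrix.diagonal (fun i => H i i) := by
    ext i j
    by_cases hij : i = j
    · subst hij; simp
    · rw [off i j hij, Matrix.diagonal_apply_ne _ hij]
  refine ⟨hd, ?_⟩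
  rw [e₁]
  conv_lhs => rw [hd, Matrix.diagonal_mul_diagonal]

/-- The rows are eigenvectors of right multiplication by C₁C₂⁻¹ with distinct eigenvalues, hence
independent. -/
lemma det_ne_zero_of_eigenrows (hC₂ : C₂.det ≠ 0) (hφ : Function.Injective φ)
    (hne : ∀ i, Θ i ≠ 0) (e : Θ * C₁ = Matrix.diagonal φ * (Θ * C₂)) : Θ.det ≠ 0 := by
  have hli : LinearIndependent ℂ Θ := by
    refine Module.End.eigenvectors_linearIndependent' (C₁ * C₂⁻¹).vecMulLinear φ hφ Θ fun i => ?_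
    refine Module.End.hasEigenvector_iff.2 ⟨Module.End.mem_eigenspace_iff.2 ?_, hne i⟩
    rw [Matrix.vecMulLinear_apply, ← Matrix.vecMul_vecMul, eigenrows_iff.1 e i, Matrix.smul_vecMul,
      Matrix.vecMul_vecMul, Matrix.mul_nonsing_inv _ (isUnit_iff_ne_zero.2 hC₂), Matrix.vecMul_one]
  have := (Matrix.isUnit_iff_isUnit_det Θ).1 (Matrix.linearIndependent_rows_iff_isUnit.1 hli)
  exact this.ne_zero

/-- The eigenspaces of a pair with distinct eigenvalues are one-dimensional. -/
lemma eigenrow_unique (hC₁ : C₁.IsSymm) (hC₂ : C₂.IsSymm) (hd : C₂.det ≠ 0)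
    (hφ : Function.Injective φ) (hne : ∀ i, Θ i ≠ 0)
    (e : Θ * C₁ = Matrix.diagonal φ * (Θ * C₂)) (i : Fin N) :
    Θ i ᵥ* C₂ ⬝ᵥ Θ i ≠ 0 ∧
      ∀ v : Fin N → ℂ, v ᵥ* C₁ = φ i • (v ᵥ* C₂) → ∃ c : ℂ, v = c • Θ i := by
  have hdet := det_ne_zero_of_eigenrows hd hφ hne e
  have hu : IsUnit Θ.det := isUnit_iff_ne_zero.2 hdet
  obtain ⟨d₂, d₁⟩ := diagonal_of_eigenrows hC₁ hC₂ hφ e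
  set h : Fin N → ℂ := fun i => (Θ * C₂ * Θᵀ) i i with hh
  have hne' : ∀ i, h i ≠ 0 := (mul_mul_inv_eq_diagonal hdet hd d₂ d₂).1
  refine ⟨hne' i, fun v hv => ?_⟩
  set a := v ᵥ* Θ⁻¹ with ha
  have hva : v = a ᵥ* Θ := by
    rw [ha, Matrix.vecMul_vecMul, Matrix.nonsing_inv_mul _ hu, Matrix.vecMul_one]
  have e1 : v ᵥ* C₁ ᵥ* Θᵀ = fun j => a j * (φ j * h j) := by
    rw [hva, Matrix.vecMul_vecMul, Matrix.vecMul_vecMul, ← Matrix.mul_assoc, d₁]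
    funext j
    rw [Matrix.vecMul_diagonal]
  have e2 : v ᵥ* C₂ ᵥ* Θᵀ = fun j => a j * h j := by
    rw [hva, Matrix.vecMul_vecMul, Matrix.vecMul_vecMul, ← Matrix.mul_assoc, d₂]
    funext j
    rw [Matrix.vecMul_diagonal]
  have hz : ∀ j, j ≠ i → a j = 0 := by
    intro j hj
    have := congrFun e1 j
    rw [hv, Matrix.smul_vecMul, e2] at this
    simp only [Pi.smul_apply, smul_eq_mul] at this
    have : (φ i - φ j) * h j * a j = 0 := by linear_combination this
    exact (mul_eq_zero.1 this).resolve_left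
      (mul_ne_zero (sub_ne_zero.2 fun h => hj (hφ h).symm) (hne' j))
  refine ⟨a i, ?_⟩
  have hs : a = Pi.single i (a i) := by
    funext j
    by_cases hj : j = i
    · subst hj; simp
    · rw [hz j hj, Pi.single_eq_of_ne hj]
  rw [hva, hs, Matrix.single_vecMul]
  simp
  rfl

end EigenRows

/-! ### Smooth dependence of simple eigencovectors. -/

section EigenIFT

variable {N : ℕ} {𝕜 : Type} [RCLike 𝕜]

/-- A simple eigencovector of a pair of symmetric matrices and its eigenvalue vary smoothly. -/
lemma exists_smooth_eigencovector {M₁ M₂ : Coord N → Matrix (Fin N) (Fin N) 𝕜} {p : Coord N}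
    (h₁ : ∀ᶠ x in 𝓝 p, SmoothEntries M₁ x) (h₂ : ∀ᶠ x in 𝓝 p, SmoothEntries M₂ x)
    (s₁ : (M₁ p).IsSymm) (s₂ : (M₂ p).IsSymm) {θ₀ : Fin N → 𝕜} {f₀ : 𝕜}
    (he : θ₀ ᵥ* M₁ p = f₀ • (θ₀ ᵥ* M₂ p)) (hc : θ₀ ᵥ* M₂ p ⬝ᵥ θ₀ ≠ 0)
    (huniq : ∀ v : Fin N → 𝕜, v ᵥ* M₁ p = f₀ • (v ᵥ* M₂ p) → ∃ c : 𝕜, v = c • θ₀) :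
    ∃ (θ : Coord N → Fin N → 𝕜) (f : Coord N → 𝕜), θ p = θ₀ ∧ f p = f₀ ∧
      (∀ᶠ x in 𝓝 p, ∀ i, ContDiffAt ℝ ∞ (fun y => θ y i) x) ∧ (∀ᶠ x in 𝓝 p, ContDiffAt ℝ ∞ f x) ∧
      ∀ᶠ x in 𝓝 p, θ x ᵥ* M₁ x = f x • (θ x ᵥ* M₂ x) := by
  set c₀ := θ₀ ᵥ* M₂ p ⬝ᵥ θ₀ with hc₀
  set n : Fin N → 𝕜 := c₀⁻¹ • (θ₀ ᵥ* M₂ p) with hn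
  -- The eigencovector equation together with the normalization θ·n = 1, which makes the numbers of
  -- equations and unknowns equal; n is scaled so that θ₀·n = 1.
  set Φ : Coord N × ((Fin N → 𝕜) × 𝕜) → (Fin N → 𝕜) × 𝕜 := fun z =>
    (z.2.1 ᵥ* M₁ z.1 - z.2.2 • (z.2.1 ᵥ* M₂ z.1), z.2.1 ⬝ᵥ n - 1) with hΦ
  have hn1 : θ₀ ⬝ᵥ n = 1 := by
    rw [hn, dotProduct_smul, dotProduct_comm, ← hc₀, smul_eq_mul, inv_mul_cancel₀ hc]
  have hsmooth : ∀ᶠ z in 𝓝 (p, (θ₀, f₀)), ContDiffAt ℝ ∞ Φ z := by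
    have t : Filter.Tendsto (fun z : Coord N × ((Fin N → 𝕜) × 𝕜) => z.1) (𝓝 (p, (θ₀, f₀))) (𝓝 p) :=
      continuous_fst.tendsto _
    filter_upwards [t.eventually h₁, t.eventually h₂] with z a₁ a₂
    have b : ∀ k, ContDiffAt ℝ ∞ (fun z : Coord N × ((Fin N → 𝕜) × 𝕜) => z.2.1 k) z := fun k => by
      fun_prop
    have b' : ContDiffAt ℝ ∞ (fun z : Coord N × ((Fin N → 𝕜) × 𝕜) => z.2.2) z := by fun_prop
    have hv : ∀ (M : Coord N → Matrix (Fin N) (Fin N) 𝕜), SmoothEntries M z.1 → ∀ l,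
        ContDiffAt ℝ ∞ (fun z : Coord N × ((Fin N → 𝕜) × 𝕜) => (z.2.1 ᵥ* M z.1) l) z := by
      intro M hM l
      simp only [Matrix.vecMul, dotProduct]
      exact ContDiffAt.sum fun k _ => (b k).mul ((hM k l).comp z contDiffAt_fst)
    refine ContDiffAt.prodMk (contDiffAt_pi.2 fun l => ?_) ?_
    · exact (hv M₁ a₁ l).sub (b'.mul (hv M₂ a₂ l))
    · simp only [dotProduct]
      exact (ContDiffAt.sum fun k _ => (b k).mul contDiffAt_const).sub contDiffAt_const
  have h0 : Φ (p, (θ₀, f₀)) = 0 := by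
    simp only [hΦ, he, hn1, sub_self]
    rfl
  -- Along a line in (θ, f) the map is a polynomial of degree two, whose linear coefficient is the
  -- derivative.
  have hder : ∀ δ : (Fin N → 𝕜) × 𝕜, fderiv ℝ Φ (p, (θ₀, f₀)) (0, δ) =
      (δ.1 ᵥ* M₁ p - f₀ • (δ.1 ᵥ* M₂ p) - δ.2 • (θ₀ ᵥ* M₂ p), δ.1 ⬝ᵥ n) := by
    intro δ
    have hd : HasFDerivAt Φ (fderiv ℝ Φ (p, (θ₀, f₀))) (p, (θ₀, f₀)) :=
      (hsmooth.self_of_nhds.differentiableAt (by simp)).hasFDerivAt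
    have hline : HasDerivAt (fun t : ℝ => ((p, (θ₀, f₀)) : Coord N × ((Fin N → 𝕜) × 𝕜))
        + t • (0, δ)) (0, δ) 0 := by
      simpa using ((hasDerivAt_id (0 : ℝ)).smul_const
        ((0, δ) : Coord N × ((Fin N → 𝕜) × 𝕜))).const_add (p, (θ₀, f₀))
    have h1 := HasFDerivAt.comp_hasDerivAt (0 : ℝ) (l := Φ) (by simpa using hd) hline
    have hEq : (Φ ∘ fun t : ℝ => ((p, (θ₀, f₀)) : Coord N × ((Fin N → 𝕜) × 𝕜)) + t • (0, δ)) =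
        fun t : ℝ => t • ((δ.1 ᵥ* M₁ p - f₀ • (δ.1 ᵥ* M₂ p) - δ.2 • (θ₀ ᵥ* M₂ p), δ.1 ⬝ᵥ n) :
          (Fin N → 𝕜) × 𝕜) + (t * t) • ((-(δ.2 • (δ.1 ᵥ* M₂ p)), 0) : (Fin N → 𝕜) × 𝕜) := by
      funext t
      simp only [hΦ, Function.comp]
      refine Prod.ext ?_ ?_
      · funext l
        have := congrFun he l
        simp only [Prod.fst_add, Prod.snd_add, Prod.smul_fst, Prod.smul_snd, smul_zero, add_zero,
          Matrix.add_vecMul, Matrix.smul_vecMul, Pi.sub_apply, Pi.add_apply, Pi.smul_apply,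
          Pi.neg_apply, smul_eq_mul, RCLike.real_smul_eq_coe_mul, map_mul] at this ⊢
        rw [this]
        ring
      · simp only [Prod.fst_add, Prod.snd_add, Prod.smul_fst, Prod.smul_snd, add_dotProduct,
          smul_dotProduct, hn1, smul_zero, add_zero]
        ring
    rw [hEq] at h1
    have h2 : HasDerivAt (fun t : ℝ => t • ((δ.1 ᵥ* M₁ p - f₀ • (δ.1 ᵥ* M₂ p)
          - δ.2 • (θ₀ ᵥ* M₂ p), δ.1 ⬝ᵥ n) : (Fin N → 𝕜) × 𝕜)
          + (t * t) • ((-(δ.2 • (δ.1 ᵥ* M₂ p)), 0) : (Fin N → 𝕜) × 𝕜))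
        (δ.1 ᵥ* M₁ p - f₀ • (δ.1 ᵥ* M₂ p) - δ.2 • (θ₀ ᵥ* M₂ p), δ.1 ⬝ᵥ n) 0 := by
      have := ((hasDerivAt_id (0 : ℝ)).smul_const ((δ.1 ᵥ* M₁ p - f₀ • (δ.1 ᵥ* M₂ p)
          - δ.2 • (θ₀ ᵥ* M₂ p), δ.1 ⬝ᵥ n) : (Fin N → 𝕜) × 𝕜)).add
        (((hasDerivAt_id (0 : ℝ)).mul (hasDerivAt_id (0 : ℝ))).smul_const
          ((-(δ.2 • (δ.1 ᵥ* M₂ p)), 0) : (Fin N → 𝕜) × 𝕜))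
      exact this.congr_deriv (by simp)
    exact h1.unique h2
  -- Pairing with θ₀ and using the symmetry of both matrices forces the eigenvalue variation to
  -- vanish, as θ₀M₂θ₀ ≠ 0. Simplicity makes the covector variation a multiple of θ₀, and the
  -- normalization makes it 0.
  have hinj : Function.Injective (fderiv ℝ Φ (p, (θ₀, f₀)) ∘L
      ContinuousLinearMap.inr ℝ (Coord N) ((Fin N → 𝕜) × 𝕜)) := by
    rw [injective_iff_map_eq_zero]
    intro δ hδ
    have hδ' := (hder δ).symm.trans hδ
    have a : δ.1 ᵥ* M₁ p - f₀ • (δ.1 ᵥ* M₂ p) - δ.2 • (θ₀ ᵥ* M₂ p) = 0 := congrArg Prod.fst hδ'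
    have b : δ.1 ⬝ᵥ n = 0 := congrArg Prod.snd hδ'
    have swap : ∀ M : Matrix (Fin N) (Fin N) 𝕜, M.IsSymm →
        δ.1 ᵥ* M ⬝ᵥ θ₀ = θ₀ ᵥ* M ⬝ᵥ δ.1 := by
      intro M hM
      rw [← Matrix.dotProduct_mulVec, ← Matrix.vecMul_transpose, hM, dotProduct_comm]
    have e := congrArg (· ⬝ᵥ θ₀) a
    simp only [sub_dotProduct, smul_dotProduct, zero_dotProduct] at e
    rw [swap _ s₁, swap _ s₂, he, smul_dotProduct, sub_self, zero_sub, neg_eq_zero, smul_eq_mul] at e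
    have h2 : δ.2 = 0 := (mul_eq_zero.1 e).resolve_right hc
    rw [h2, zero_smul, sub_zero, sub_eq_zero] at a
    obtain ⟨c, hcδ⟩ := huniq _ a
    rw [hcδ, smul_dotProduct, hn1, smul_eq_mul, mul_one] at b
    refine Prod.ext ?_ h2
    rw [hcδ, b, zero_smul]
    rfl
  have hinv : (fderiv ℝ Φ (p, (θ₀, f₀)) ∘L
      ContinuousLinearMap.inr ℝ (Coord N) ((Fin N → 𝕜) × 𝕜)).IsInvertible := by
    refine ⟨(LinearEquiv.ofInjectiveEndo (fderiv ℝ Φ (p, (θ₀, f₀)) ∘L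
      ContinuousLinearMap.inr ℝ (Coord N) ((Fin N → 𝕜) × 𝕜) :
        ((Fin N → 𝕜) × 𝕜) →ₗ[ℝ] ((Fin N → 𝕜) × 𝕜)) hinj).toContinuousLinearEquiv, ?_⟩
    ext δ <;> rfl
  obtain ⟨ψ, hψ0, hψs, hψ⟩ := exists_smooth_implicit hsmooth h0 hinv
  refine ⟨fun x => (ψ x).1, fun x => (ψ x).2, by simp only [hψ0], by simp only [hψ0], ?_, ?_, ?_⟩
  · filter_upwards [hψs] with x hx i
    exact contDiffAt_pi.1 (contDiff_fst.contDiffAt.comp x hx) i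
  · filter_upwards [hψs] with x hx
    exact contDiff_snd.contDiffAt.comp x hx
  · have t : Filter.Tendsto (fun x => (x, ψ x)) (𝓝 p) (𝓝 (p, (θ₀, f₀))) := by
      have hψc : ContinuousAt ψ p := hψs.self_of_nhds.continuousAt
      have := continuousAt_id.prodMk hψc
      have h3 : (id p, ψ p) = (p, (θ₀, f₀)) := by rw [hψ0]; rfl
      rw [← h3]
      exact this
    filter_upwards [t.eventually hψ] with x hx
    have := congrArg Prod.fst (hx.2 rfl)
    exact sub_eq_zero.1 this

end EigenIFT

/-! ### A conjugation-stable eigencoframe near a point. -/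

section EigenCoframe

variable {N : ℕ}

/-- `Set.ncard` is 0 on infinite sets, so the case `N = 0` needs emptiness as a separate assumption.
-/
lemma exists_injective_range_eq {S : Set ℂ} (h : S.ncard = N) (h0 : N = 0 → S = ∅) :
    ∃ μ : Fin N → ℂ, Function.Injective μ ∧ Set.range μ = S := by
  rcases Nat.eq_zero_or_pos N with hN | hN
  · subst hN
    exact ⟨Fin.elim0, fun i => i.elim0, by rw [h0 rfl]; exact Set.range_eq_empty _⟩
  · have hfin : S.Finite := Set.finite_of_ncard_ne_zero (by omega)
    have hcard : hfin.toFinset.card = N := by rw [← Set.ncard_eq_toFinset_card S hfin, h]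
    refine ⟨fun i => ((Finset.equivFinOfCardEq hcard).symm i : ℂ), fun i j hij => ?_, ?_⟩
    · exact (Finset.equivFinOfCardEq hcard).symm.injective (Subtype.ext hij)
    · ext z
      constructor
      · rintro ⟨i, rfl⟩
        exact hfin.mem_toFinset.1 ((Finset.equivFinOfCardEq hcard).symm i).2
      · intro hz
        refine ⟨Finset.equivFinOfCardEq hcard ⟨z, hfin.mem_toFinset.2 hz⟩, ?_⟩
        simp

/-- Complex conjugation acts on the set of eigenvalues by an involution. -/
lemma exists_conj_perm {μ : Fin N → ℂ} (hμ : Function.Injective μ)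
    (hc : ∀ i, (starRingEnd ℂ) (μ i) ∈ Set.range μ) :
    ∃ σ : Equiv.Perm (Fin N), (∀ i, σ (σ i) = i) ∧ ∀ i, μ (σ i) = (starRingEnd ℂ) (μ i) := by
  choose s hs using hc
  have hinv : Function.Involutive s := fun i => hμ (by rw [hs, hs, Complex.conj_conj])
  exact ⟨hinv.toPerm, hinv, hs⟩

lemma vecMul_conj (v : Fin N → ℂ) (A : Matrix (Fin N) (Fin N) ℝ) :
    (fun k => (starRingEnd ℂ) (v k)) ᵥ* complexify A =
      fun k => (starRingEnd ℂ) ((v ᵥ* complexify A) k) := by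
  funext k
  simp only [Matrix.vecMul, dotProduct, map_sum, map_mul, complexify, Matrix.map_apply,
    Complex.conj_ofReal]

lemma vecMul_ofReal (v : Fin N → ℝ) (A : Matrix (Fin N) (Fin N) ℝ) :
    (fun k => (v k : ℂ)) ᵥ* complexify A = fun k => (((v ᵥ* A) k : ℝ) : ℂ) := by
  funext k
  simp only [Matrix.vecMul, dotProduct, complexify, Matrix.map_apply, Complex.ofReal_sum,
    Complex.ofReal_mul]

lemma isSymm_complexify {A : Matrix (Fin N) (Fin N) ℝ} (h : A.IsSymm) :
    (complexify A).IsSymm := by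
  rw [Matrix.IsSymm, ← complexify_transpose, h]

/-- Eigenvalues with the imaginary part zero have real eigencovectors. -/
lemma exists_eigencovector (A B : Matrix (Fin N) (Fin N) ℝ) {μ : ℂ}
    (h : (complexify A - μ • complexify B).det = 0) :
    ∃ v : Fin N → ℂ, v ≠ 0 ∧ v ᵥ* complexify A = μ • (v ᵥ* complexify B) ∧
      (μ.im = 0 → ∃ w : Fin N → ℝ, v = fun k => (w k : ℂ)) := by
  by_cases hμ : μ.im = 0
  · have hre : μ = (μ.re : ℂ) := Complex.ext rfl (by simpa using hμ)
    have hd : (A - μ.re • B).det = 0 := by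
      rw [hre, ← complexify_smul, ← complexify_sub, det_complexify] at h
      exact_mod_cast h
    obtain ⟨w, hw, hw0⟩ := Matrix.exists_vecMul_eq_zero_iff.2 hd
    refine ⟨fun k => (w k : ℂ), fun h0 => hw ?_, ?_, fun _ => ⟨w, rfl⟩⟩
    · funext k
      exact Complex.ofReal_eq_zero.1 (congrFun h0 k)
    · rw [Matrix.vecMul_sub, sub_eq_zero, Matrix.vecMul_smul] at hw0
      rw [vecMul_ofReal, vecMul_ofReal, hw0, hre]
      funext k
      simp
  · obtain ⟨v, hv, hv0⟩ := Matrix.exists_vecMul_eq_zero_iff.2 h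
    refine ⟨v, hv, ?_, fun h0 => absurd h0 hμ⟩
    rwa [Matrix.vecMul_sub, sub_eq_zero, Matrix.vecMul_smul] at hv0

/-- Near a point where a pair of metrics has distinct eigenvalues there is a smooth coframe of
eigencovectors, stable under complex conjugation. -/
lemma exists_eigen_coframe {G₁ G₂ : Coord N → Matrix (Fin N) (Fin N) ℝ} {p : Coord N}
    (h₁ : ∀ᶠ x in 𝓝 p, IsMetricNear G₁ x) (h₂ : ∀ᶠ x in 𝓝 p, IsMetricNear G₂ x)
    (hns : {μ : ℂ | (complexify (G₁ p) - μ • complexify (G₂ p)).det = 0}.ncard = N) :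
    ∃ (σ : Equiv.Perm (Fin N)) (Θ : Coord N → Matrix (Fin N) (Fin N) ℂ) (f : Coord N → Fin N → ℂ),
      (∀ i, σ (σ i) = i) ∧ (∀ i, σ i = i ↔ (f p i).im = 0) ∧
      (∀ᶠ x in 𝓝 p, SmoothEntries Θ x) ∧
      (∀ᶠ x in 𝓝 p, ∀ i, ContDiffAt ℝ ∞ (fun y => f y i) x) ∧ (Θ p).det ≠ 0 ∧
      (∀ᶠ x in 𝓝 p, Θ x * complexify (G₁ x) = Matrix.diagonal (f x) * (Θ x * complexify (G₂ x))) ∧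
      Function.Injective (f p) ∧
      (∀ x i k, Θ x (σ i) k = (starRingEnd ℂ) (Θ x i k)) ∧
      ∀ x i, f x (σ i) = (starRingEnd ℂ) (f x i) := by
  have m₁ := h₁.self_of_nhds
  have m₂ := h₂.self_of_nhds
  have y₁ := isSymm_complexify m₁.symm.self_of_nhds
  have y₂ := isSymm_complexify m₂.symm.self_of_nhds
  have hdet₂ : (complexify (G₂ p)).det ≠ 0 := by
    rw [det_complexify]; exact_mod_cast m₂.det_ne
  obtain ⟨μ, hμ, hrange⟩ := exists_injective_range_eq hns (by
    rintro rfl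
    ext z
    simp)
  have hroot : ∀ i, (complexify (G₁ p) - μ i • complexify (G₂ p)).det = 0 := fun i => by
    have : μ i ∈ Set.range μ := ⟨i, rfl⟩
    rw [hrange] at this
    exact this
  choose v hv0 hve hvr using fun i => exists_eigencovector (G₁ p) (G₂ p) (hroot i)
  have hconj : ∀ i, (starRingEnd ℂ) (μ i) ∈ Set.range μ := by
    intro i
    rw [hrange, Set.mem_ofPred_eq]
    by_contra hne
    refine hv0 i ?_
    have h0 : (fun k => (starRingEnd ℂ) (v i k)) ᵥ*
        (complexify (G₁ p) - (starRingEnd ℂ) (μ i) • complexify (G₂ p)) = 0 := by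
      rw [Matrix.vecMul_sub, sub_eq_zero, Matrix.vecMul_smul, vecMul_conj, vecMul_conj, hve]
      funext k
      simp
    have := Matrix.eq_zero_of_vecMul_eq_zero hne h0
    funext k
    have hk := congrFun this k
    simpa using hk
  obtain ⟨σ, hσσ, hσ⟩ := exists_conj_perm hμ hconj
  have hσfix : ∀ i, σ i = i ↔ (μ i).im = 0 := by
    intro i
    rw [← Complex.conj_eq_iff_im, ← hσ]
    exact ⟨fun h => by rw [h], fun h => hμ h⟩
  have hrows : Matrix.of v * complexify (G₁ p) =
      Matrix.diagonal μ * (Matrix.of v * complexify (G₂ p)) := eigenrows_iff.2 hve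
  have hsimple := eigenrow_unique (Θ := Matrix.of v) y₁ y₂ hdet₂ hμ hv0 hrows
  have hfam : ∀ i, ∃ (θ : Coord N → Fin N → ℂ) (φ : Coord N → ℂ), θ p = v i ∧ φ p = μ i ∧
      (∀ᶠ x in 𝓝 p, ∀ k, ContDiffAt ℝ ∞ (fun y => θ y k) x) ∧
      (∀ᶠ x in 𝓝 p, ContDiffAt ℝ ∞ φ x) ∧
      (∀ᶠ x in 𝓝 p, θ x ᵥ* complexify (G₁ x) = φ x • (θ x ᵥ* complexify (G₂ x))) ∧
      (σ i = i → (∀ x k, (starRingEnd ℂ) (θ x k) = θ x k) ∧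
        ∀ x, (starRingEnd ℂ) (φ x) = φ x) := by
    intro i
    obtain ⟨hc, hu⟩ := hsimple i
    -- For a real eigenvalue the implicit function theorem is applied over ℝ, so the eigencovector
    -- and eigenvalue remain real at nearby points.
    by_cases hi : σ i = i
    · have him := (hσfix i).1 hi
      obtain ⟨w, hw⟩ := hvr i him
      have hre : μ i = ((μ i).re : ℂ) := Complex.ext rfl (by simpa using him)
      have hc' : v i ᵥ* complexify (G₂ p) ⬝ᵥ v i ≠ 0 := hc
      have hve' := hve i
      obtain ⟨θ, φ, a, b, c, d, e⟩ := exists_smooth_eigencovector (𝕜 := ℝ) (M₁ := G₁) (M₂ := G₂)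
        (p := p) (θ₀ := w) (f₀ := (μ i).re) (h₁.mono fun x hx => hx.smooth)
        (h₂.mono fun x hx => hx.smooth) m₁.symm.self_of_nhds m₂.symm.self_of_nhds (by
          rw [hw, vecMul_ofReal, vecMul_ofReal, hre] at hve'
          funext k
          have := congrFun hve' k
          simp only [Pi.smul_apply, smul_eq_mul] at this ⊢
          exact_mod_cast this) (by
          intro h0
          apply hc'
          rw [hw, vecMul_ofReal]
          simp only [dotProduct] at h0 ⊢
          exact_mod_cast h0) (by
          intro z hz
          obtain ⟨c, hcz⟩ := hu (fun k => (z k : ℂ)) (by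
            rw [vecMul_ofReal, vecMul_ofReal, hz, hre]
            funext k
            simp)
          obtain ⟨k, hk⟩ : ∃ k, w k ≠ 0 := by
            by_contra! hall
            apply hv0 i
            rw [hw]
            funext k
            simp [hall k]
          have hcr : ∀ l, (z l : ℂ) = c * (w l : ℂ) := fun l => by
            have := congrFun hcz l
            simp only [Pi.smul_apply, smul_eq_mul, Matrix.of_apply] at this
            rw [this, hw]
          refine ⟨z k / w k, ?_⟩
          have hcc : c = ((z k / w k : ℝ) : ℂ) := by
            have hk' : (w k : ℂ) ≠ 0 := by exact_mod_cast hk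
            rw [Complex.ofReal_div, hcr k, mul_div_cancel_right₀ _ hk']
          funext l
          have := hcr l
          rw [hcc] at this
          simp only [Pi.smul_apply, smul_eq_mul]
          exact_mod_cast this)
      refine ⟨fun x k => (θ x k : ℂ), fun x => (φ x : ℂ), ?_, ?_, ?_, ?_, ?_, fun _ =>
        ⟨fun x k => Complex.conj_ofReal _, fun x => Complex.conj_ofReal _⟩⟩
      · simp only [a, hw]
      · simp only [b]; exact hre.symm
      · filter_upwards [c] with x hx k
        exact Complex.ofRealCLM.contDiff.contDiffAt.comp x (hx k)
      · filter_upwards [d] with x hx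
        exact Complex.ofRealCLM.contDiff.contDiffAt.comp x hx
      · filter_upwards [e] with x hx
        rw [vecMul_ofReal, vecMul_ofReal, hx]
        funext k
        simp
    · obtain ⟨θ, φ, a, b, c, d, e⟩ := exists_smooth_eigencovector (𝕜 := ℂ)
        (M₁ := fun x => complexify (G₁ x)) (M₂ := fun x => complexify (G₂ x)) (p := p)
        (h₁.mono fun x hx => hx.smooth.complexify) (h₂.mono fun x hx => hx.smooth.complexify)
        y₁ y₂ (hve i) hc hu
      exact ⟨θ, φ, a, b, c, d, e, fun h => absurd h hi⟩
  choose θ φ hθp hφp hθs hφs he hreal using hfam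
  have him : ∀ i, (μ (σ i)).im = -(μ i).im := fun i => by rw [hσ, Complex.conj_im]
  -- Each conjugate pair uses the solution for the member with positive imaginary part, and its
  -- conjugate for the other. Conjugation symmetry then holds identically, without comparing two
  -- implicit functions.
  refine ⟨σ, fun x => Matrix.of fun i k =>
      if 0 ≤ (μ i).im then θ i x k else (starRingEnd ℂ) (θ (σ i) x k),
    fun x i => if 0 ≤ (μ i).im then φ i x else (starRingEnd ℂ) (φ (σ i) x), hσσ, ?_⟩
  have hfp : (fun i => if 0 ≤ (μ i).im then φ i p else (starRingEnd ℂ) (φ (σ i) p)) = μ := by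
    funext i
    split_ifs
    · exact hφp i
    · rw [hφp, hσ, Complex.conj_conj]
  have hrow : ∀ᶠ x in 𝓝 p, (Matrix.of fun i k =>
      if 0 ≤ (μ i).im then θ i x k else (starRingEnd ℂ) (θ (σ i) x k)) * complexify (G₁ x) =
      Matrix.diagonal (fun i => if 0 ≤ (μ i).im then φ i x else (starRingEnd ℂ) (φ (σ i) x)) *
      ((Matrix.of fun i k =>
      if 0 ≤ (μ i).im then θ i x k else (starRingEnd ℂ) (θ (σ i) x k)) * complexify (G₂ x)) := by
    filter_upwards [Filter.eventually_all.2 he] with x hx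
    refine eigenrows_iff.2 fun i => ?_
    by_cases hi : 0 ≤ (μ i).im
    · have : (Matrix.of fun i k => if 0 ≤ (μ i).im then θ i x k
          else (starRingEnd ℂ) (θ (σ i) x k)) i = θ i x := by
        funext k; simp [hi]
      rw [this, if_pos hi, hx i]
    · have : (Matrix.of fun i k => if 0 ≤ (μ i).im then θ i x k
          else (starRingEnd ℂ) (θ (σ i) x k)) i = fun k => (starRingEnd ℂ) (θ (σ i) x k) := by
        funext k; simp [hi]
      rw [this, if_neg hi, vecMul_conj, vecMul_conj, hx]
      funext k
      simp
  refine ⟨fun i => ?_, ?_, ?_, ?_, hrow, ?_, ?_, ?_⟩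
  · have := congrFun hfp i
    simp only [this]
    exact hσfix i
  · filter_upwards [Filter.eventually_all.2 hθs] with x hx i k
    by_cases hi : 0 ≤ (μ i).im
    · simp only [Matrix.of_apply, if_pos hi]
      exact hx i k
    · simp only [Matrix.of_apply, if_neg hi]
      exact Complex.conjCLE.toContinuousLinearMap.contDiff.contDiffAt.comp x (hx (σ i) k)
  · filter_upwards [Filter.eventually_all.2 hφs] with x hx i
    by_cases hi : 0 ≤ (μ i).im
    · simp only [if_pos hi]
      exact hx i
    · simp only [if_neg hi]
      exact Complex.conjCLE.toContinuousLinearMap.contDiff.contDiffAt.comp x (hx (σ i))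
  · refine det_ne_zero_of_eigenrows (C₁ := complexify (G₁ p)) (φ := μ) hdet₂ hμ ?_ ?_
    · intro i h0
      by_cases hi : 0 ≤ (μ i).im
      · refine hv0 i ?_
        funext k
        have := congrFun h0 k
        simpa [hi, hθp] using this
      · refine hv0 (σ i) ?_
        funext k
        have := congrFun h0 k
        simpa [hi, hθp] using this
    · have := hrow.self_of_nhds
      rwa [hfp] at this
  · simp only [hfp]; exact hμ
  · intro x i k
    simp only [Matrix.of_apply, him, hσσ]
    rcases lt_trichotomy (μ i).im 0 with hi | hi | hi
    · rw [if_pos (by linarith), if_neg (by linarith), Complex.conj_conj]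
    · have hfix := (hσfix i).2 hi
      rw [hi, neg_zero, if_pos le_rfl, if_pos le_rfl, hfix, ((hreal i hfix).1 x k)]
    · rw [if_neg (by linarith), if_pos hi.le]
  · intro x i
    simp only [him, hσσ]
    rcases lt_trichotomy (μ i).im 0 with hi | hi | hi
    · rw [if_pos (by linarith), if_neg (by linarith), Complex.conj_conj]
    · have hfix := (hσfix i).2 hi
      rw [hi, neg_zero, if_pos le_rfl, if_pos le_rfl, hfix, ((hreal i hfix).2 x)]
    · rw [if_neg (by linarith), if_pos hi.le]

end EigenCoframe

end MetricPencil

end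

open scoped ContDiff Topology Matrix

noncomputable section

namespace MetricPencil

/-! ### Rows of a coframe as differential forms. -/

section RowForm

variable {N : ℕ}

/-- The real-linear form with the given complex coefficients. -/
def rowForm (v : Fin N → ℂ) : Coord N →L[ℝ] ℂ :=
  ∑ k, (ContinuousLinearMap.proj k : Coord N →L[ℝ] ℝ).smulRight (v k)

lemma rowForm_apply (v : Fin N → ℂ) (h : Coord N) : rowForm v h = ∑ k, (h k : ℂ) * v k := by
  simp [rowForm, sum_apply]

lemma rowForm_single (v : Fin N → ℂ) (k : Fin N) : rowForm v (Pi.single k 1) = v k := by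
  rw [rowForm_apply, Finset.sum_eq_single k]
  · simp
  · intro j _ hj
    simp [Pi.single_eq_of_ne hj]
  · simp

lemma rowForm_eq_mulVec (M : Matrix (Fin N) (Fin N) ℂ) (i : Fin N) (h : Coord N) :
    rowForm (M i) h = (M *ᵥ fun k => (h k : ℂ)) i := by
  rw [rowForm_apply, Matrix.mulVec, dotProduct]
  exact Finset.sum_congr rfl fun k _ => mul_comm _ _

lemma contDiffAt_rowForm {v : Coord N → Fin N → ℂ} {x : Coord N}
    (hv : ∀ k, ContDiffAt ℝ ∞ (fun y => v y k) x) : ContDiffAt ℝ ∞ (fun y => rowForm (v y)) x := by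
  unfold rowForm
  refine ContDiffAt.sum fun k _ => ?_
  exact ((ContinuousLinearMap.smulRightL ℝ (Coord N) ℂ
    (ContinuousLinearMap.proj k)).contDiff.contDiffAt).comp x (hv k)

lemma fderiv_rowForm {v : Coord N → Fin N → ℂ} {x : Coord N}
    (hv : ∀ k, ContDiffAt ℝ ∞ (fun y => v y k) x) (h l : Coord N) :
    fderiv ℝ (fun y => rowForm (v y)) x h l =
      ∑ m, ∑ k, pd m (fun y => v y k) x * ((h m : ℂ) * (l k : ℂ)) := by
  have hd := (contDiffAt_rowForm hv).differentiableAt (by simp)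
  have h1 : HasFDerivAt (fun y => rowForm (v y) l)
      ((fderiv ℝ (fun y => rowForm (v y)) x).flip l) x := by
    have := hd.hasFDerivAt.clm_apply (hasFDerivAt_const l x)
    simp only [ContinuousLinearMap.comp_zero, zero_add] at this
    exact this
  have h2 : fderiv ℝ (fun y => rowForm (v y)) x h l = fderiv ℝ (fun y => rowForm (v y) l) x h := by
    rw [h1.fderiv]; rfl
  rw [h2, fderiv_eq_sum_pd]
  refine Finset.sum_congr rfl fun m _ => ?_
  have h3 : pd m (fun y => rowForm (v y) l) x = ∑ k, (l k : ℂ) * pd m (fun y => v y k) x := by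
    simp only [rowForm_apply]
    have hk : ∀ k, DifferentiableAt ℝ (fun y => v y k) x := fun k =>
      (hv k).differentiableAt (by simp)
    rw [pd_sum _ fun k _ => (differentiableAt_const _).fun_mul (hk k)]
    exact Finset.sum_congr rfl fun k _ => pd_const_mul _ (hk k)
  rw [h3, Finset.smul_sum]
  refine Finset.sum_congr rfl fun k _ => ?_
  rw [Complex.real_smul]
  ring

end RowForm

/-! ### Coordinates adapted to a coframe with integrable rows. -/

section Coordinates

variable {N : ℕ} {p : Coord N}

/-- The integrability conditions for one row of a coframe and an associated eigenvalue. -/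
structure IsIntegrableRow (θ : Coord N → Fin N → ℂ) (φ : Coord N → ℂ) (x : Coord N) : Prop where
  smooth : ∀ k, ContDiffAt ℝ ∞ (fun y => θ y k) x
  smooth_eigenvalue : ContDiffAt ℝ ∞ φ x
  closed : ∀ h : Coord N, rowForm (θ x) h = 0 → ∃ k : ℂ, ∀ l : Coord N,
    fderiv ℝ (fun y => rowForm (θ y)) x h l - fderiv ℝ (fun y => rowForm (θ y)) x l h =
      k * rowForm (θ x) l
  proportional : ∃ κ : ℂ, ∀ h : Coord N, fderiv ℝ φ x h = κ * rowForm (θ x) h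

/-- A conjugation-invariant row takes real values on real vectors, so the real theorem applies to
its real part; the function of one real variable is extended to ℂ through the real part. -/
lemma exists_coordinate_of_real {θ : Coord N → Fin N → ℂ} {φ : Coord N → ℂ}
    (h : ∀ᶠ x in 𝓝 p, IsIntegrableRow θ φ x)
    (hreal : ∀ x k, (starRingEnd ℂ) (θ x k) = θ x k) (hne : ∃ k, θ p k ≠ 0) :
    ∃ (u : Coord N → ℂ) (F : ℂ → ℂ), (∀ᶠ x in 𝓝 p, ContDiffAt ℝ ∞ u x) ∧
      (∀ᶠ x in 𝓝 p, ∃ c : ℂ, c ≠ 0 ∧ ∀ k, pd k u x = c * θ x k) ∧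
      (∀ᶠ x in 𝓝 p, φ x = F (u x)) ∧ (∀ x, (starRingEnd ℂ) (u x) = u x) ∧
      ∀ᶠ t in 𝓝 (u p).re, ContDiffAt ℝ ∞ (fun t : ℝ => F t) t := by
  set η : Coord N → Coord N →L[ℝ] ℝ := fun x => Complex.reCLM.comp (rowForm (θ x)) with hη
  have hηθ : ∀ x l, ((η x l : ℝ) : ℂ) = rowForm (θ x) l := by
    intro x l
    have hz : (starRingEnd ℂ) (rowForm (θ x) l) = rowForm (θ x) l := by
      rw [rowForm_apply, map_sum]
      exact Finset.sum_congr rfl fun k _ => by rw [map_mul, Complex.conj_ofReal, hreal]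
    exact Complex.conj_eq_iff_re.1 hz
  have hηd : ∀ x, IsIntegrableRow θ φ x → ∀ a b, fderiv ℝ η x a b =
      (fderiv ℝ (fun y => rowForm (θ y)) x a b).re := by
    intro x hx a b
    have h1 : HasFDerivAt (fun y => rowForm (θ y)) (fderiv ℝ (fun y => rowForm (θ y)) x) x :=
      ((contDiffAt_rowForm hx.smooth).differentiableAt (by simp)).hasFDerivAt
    have h2 : HasFDerivAt η ((ContinuousLinearMap.compL ℝ (Coord N) ℂ ℝ Complex.reCLM).comp
        (fderiv ℝ (fun y => rowForm (θ y)) x)) x :=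
      (ContinuousLinearMap.compL ℝ (Coord N) ℂ ℝ Complex.reCLM).hasFDerivAt.comp x h1
    rw [h2.fderiv]
    rfl
  obtain ⟨u, F, hu, hc, hF, hφ⟩ := exists_real_coordinate (θ := η) (p := p) (φ := φ)
    (by
      filter_upwards [h] with x hx
      exact (ContinuousLinearMap.compL ℝ (Coord N) ℂ ℝ Complex.reCLM).contDiff.contDiffAt.comp x
        (contDiffAt_rowForm hx.smooth))
    (by
      obtain ⟨k, hk⟩ := hne
      have h0 : η p (Pi.single k 1) ≠ 0 := by
        intro h0
        have := hηθ p (Pi.single k 1)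
        rw [h0, rowForm_single] at this
        exact hk (by simpa using this.symm)
      intro t
      refine ⟨(t / η p (Pi.single k 1)) • Pi.single k 1, ?_⟩
      rw [map_smul, smul_eq_mul, div_mul_cancel₀ _ h0])
    (by
      filter_upwards [h] with x hx a b ha hb
      obtain ⟨k, hk⟩ := hx.closed a (by rw [← hηθ, ha, Complex.ofReal_zero])
      have := hk b
      rw [← hηθ x b, hb, Complex.ofReal_zero, mul_zero, sub_eq_zero] at this
      rw [hηd x hx, hηd x hx, this])
    (h.mono fun x hx => hx.smooth_eigenvalue)
    (by
      filter_upwards [h] with x hx a ha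
      obtain ⟨κ, hκ⟩ := hx.proportional
      rw [hκ, ← hηθ, ha, Complex.ofReal_zero, mul_zero])
  refine ⟨fun x => (u x : ℂ), fun z => F z.re, ?_, ?_, ?_, fun x => Complex.conj_ofReal _, ?_⟩
  · filter_upwards [hu] with x hx
    exact Complex.ofRealCLM.contDiff.contDiffAt.comp x hx
  · filter_upwards [hu, hc] with x hx hcx
    obtain ⟨c, hc0, hcx⟩ := hcx
    refine ⟨c, by exact_mod_cast hc0, fun k => ?_⟩
    rw [pd_ofReal (hx.differentiableAt (by simp)), pd, hcx, Complex.ofReal_mul, hηθ,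
      rowForm_single]
  · filter_upwards [hφ] with x hx
    rw [hx, Complex.ofReal_re]
  · simpa only [Complex.ofReal_re] using hF

lemma exists_coordinate_of_complex {θ : Coord N → Fin N → ℂ} {φ : Coord N → ℂ}
    (h : ∀ᶠ x in 𝓝 p, IsIntegrableRow θ φ x) (hsurj : Function.Surjective (rowForm (θ p))) :
    ∃ (u : Coord N → ℂ) (F : ℂ → ℂ), (∀ᶠ x in 𝓝 p, ContDiffAt ℝ ∞ u x) ∧
      (∀ᶠ x in 𝓝 p, ∃ c : ℂ, c ≠ 0 ∧ ∀ k, pd k u x = c * θ x k) ∧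
      (∀ᶠ x in 𝓝 p, φ x = F (u x)) ∧ ∀ᶠ ζ in 𝓝 (u p), DifferentiableAt ℂ F ζ := by
  obtain ⟨u, F, hu, hc, hF, hφ⟩ := exists_complex_coordinate (θ := fun x => rowForm (θ x)) (p := p)
    (φ := φ) (h.mono fun x hx => contDiffAt_rowForm hx.smooth) hsurj
    (h.mono fun x hx => hx.closed) (h.mono fun x hx => hx.smooth_eigenvalue)
    (h.mono fun x hx => hx.proportional)
  refine ⟨u, F, hu, ?_, hφ, hF⟩
  filter_upwards [hc] with x hcx
  obtain ⟨c, hc0, hcx⟩ := hcx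
  exact ⟨c, hc0, fun k => by rw [pd, hcx, rowForm_single]⟩

lemma pd_conj {v : Coord N → ℂ} {x : Coord N} (hv : DifferentiableAt ℝ v x) (m : Fin N) :
    pd m (fun y => (starRingEnd ℂ) (v y)) x = (starRingEnd ℂ) (pd m v x) := by
  have hd : HasFDerivAt (fun y => (starRingEnd ℂ) (v y))
      (Complex.conjCLE.toContinuousLinearMap.comp (fderiv ℝ v x)) x :=
    Complex.conjCLE.toContinuousLinearMap.hasFDerivAt.comp x hv.hasFDerivAt
  rw [pd, hd.fderiv]
  rfl

/-- Coordinates adapted to a conjugation-stable coframe with integrable rows. -/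
lemma exists_adapted_coordinates {σ : Equiv.Perm (Fin N)}
    {Θ : Coord N → Matrix (Fin N) (Fin N) ℂ} {f : Coord N → Fin N → ℂ} (hσ : ∀ i, σ (σ i) = i)
    (hfix : ∀ i, σ i = i ↔ (f p i).im = 0) (hdet : (Θ p).det ≠ 0)
    (hΘσ : ∀ x i k, Θ x (σ i) k = (starRingEnd ℂ) (Θ x i k))
    (hfσ : ∀ x i, f x (σ i) = (starRingEnd ℂ) (f x i))
    (h : ∀ᶠ x in 𝓝 p, ∀ i, IsIntegrableRow (fun y => Θ y i) (fun y => f y i) x) :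
    ∃ (u : Coord N → Fin N → ℂ) (F : Fin N → ℂ → ℂ),
      (∀ᶠ x in 𝓝 p, ∀ i, ContDiffAt ℝ ∞ (fun y => u y i) x) ∧
      (∀ᶠ x in 𝓝 p, ∃ c : Fin N → ℂ, (∀ i, c i ≠ 0) ∧
        jacobian u x = Matrix.diagonal c * Θ x) ∧
      (∀ᶠ x in 𝓝 p, ∀ i, f x i = F i (u x i)) ∧
      (∀ x i, u x (σ i) = (starRingEnd ℂ) (u x i)) ∧
      (∀ i, σ i = i → ∀ᶠ t in 𝓝 (u p i).re, ContDiffAt ℝ ∞ (fun t : ℝ => F i t) t) ∧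
      ∀ i, σ i ≠ i → ∀ᶠ ζ in 𝓝 (u p i), DifferentiableAt ℂ (F i) ζ := by
  have hfam : ∀ i, ∃ (u : Coord N → ℂ) (F : ℂ → ℂ), (∀ᶠ x in 𝓝 p, ContDiffAt ℝ ∞ u x) ∧
      (∀ᶠ x in 𝓝 p, ∃ c : ℂ, c ≠ 0 ∧ ∀ k, pd k u x = c * Θ x i k) ∧
      (∀ᶠ x in 𝓝 p, f x i = F (u x)) ∧
      (σ i = i → (∀ x, (starRingEnd ℂ) (u x) = u x) ∧
        ∀ᶠ t in 𝓝 (u p).re, ContDiffAt ℝ ∞ (fun t : ℝ => F t) t) ∧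
      (σ i ≠ i → ∀ᶠ ζ in 𝓝 (u p), DifferentiableAt ℂ F ζ) := by
    intro i
    have hi : ∀ᶠ x in 𝓝 p, IsIntegrableRow (fun y => Θ y i) (fun y => f y i) x :=
      h.mono fun x hx => hx i
    by_cases hs : σ i = i
    · obtain ⟨u, F, a, b, c, d, e⟩ := exists_coordinate_of_real hi
        (fun x k => by rw [← hΘσ, hs]) (row_ne_zero hdet i)
      exact ⟨u, F, a, b, c, fun _ => ⟨d, e⟩, fun h => absurd hs h⟩
    · obtain ⟨u, F, a, b, c, d⟩ := exists_coordinate_of_complex hi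
        (surjective_of_conj_rows hdet (Ne.symm hs) (hΘσ p i) _ fun k => rowForm_single _ k)
      exact ⟨u, F, a, b, c, fun h => absurd h hs, fun _ => d⟩
  choose u F hus huc huf hur huh using hfam
  have him : ∀ i, (f p (σ i)).im = -(f p i).im := fun i => by rw [hfσ, Complex.conj_im]
  -- One coordinate is kept from each conjugate pair and its partner is defined as the conjugate.
  -- The partner's function is the conjugate of F(z̄), again holomorphic.
  refine ⟨fun x i => if 0 ≤ (f p i).im then u i x else (starRingEnd ℂ) (u (σ i) x),
    fun i z => if 0 ≤ (f p i).im then F i z else (starRingEnd ℂ) (F (σ i) ((starRingEnd ℂ) z)),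
    ?_, ?_, ?_, ?_, ?_, ?_⟩
  · filter_upwards [Filter.eventually_all.2 hus] with x hx i
    by_cases hi : 0 ≤ (f p i).im
    · simp only [if_pos hi]
      exact hx i
    · simp only [if_neg hi]
      exact Complex.conjCLE.toContinuousLinearMap.contDiff.contDiffAt.comp x (hx (σ i))
  · filter_upwards [Filter.eventually_all.2 hus, Filter.eventually_all.2 huc] with x hx hcx
    choose c hc0 hcx using hcx
    refine ⟨fun i => if 0 ≤ (f p i).im then c i else (starRingEnd ℂ) (c (σ i)), fun i => ?_, ?_⟩
    · by_cases hi : 0 ≤ (f p i).im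
      · simp only [if_pos hi]
        exact hc0 i
      · simp only [if_neg hi]
        exact (map_ne_zero _).2 (hc0 (σ i))
    · ext i k
      rw [Matrix.diagonal_mul, jacobian, Matrix.of_apply]
      by_cases hi : 0 ≤ (f p i).im
      · simp only [if_pos hi]
        exact hcx i k
      · simp only [if_neg hi]
        rw [pd_conj ((hx (σ i)).differentiableAt (by simp)), hcx, map_mul, hΘσ, Complex.conj_conj]
  · filter_upwards [Filter.eventually_all.2 huf] with x hx i
    by_cases hi : 0 ≤ (f p i).im
    · simp only [if_pos hi]
      exact hx i
    · simp only [if_neg hi]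
      rw [Complex.conj_conj, ← hx, hfσ, Complex.conj_conj]
  · intro x i
    simp only [him, hσ]
    rcases lt_trichotomy (f p i).im 0 with hi | hi | hi
    · rw [if_pos (by linarith), if_neg (by linarith), Complex.conj_conj]
    · have hs := (hfix i).2 hi
      rw [hi, neg_zero, if_pos le_rfl, if_pos le_rfl, hs, ((hur i hs).1 x)]
    · rw [if_neg (by linarith), if_pos hi.le]
  · intro i hs
    have hi := ((hfix i).1 hs).ge
    simp only [if_pos hi]
    exact (hur i hs).2
  · intro i hs
    by_cases hi : 0 ≤ (f p i).im
    · simp only [if_pos hi]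
      exact huh i hs
    · simp only [if_neg hi]
      have hs' : σ (σ i) ≠ σ i := fun h => hs (σ.injective h)
      have t : Filter.Tendsto (starRingEnd ℂ) (𝓝 ((starRingEnd ℂ) (u (σ i) p)))
          (𝓝 (u (σ i) p)) := by
        have := Complex.continuous_conj.tendsto ((starRingEnd ℂ) (u (σ i) p))
        rwa [Complex.conj_conj] at this
      filter_upwards [t.eventually (huh (σ i) hs')] with ζ hζ
      have := hζ.conj_conj
      rwa [Complex.conj_conj] at this

/-- Complex coordinate functions with a nondegenerate Jacobian matrix are locally injective. -/
lemma exists_nhds_injOn {u : Coord N → Fin N → ℂ} (hu : ∀ i, ContDiffAt ℝ ∞ (fun y => u y i) p)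
    (hdet : (jacobian u p).det ≠ 0) : ∃ V ∈ 𝓝 p, Set.InjOn u V := by
  have hu' : ContDiffAt ℝ ∞ u p := contDiffAt_pi.2 hu
  have hs : HasStrictFDerivAt u (fderiv ℝ u p) p := hu'.hasStrictFDerivAt (by simp)
  have hinj : LinearMap.ker (fderiv ℝ u p : Coord N →ₗ[ℝ] (Fin N → ℂ)) = ⊥ := by
    refine LinearMap.ker_eq_bot'.2 fun h hh => ?_
    have h1 : ∀ i, fderiv ℝ (fun y => u y i) p h = 0 := by
      intro i
      have : HasFDerivAt (fun y => u y i) ((ContinuousLinearMap.proj i).comp (fderiv ℝ u p)) p :=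
        (hasFDerivAt_pi'.1 hs.hasFDerivAt) i
      rw [this.fderiv]
      exact congrFun hh i
    have h2 : jacobian u p *ᵥ (fun k => (h k : ℂ)) = 0 := by
      funext i
      have := h1 i
      rw [fderiv_eq_sum_pd] at this
      rw [Matrix.mulVec, dotProduct, Pi.zero_apply, ← this]
      exact Finset.sum_congr rfl fun k _ => by rw [Complex.real_smul, mul_comm]; rfl
    have h3 := Matrix.eq_zero_of_mulVec_eq_zero hdet h2
    funext k
    exact Complex.ofReal_eq_zero.1 (congrFun h3 k)
  -- The map goes into ℂ^N, of twice the real dimension, so its derivative is only injective. A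
  -- linear left inverse reduces to the inverse function theorem.
  obtain ⟨R, hR⟩ := LinearMap.exists_leftInverse_of_injective _ hinj
  have hRs : HasStrictFDerivAt (fun y => LinearMap.toContinuousLinearMap R (u y))
      ((ContinuousLinearEquiv.refl ℝ (Coord N) : Coord N →L[ℝ] Coord N)) p := by
    have := (LinearMap.toContinuousLinearMap R).hasStrictFDerivAt.comp p hs
    have hE : LinearMap.toContinuousLinearMap R ∘L fderiv ℝ u p =
        (ContinuousLinearEquiv.refl ℝ (Coord N) : Coord N →L[ℝ] Coord N) :=
      ContinuousLinearMap.ext fun h => LinearMap.congr_fun hR h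
    rw [hE] at this
    exact this
  refine ⟨_, hRs.eventually_left_inverse, fun x hx y hy hxy => ?_⟩
  rw [← hx, ← hy]
  simp only [hxy]

end Coordinates

/-! ### From compatibility to the diagonal form. -/

section Forward

variable {N : ℕ} {Ω : Set (Coord N)} {G₁ G₂ : Coord N → Matrix (Fin N) (Fin N) ℝ}

lemma exists_pencil_det_ne_zero {A B : Matrix (Fin N) (Fin N) ℝ} (hA : A.det ≠ 0) :
    ∃ ε : ℝ, ε ≠ 0 ∧ ((1 : ℝ) • A + ε • B).det ≠ 0 := by
  have hc : Continuous fun ε : ℝ => ((1 : ℝ) • A + ε • B).det := by fun_prop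
  have h0 : ∀ᶠ ε in 𝓝 (0 : ℝ), ((1 : ℝ) • A + ε • B).det ≠ 0 :=
    hc.continuousAt.eventually_ne (by simpa using hA)
  have h1 : ∀ᶠ ε in 𝓝[≠] (0 : ℝ), ε ≠ 0 ∧ ((1 : ℝ) • A + ε • B).det ≠ 0 := by
    filter_upwards [self_mem_nhdsWithin, h0.filter_mono nhdsWithin_le_nhds] with ε a b
    exact ⟨a, b⟩
  exact h1.exists

/-- A nonsingular compatible pair has the diagonal form in suitable local coordinates. -/
lemma Compatible.locallyDiagonal (hΩ : IsOpen Ω) (hG₁ : IsMetric Ω G₁) (hG₂ : IsMetric Ω G₂)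
    (hns : IsNonsingularPair Ω G₁ G₂) (hcomp : Compatible Ω G₁ G₂) :
    LocallyDiagonal Ω G₁ G₂ := by
  intro p hp
  have hΩp : ∀ᶠ x in 𝓝 p, x ∈ Ω := hΩ.mem_nhds hp
  have h₁ : ∀ᶠ x in 𝓝 p, IsMetricNear G₁ x := hΩp.mono fun x hx => hG₁.isMetricNear hΩ hx
  have h₂ : ∀ᶠ x in 𝓝 p, IsMetricNear G₂ x := hΩp.mono fun x hx => hG₂.isMetricNear hΩ hx
  obtain ⟨σ, Θ, f, hσ, hfix, hΘs, hfs, hdet, hrow, hfinj, hΘσ, hfσ⟩ :=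
    exists_eigen_coframe h₁ h₂ (hns p hp)
  have hdet' : ∀ᶠ x in 𝓝 p, (Θ x).det ≠ 0 :=
    hΘs.self_of_nhds.det.continuousAt.eventually_ne hdet
  have hfinj' : ∀ᶠ x in 𝓝 p, Function.Injective (f x) := by
    have : ∀ᶠ x in 𝓝 p, ∀ i j, i ≠ j → f x i - f x j ≠ 0 := by
      refine Filter.eventually_all.2 fun i => Filter.eventually_all.2 fun j => ?_
      by_cases hij : i = j
      · exact Filter.Eventually.of_forall fun x h => absurd hij h
      · have hc := hfs.self_of_nhds
        have := ((hc i).continuousAt.sub (hc j).continuousAt).eventually_ne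
          (sub_ne_zero.2 fun h => hij (hfinj h))
        exact this.mono fun x hx _ => hx
    filter_upwards [this] with x hx i j hij
    by_contra hne
    exact hx i j hne (sub_eq_zero.2 hij)
  have hsym : ∀ᶠ x in 𝓝 p, (complexify (G₁ x)).IsSymm ∧ (complexify (G₂ x)).IsSymm := by
    filter_upwards [hΩp] with x hx
    exact ⟨isSymm_complexify (hG₁.symm x hx), isSymm_complexify (hG₂.symm x hx)⟩
  have hdiag : ∀ᶠ x in 𝓝 p,
      Θ x * complexify (G₂ x) * (Θ x)ᵀ =
        Matrix.diagonal (fun i => (Θ x * complexify (G₂ x) * (Θ x)ᵀ) i i) ∧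
      Θ x * complexify (G₁ x) * (Θ x)ᵀ =
        Matrix.diagonal (fun i => f x i * (Θ x * complexify (G₂ x) * (Θ x)ᵀ) i i) := by
    filter_upwards [hsym, hfinj', hrow] with x a b c
    exact diagonal_of_eigenrows a.1 a.2 b c
  obtain ⟨ε, hε, hεd⟩ := exists_pencil_det_ne_zero (B := G₂ p) (hG₁.nondegenerate p hp)
  have hεd' : ∀ᶠ x in 𝓝 p, (pencil 1 ε G₁ G₂ x).det ≠ 0 :=
    (h₁.self_of_nhds.pencil h₂.self_of_nhds hεd).eventually_det
  have hintg : ∀ᶠ x in 𝓝 p, ∀ i, IsIntegrableRow (fun y => Θ y i) (fun y => f y i) x := by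
    filter_upwards [hΩp, hΘs, hfs, hdet', hfinj', hεd', hdiag.eventually_nhds] with x hx a b c d e
      hd i
    obtain ⟨I, κ, hκ⟩ := integrable_of_connection (h := fun y i =>
      (Θ y * complexify (G₂ y) * (Θ y)ᵀ) i i) (hG₁.isMetricNear hΩ hx) (hG₂.isMetricNear hΩ hx) a c
      (hd.mono fun y hy => hy.2) (hd.mono fun y hy => hy.1)
      (fun i => (b i).differentiableAt (by simp)) (fun i j hij h => hij (d h)) hε e
      (hcomp 1 ε x hx e).1 i
    refine ⟨a i, b i, fun h hh => ?_, κ, fun h => ?_⟩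
    · obtain ⟨k, hk⟩ := I (fun m => (h m : ℂ)) (by rw [← rowForm_eq_mulVec]; exact hh)
      refine ⟨k, fun l => ?_⟩
      rw [fderiv_rowForm (a i), fderiv_rowForm (a i), rowForm_eq_mulVec, ← hk]
      simp only [← Finset.sum_sub_distrib, mul_sub]
    · rw [rowForm_eq_mulVec, ← hκ, fderiv_eq_sum_pd]
      exact Finset.sum_congr rfl fun m _ => by rw [Complex.real_smul, mul_comm]
  obtain ⟨u, F, hus, huJ, huf, hconj, hreal, hhol⟩ :=
    exists_adapted_coordinates hσ hfix hdet hΘσ hfσ hintg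
  have hJdet : ∀ᶠ x in 𝓝 p, (jacobian u x).det ≠ 0 := by
    filter_upwards [huJ, hdet'] with x a b
    obtain ⟨c, hc, hJ⟩ := a
    rw [hJ, Matrix.det_mul, Matrix.det_diagonal]
    exact mul_ne_zero (Finset.prod_ne_zero_iff.2 fun i _ => hc i) b
  -- Each row of the Jacobian is a nonzero multiple of an eigencovector, hence itself an
  -- eigencovector for the same eigenvalue. Orthogonality diagonalizes both metrics in the new
  -- coordinates.
  have hJform : ∀ᶠ x in 𝓝 p,
      inCoordinates G₂ u x = Matrix.diagonal (fun i => inCoordinates G₂ u x i i) ∧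
      inCoordinates G₁ u x = Matrix.diagonal (fun i => f x i * inCoordinates G₂ u x i i) := by
    filter_upwards [huJ, hsym, hfinj', hrow] with x a b c d
    refine diagonal_of_eigenrows b.1 b.2 c ?_
    obtain ⟨c, -, hJ⟩ := a
    rw [hJ, Matrix.mul_assoc, d, Matrix.mul_assoc, ← Matrix.mul_assoc (Matrix.diagonal c),
      ← Matrix.mul_assoc (Matrix.diagonal (f x)), Matrix.diagonal_mul_diagonal,
      Matrix.diagonal_mul_diagonal]
    congr 2
    funext i
    exact mul_comm _ _
  obtain ⟨V, hV, hVinj⟩ := exists_nhds_injOn hus.self_of_nhds hJdet.self_of_nhds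
  have hcont : ∀ i, ContinuousAt (fun y => u y i) p := fun i =>
    (hus.self_of_nhds i).continuousAt
  have hgood : ∀ᶠ x in 𝓝 p, (∀ i, σ i = i → ContDiffAt ℝ ∞ (fun t : ℝ => F i t) (u x i).re) ∧
      ∀ i, σ i ≠ i → DifferentiableAt ℂ (F i) (u x i) := by
    refine (Filter.eventually_all.2 fun i => ?_).and (Filter.eventually_all.2 fun i => ?_)
    · by_cases hs : σ i = i
      · have := (Complex.continuous_re.continuousAt.comp (hcont i)).tendsto.eventually (hreal i hs)
        exact this.mono fun x hx _ => hx
      · exact Filter.Eventually.of_forall fun x h => absurd h hs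
    · by_cases hs : σ i = i
      · exact Filter.Eventually.of_forall fun x h => absurd hs h
      · have := (hcont i).tendsto.eventually (hhol i hs)
        exact this.mono fun x hx _ => hx
  have hall := hΩp.and (hus.and (hJdet.and (hJform.and (hgood.and (huf.and hV)))))
  obtain ⟨U, hU, hUo, hpU⟩ := eventually_nhds_iff.1 hall
  refine ⟨U, σ, u, F, fun i x => inCoordinates G₂ u x i i, hpU, fun x hx => (hU x hx).1, ?_⟩
  refine ⟨⟨hUo, hσ, fun x _ => hconj x, fun i x hx => ?_, fun x hx y hy hxy => ?_, fun x hx => ?_⟩,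
    ?_, ?_, ?_, ?_⟩
  · exact ((hU x hx).2.1 i).contDiffWithinAt
  · exact hVinj (hU x hx).2.2.2.2.2.2 (hU y hy).2.2.2.2.2.2 hxy
  · exact (hU x hx).2.2.1
  · rintro i hs t ⟨x, hx, hxt⟩
    have := (hU x hx).2.2.2.2.1.1 i hs
    rw [hxt, Complex.ofReal_re] at this
    exact this.contDiffWithinAt
  · rintro i hs _ ⟨x, hx, rfl⟩
    exact ((hU x hx).2.2.2.2.1.2 i hs).differentiableWithinAt
  · exact fun x hx => (hU x hx).2.2.2.1.1
  · intro x hx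
    rw [(hU x hx).2.2.2.1.2]
    congr 1
    funext i
    rw [(hU x hx).2.2.2.2.2.1 i]

end Forward

end MetricPencil

end

theorem theorem5 (N : ℕ) (Ω : Set (MetricPencil.Coord N)) (hΩ : IsOpen Ω)
    (G₁ G₂ : MetricPencil.Coord N → Matrix (Fin N) (Fin N) ℝ)
    (hG₁ : MetricPencil.IsMetric Ω G₁) (hG₂ : MetricPencil.IsMetric Ω G₂) :
    -- a nonsingular pair is compatible iff it has the diagonal form in suitable local coordinates
    (MetricPencil.IsNonsingularPair Ω G₁ G₂ →
      (MetricPencil.Compatible Ω G₁ G₂ ↔ MetricPencil.LocallyDiagonal Ω G₁ G₂)) ∧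
    -- pairs of the diagonal form are compatible even if they are singular
    (MetricPencil.LocallyDiagonal Ω G₁ G₂ → MetricPencil.Compatible Ω G₁ G₂) ∧
    -- the functions `f^i` do not vanish, and for a nonsingular pair their values are distinct
    (∀ (U : Set (MetricPencil.Coord N)) (σ : Equiv.Perm (Fin N))
      (u : MetricPencil.Coord N → Fin N → ℂ) (f : Fin N → ℂ → ℂ)
      (g : Fin N → MetricPencil.Coord N → ℂ), U ⊆ Ω →
      MetricPencil.IsDiagonalForm U G₁ G₂ σ u f g →
      (∀ x ∈ U, ∀ i, f i (u x i) ≠ 0) ∧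
      (MetricPencil.IsNonsingularPair Ω G₁ G₂ →
        ∀ x ∈ U, ∀ i j, i ≠ j → f i (u x i) ≠ f j (u x j))) := by
  have hdc := fun h => MetricPencil.LocallyDiagonal.compatible hΩ hG₁ hG₂ h
  exact ⟨fun hns => ⟨fun h => h.locallyDiagonal hΩ hG₁ hG₂ hns, hdc⟩, hdc,
    fun U σ u f g hU h => h.factor_ne hG₁ hG₂ hU⟩
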